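/- All manifolds and vector bundles are real, smooth and finite-dimensional, and vector bundles have constant rank. Let $(D;A,B;M)$ be a double vector bundle with core $C$, let $C^*$ be the dual vector bundle of $C$, with projection $q_{C^*}\colon C^*\to M$, and assume $\operatorname{rank}A+\operatorname{rank}B\neq 1$. Let Lie algebroid structures on $A\to M$, $B\to M$ (anchors $\rho_A,\rho_B$), $D\to A$ and $D\to B$ make $D$ a double Lie algebroid. That is, $(D\to B;A\to M)$ and $(D\to A;B\to M)$ are VB-algebroids, and the duals $D^{*A}$, $D^{*B}$ of $D\to A$, $D\to B$, regarded as vector bundles over $C^*$ with the Lie algebroid structures induced by $(D\to B;A\to M)$ and $(D\to A;B\to M)$ respectively, and in duality through the pairing $\langle\!\langle\Phi,\Psi\rangle\!\rangle=\langle\Phi,d\rangle_A-\langle\Psi,d\rangle_B$ (for any $d\in D$ lying over the same points of $A$ and $B$ as $\Phi$ and $\Psi$), form a Lie bialgebroid: $\mathrm d_*[X,Y]=[\mathrm d_*X,Y]+[X,\mathrm d_*Y]$ for all sections $X,Y$ of $D^{*A}\to C^*$, where $\mathrm d_*$ is the Lie algebroid differential of $D^{*B}$. (The induced structure on $D^{*A}\to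 C^*$ is the one dual to the linear Poisson structure on $D^{*B}$ that is dual to $D\to B$, under the identification $\Phi\mapsto-\langle\!\langle\Phi,\cdot\rangle\!\rangle$ of $D^{*A}$ with the dual of $D^{*B}\to C^*$; the one on $D^{*B}\to C^*$ is obtained in the same way from $D\to A$ through $\Psi\mapsto\langle\!\langle\cdot,\Psi\rangle\!\rangle$.) Let $\Theta_A\colon D^{*A}\to TC^*$ and $\Theta_B\colon D^{*B}\to TC^*$ be the anchors. Let $\Sigma\colon A\times_MB\to D$ be a linear splitting, with lifts $\sigma_A(a)(b_m)=\Sigma(a(m),b_m)$ and $\sigma_B(b)(a_m)=\Sigma(a_m,b(m))$. For $c\in\Gamma(C)$ let $c^\dagger$ denote the corresponding core section of $D\to B$ or of $D\to A$. The core-anchors $\partial_B\colon C\to B$ and $\partial_A\colon C\to A$ are defined by the condition that the anchors of $D\to B$ and $D\to A$ send $c^\dagger$ to the vertical lifts of $\partial_Bc$ and $\partial_Ac$ respectively. The connections $\nabla_ac$ and $\nabla_bc$, for $a\in\Gamma(A)$, $b\in\Gamma(B)$ and $c\in\Gamma(C)$, are defined by $[\sigma_A(a),c^\dagger]=(\nabla_ac)^\dagger$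 in $\Gamma_B(D)$ and $[\sigma_B(b),c^\dagger]=(\nabla_bc)^\dagger$ in $\Gamma_A(D)$. Then $\rho_A\circ\partial_A=\rho_B\circ\partial_B$, and $C$ is a Lie algebroid over $M$ with this map as anchor and with the bracket $$[c_1,c_2]=\nabla_{\partial_Ac_1}c_2-\nabla_{\partial_Bc_2}c_1\qquad(c_1,c_2\in\Gamma(C)).$$ Moreover $\{F,G\}=\langle \mathrm dG,(\Theta_B\circ\Theta_A^*)(\mathrm dF)\rangle$ is a Poisson bracket on $C^\infty(C^*)$ (the Poisson structure induced by the Lie bialgebroid $(D^{*A},D^{*B})$; here $\Theta_A^*\colon T^*C^*\to D^{*B}$ is the dual of $\Theta_A$ with respect to $\langle\!\langle\cdot,\cdot\rangle\!\rangle$), and it is the linear Poisson structure dual to this Lie algebroid $C$: for all $c,c_1,c_2\in\Gamma(C)$ and $f,f_1,f_2\in C^\infty(M)$, $$\{\ell_{c_1},\ell_{c_2}\}=\ell_{[c_1,c_2]},\qquad \{\ell_c,q_{C^*}^*f\}=q_{C^*}^*\bigl(\rho_A(\partial_Ac)f\bigr),\qquad \{q_{C^*}^*f_1,q_{C^*}^*f_2\}=0,$$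 where $\ell_c\colon C^*\to\mathbb R$ is the fibrewise linear function defined by $c$. -/

import Mathlib

open Bundle
open scoped Manifold ContDiff Bundle

noncomputable section

universe uF uV

set_option linter.checkUnivs false

/-- The differential at `x` of a real function on a manifold. -/
def diffAt {EN HN : Type*} [NormedAddCommGroup EN] [NormedSpace ℝ EN] [TopologicalSpace HN]
    (I : ModelWithCorners ℝ EN HN) {N : Type*} [TopologicalSpace N] [ChartedSpace HN N]
    (f : N → ℝ) (x : N) : TangentSpace I x →L[ℝ] ℝ :=
  mfderiv I 𝓘(ℝ, ℝ) f x

/-! ### Smooth vector bundles -/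

/-- A smooth real vector bundle of finite rank over `N` (Mathlib's notion, bundled), with fibres
`V x` and model fibre `F`. -/
structure SmoothVB {EN HN : Type*} [NormedAddCommGroup EN] [NormedSpace ℝ EN] [TopologicalSpace HN]
    (I : ModelWithCorners ℝ EN HN) (N : Type*) [TopologicalSpace N] [ChartedSpace HN N] where
  F : Type uF
  V : N → Type uV
  [instF : NormedAddCommGroup F]
  [instFS : NormedSpace ℝ F]
  [instFD : FiniteDimensional ℝ F]
  [instV : ∀ x, AddCommGroup (V x)]
  [instVM : ∀ x, Module ℝ (V x)]
  [instVT : ∀ x, TopologicalSpace (V x)]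
  [instVA : ∀ x, IsTopologicalAddGroup (V x)]
  [instVC : ∀ x, ContinuousSMul ℝ (V x)]
  [instT : TopologicalSpace (TotalSpace F V)]
  [instFB : FiberBundle F V]
  [instVB : VectorBundle ℝ F V]
  [instSm : ContMDiffVectorBundle ∞ F V I]

attribute [instance] SmoothVB.instF SmoothVB.instFS SmoothVB.instFD SmoothVB.instV SmoothVB.instVM
  SmoothVB.instVT SmoothVB.instVA SmoothVB.instVC SmoothVB.instT SmoothVB.instFB SmoothVB.instVB
  SmoothVB.instSm

namespace SmoothVB

variable {EN HN : Type*} [NormedAddCommGroup EN] [NormedSpace ℝ EN] [TopologicalSpace HN]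
  {I : ModelWithCorners ℝ EN HN} {N : Type*} [TopologicalSpace N] [ChartedSpace HN N]

/-- The total space. -/
abbrev Tot (E : SmoothVB I N) := TotalSpace E.F E.V

/-- The model with corners of the total space. -/
abbrev model (E : SmoothVB I N) := I.prod 𝓘(ℝ, E.F)

/-- The space `Γ(E)` of smooth sections. -/
abbrev Sec (E : SmoothVB I N) := Cₛ^∞⟮I; E.F, E.V⟯

/-- The dual vector bundle. -/
abbrev dual [IsManifold I ∞ N] (E : SmoothVB I N) : SmoothVB I N where
  F := E.F →L[ℝ] ℝ
  V := fun x => E.V x →L[ℝ] Bundle.Trivial N ℝ x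

/-- The zero vector over `x`. -/
def zeroT (E : SmoothVB I N) (x : N) : E.Tot := ⟨x, 0⟩

/-- Fibrewise scalar multiplication. -/
def smulT (E : SmoothVB I N) (r : ℝ) (v : E.Tot) : E.Tot := ⟨v.1, r • v.2⟩

/-- `v` and `w` lie in the same fibre and `u` is their sum. -/
def IsAdd (E : SmoothVB I N) (v w u : E.Tot) : Prop :=
  ∃ (x : N) (a b : E.V x), v = ⟨x, a⟩ ∧ w = ⟨x, b⟩ ∧ u = ⟨x, a + b⟩

/-- The product `f • s` of a section and a function. -/
def fsmul (E : SmoothVB I N) (f : C^∞⟮I, N; ℝ⟯) (s : E.Sec) : E.Sec where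
  toFun := (f : N → ℝ) • (s : ∀ x, E.V x)
  contMDiff_toFun := f.contMDiff.smul_section s.contMDiff

/-- The fibrewise linear function `ℓ_ξ` on the dual bundle defined by a section `ξ`. -/
def ell [IsManifold I ∞ N] (E : SmoothVB I N) (ξ : E.Sec) :
    C^∞⟮E.dual.model, E.dual.Tot; ℝ⟯ where
  val := fun φ => φ.2 (ξ φ.1)
  property := by
    have h1 := ContMDiff.clm_bundle_apply (n := ∞) (IB := I) (F₁ := E.F) (E₁ := E.V) (F₂ := ℝ)
      (E₂ := Bundle.Trivial N ℝ) (IM := E.dual.model) (M := E.dual.Tot)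
      (b := fun φ : E.dual.Tot => φ.1)
      (ϕ := fun φ => φ.2) (v := fun φ => ξ φ.1) contMDiff_id
      (ξ.contMDiff.comp (contMDiff_proj E.dual.V))
    intro x
    have h2 := (contMDiffAt_totalSpace.1 (h1 x)).2
    simpa using h2

/-- The pullback `q^* f` to the total space of a function on the base. -/
def pull (E : SmoothVB I N) (f : C^∞⟮I, N; ℝ⟯) : C^∞⟮E.model, E.Tot; ℝ⟯ :=
  ⟨fun e => f e.1, f.contMDiff.comp (contMDiff_proj E.V)⟩

/-- The evaluation of `φ` in the dual bundle on `v` in the same fibre. -/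
def eval [IsManifold I ∞ N] (E : SmoothVB I N) (φ : E.dual.Tot) (v : E.Tot) : ℝ :=
  open scoped Classical in if h : v.1 = φ.1 then φ.2 (h ▸ v.2) else 0

theorem eval_mk [IsManifold I ∞ N] (E : SmoothVB I N) (x : N) (φ : E.dual.V x) (v : E.V x) :
    E.eval ⟨x, φ⟩ ⟨x, v⟩ = φ v := by
  simp [eval]

/-- The vertical lift of `v` at `e`: the velocity at `t = 0` of `t ↦ e + t v`. -/
def vertLift (E : SmoothVB I N) (e : E.Tot) (v : E.V e.1) : TangentSpace E.model e :=
  mfderiv 𝓘(ℝ, ℝ) E.model (fun t : ℝ => (⟨e.1, e.2 + t • v⟩ : E.Tot)) 0 (1 : ℝ)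

/-- Addition in the vector bundle `TE → TN`, i.e. the tangent of the fibrewise addition
`E ⊕ E → E`: there is a tangent vector of `E ⊕ E` with components `v` and `w`
that is sent to `u`. -/
def IsTangentAdd (E : SmoothVB I N) (v w u : TangentBundle E.model E.Tot) : Prop :=
  ∃ z : TangentBundle (I.prod 𝓘(ℝ, E.F × E.F)) (TotalSpace (E.F × E.F) (E.V ×ᵇ E.V)),
    tangentMap (I.prod 𝓘(ℝ, E.F × E.F)) E.model
      (fun p : TotalSpace (E.F × E.F) (E.V ×ᵇ E.V) => (⟨p.1, p.2.1⟩ : E.Tot)) z = v ∧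
    tangentMap (I.prod 𝓘(ℝ, E.F × E.F)) E.model
      (fun p : TotalSpace (E.F × E.F) (E.V ×ᵇ E.V) => (⟨p.1, p.2.2⟩ : E.Tot)) z = w ∧
    tangentMap (I.prod 𝓘(ℝ, E.F × E.F)) E.model
      (fun p : TotalSpace (E.F × E.F) (E.V ×ᵇ E.V) => (⟨p.1, p.2.1 + p.2.2⟩ : E.Tot)) z = u

end SmoothVB

/-! ### Lie algebroids and Poisson structures -/

section Algebroids

variable {EN HN : Type*} [NormedAddCommGroup EN] [NormedSpace ℝ EN] [TopologicalSpace HN]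
  {I : ModelWithCorners ℝ EN HN} {N : Type*} [TopologicalSpace N] [ChartedSpace HN N]

/-- A Lie algebroid structure on the vector bundle `E`. -/
structure LieAlgebroid [IsManifold I ∞ N] (E : SmoothVB I N) where
  anchor : ∀ x, E.V x →L[ℝ] TangentSpace I x
  anchor_smooth : ContMDiff E.model I.tangent ∞
    (fun v : E.Tot => (⟨v.1, anchor v.1 v.2⟩ : TangentBundle I N))
  bracket : E.Sec →ₗ[ℝ] E.Sec →ₗ[ℝ] E.Sec
  bracket_self : ∀ a, bracket a a = 0
  jacobi : ∀ a b c,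
    bracket a (bracket b c) = bracket (bracket a b) c + bracket b (bracket a c)
  leibniz : ∀ (a b : E.Sec) (f : C^∞⟮I, N; ℝ⟯) (x : N),
    bracket a (E.fsmul f b) x = f x • bracket a b x + diffAt I f x (anchor x (a x)) • b x

/-- A Poisson structure on a manifold, as a Poisson bracket on its smooth functions. -/
structure PoissonStructure (I : ModelWithCorners ℝ EN HN) (N : Type*) [TopologicalSpace N]
    [ChartedSpace HN N] where
  br : C^∞⟮I, N; ℝ⟯ →ₗ[ℝ] C^∞⟮I, N; ℝ⟯ →ₗ[ℝ] C^∞⟮I, N; ℝ⟯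
  br_self : ∀ f, br f f = 0
  jacobi : ∀ f g h, br f (br g h) = br (br f g) h + br g (br f h)
  leibniz : ∀ f g h, br f (g * h) = br f g * h + g * br f h

variable [IsManifold I ∞ N]

/-- `P` is the linear Poisson structure on `E^*` dual to the Lie algebroid structure on `E`:
`{ℓ_ξ, ℓ_η} = ℓ_[ξ, η]`, `{ℓ_ξ, q^* f} = q^*(ρ(ξ) f)` and `{q^* f, q^* g} = 0`. -/
structure IsDualPoisson {E : SmoothVB I N} (L : LieAlgebroid E)
    (P : PoissonStructure E.dual.model E.dual.Tot) : Prop where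
  ell_ell : ∀ ξ η : E.Sec, P.br (E.ell ξ) (E.ell η) = E.ell (L.bracket ξ η)
  ell_pull : ∀ (ξ : E.Sec) (f : C^∞⟮I, N; ℝ⟯) (φ : E.dual.Tot),
    P.br (E.ell ξ) (E.dual.pull f) φ = diffAt I f φ.1 (L.anchor φ.1 (ξ φ.1))
  pull_pull : ∀ f g : C^∞⟮I, N; ℝ⟯, P.br (E.dual.pull f) (E.dual.pull g) = 0

/-- The linear Poisson bracket of two smooth functions on `E^*`, computed at `φ`. A Poisson bracket
depends on the differentials at `φ` only, and each covector at `φ` is the differential of some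
`ℓ_ξ + q^* f`; hence the three identities of `IsDualPoisson` give the value
`{ℓ_ξ + q^* f, ℓ_η + q^* g} = ℓ_[ξ, η] + q^*(ρ(ξ) g - ρ(η) f)` at `φ`. -/
def liePoisson {E : SmoothVB I N} (L : LieAlgebroid E) (F G : E.dual.Tot → ℝ) (φ : E.dual.Tot) : ℝ :=
  Classical.epsilon fun r : ℝ => ∃ (ξ η : E.Sec) (f g : C^∞⟮I, N; ℝ⟯),
    diffAt E.dual.model F φ = diffAt E.dual.model (E.ell ξ + E.dual.pull f) φ ∧
    diffAt E.dual.model G φ = diffAt E.dual.model (E.ell η + E.dual.pull g) φ ∧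
    r = E.ell (L.bracket ξ η) φ + diffAt I g φ.1 (L.anchor φ.1 (ξ φ.1))
      - diffAt I f φ.1 (L.anchor φ.1 (η φ.1))

end Algebroids

/-- The Lie bialgebroid condition `d_*[X, Y] = [d_* X, Y] + [X, d_* Y]` for Lie algebroid structures
on dual bundles `𝒜`, `𝒜^*` over `N` with section spaces `S`, `T`; `pair` is the pairing, `brS`,
`brT` are the brackets and `actS`, `actT` the actions of sections on functions through the anchors.
Here `d_* X (α, β) = ρ_*(α)⟨X, β⟩ - ρ_*(β)⟨X, α⟩ - ⟨X, [α, β]_*⟩`, the Lie derivative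
`α' = L_X α` is given by `⟨Y, α'⟩ = ρ(X)⟨Y, α⟩ - ⟨[X, Y], α⟩`, and the Schouten bracket
with a bivector `Π` by
`[X, Π](α, β) = -[Π, X](α, β) = ρ(X)(Π(α, β)) - Π(L_X α, β) - Π(α, L_X β)`. -/
def IsLieBialgebroid {S T N : Type*} (pair : S → T → N → ℝ)
    (brS : S → S → S) (actS : S → (N → ℝ) → N → ℝ)
    (brT : T → T → T) (actT : T → (N → ℝ) → N → ℝ) : Prop :=
  let d : S → T → T → N → ℝ := fun X α β =>
    actT α (pair X β) - actT β (pair X α) - pair X (brT α β)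
  let IsLieDer : S → T → T → Prop := fun X α α' =>
    ∀ Y, pair Y α' = actS X (pair Y α) - pair (brS X Y) α
  ∀ (X Y : S) (α β αX βX αY βY : T),
    IsLieDer X α αX → IsLieDer X β βX → IsLieDer Y α αY → IsLieDer Y β βY →
    d (brS X Y) α β =
      -(actS Y (d X α β) - d X αY β - d X α βY) + (actS X (d Y α β) - d Y αX β - d Y α βX)

/-! ### Double vector bundles -/

section Double

variable {EM HM : Type*} [NormedAddCommGroup EM] [NormedSpace ℝ EM] [TopologicalSpace HM]
  {I : ModelWithCorners ℝ EM HM} {M : Type*} [TopologicalSpace M] [ChartedSpace HM M]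

/-- A double vector bundle `(D; A, B; M)` with core `C`. The manifold `D` is given as the total
space of the bundle `DA : D → A`, and `e` identifies it with the total space of the bundle
`DB : D → B`; so `π_A d = d.proj` and `π_B d = (e d).proj` for `d : DA.Tot`. -/
structure DoubleVB (A B C : SmoothVB I M) (DA : SmoothVB A.model A.Tot)
    (DB : SmoothVB B.model B.Tot) where
  e : DA.Tot ≃ DB.Tot
  /-- `e` is a diffeomorphism -/
  e_smooth : ContMDiff DA.model DB.model ∞ e
  e_symm_smooth : ContMDiff DB.model DA.model ∞ e.symm
  /-- the square commutes -/
  proj_comm : ∀ d : DA.Tot, (e d).proj.proj = d.proj.proj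
  /-- `π_B` is a vector bundle morphism over `q_A` -/
  prB_add : ∀ d₁ d₂ d : DA.Tot, DA.IsAdd d₁ d₂ d → B.IsAdd (e d₁).proj (e d₂).proj (e d).proj
  prB_smul : ∀ (r : ℝ) (d : DA.Tot), (e (DA.smulT r d)).proj = B.smulT r (e d).proj
  /-- the addition of `D → B` is a vector bundle morphism over the addition of `A` -/
  prA_add : ∀ d₁ d₂ d : DA.Tot, DB.IsAdd (e d₁) (e d₂) (e d) → A.IsAdd d₁.proj d₂.proj d.proj
  interchange : ∀ d₁ d₂ d₃ d₄ s t u v : DA.Tot, DA.IsAdd d₁ d₂ s → DA.IsAdd d₃ d₄ t →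
    DB.IsAdd (e d₁) (e d₃) (e u) → DB.IsAdd (e d₂) (e d₄) (e v) →
    ∃ w : DA.Tot, DB.IsAdd (e s) (e t) (e w) ∧ DA.IsAdd u v w
  smulA_add : ∀ (r : ℝ) (d₁ d₂ d : DA.Tot), DB.IsAdd (e d₁) (e d₂) (e d) →
    DB.IsAdd (e (DA.smulT r d₁)) (e (DA.smulT r d₂)) (e (DA.smulT r d))
  /-- the scalar multiplication of `D → B` is a vector bundle morphism over that of `A` -/
  prA_smul : ∀ (r : ℝ) (d : DA.Tot), (e.symm (DB.smulT r (e d))).proj = A.smulT r d.proj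
  smulB_add : ∀ (r : ℝ) (d₁ d₂ d : DA.Tot), DA.IsAdd d₁ d₂ d →
    DA.IsAdd (e.symm (DB.smulT r (e d₁))) (e.symm (DB.smulT r (e d₂))) (e.symm (DB.smulT r (e d)))
  smul_smul : ∀ (r s : ℝ) (d : DA.Tot),
    e.symm (DB.smulT r (e (DA.smulT s d))) = DA.smulT s (e.symm (DB.smulT r (e d)))
  /-- the inclusion of the core, an isomorphism of `C` onto the intersection of the kernels of
  `π_A` and `π_B` with the vector bundle structure restricted from `D` -/
  core : C.Tot → DA.Tot
  core_smooth : ContMDiff C.model DA.model ∞ core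
  core_injective : Function.Injective core
  core_prA : ∀ c : C.Tot, (core c).proj = A.zeroT c.proj
  core_prB : ∀ c : C.Tot, (e (core c)).proj = B.zeroT c.proj
  core_surj : ∀ (d : DA.Tot) (m : M), d.proj = A.zeroT m → (e d).proj = B.zeroT m →
    ∃ c : C.Tot, core c = d
  core_addA : ∀ c₁ c₂ c : C.Tot, C.IsAdd c₁ c₂ c → DA.IsAdd (core c₁) (core c₂) (core c)
  core_addB : ∀ c₁ c₂ c : C.Tot, C.IsAdd c₁ c₂ c →
    DB.IsAdd (e (core c₁)) (e (core c₂)) (e (core c))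
  core_smulA : ∀ (r : ℝ) (c : C.Tot), core (C.smulT r c) = DA.smulT r (core c)
  core_smulB : ∀ (r : ℝ) (c : C.Tot), e (core (C.smulT r c)) = DB.smulT r (e (core c))

variable {A B C : SmoothVB I M} {DA : SmoothVB A.model A.Tot} {DB : SmoothVB B.model B.Tot}

namespace DoubleVB

/-- The same double vector bundle with the roles of `A` and `B` exchanged. -/
def flip (D : DoubleVB A B C DA DB) : DoubleVB B A C DB DA where
  e := D.e.symm
  e_smooth := D.e_symm_smooth
  e_symm_smooth := D.e_smooth
  proj_comm d := by
    obtain ⟨d, rfl⟩ := D.e.surjective d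
    simpa using (D.proj_comm d).symm
  prB_add d₁ d₂ d h := D.prA_add _ _ _ (by simpa using h)
  prB_smul r d := by
    obtain ⟨d, rfl⟩ := D.e.surjective d
    simpa using D.prA_smul r d
  prA_add d₁ d₂ d h := by simpa using D.prB_add _ _ _ h
  interchange d₁ d₂ d₃ d₄ s t u v h₁ h₂ h₃ h₄ := by
    obtain ⟨w, hw, hw'⟩ := D.interchange (D.e.symm d₁) (D.e.symm d₃) (D.e.symm d₂) (D.e.symm d₄)
      (D.e.symm u) (D.e.symm v) (D.e.symm s) (D.e.symm t) h₃ h₄ (by simpa using h₁)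
      (by simpa using h₂)
    exact ⟨D.e w, by simpa using hw', by simpa using hw⟩
  smulA_add r d₁ d₂ d h := by simpa using D.smulB_add r _ _ _ h
  prA_smul r d := by
    obtain ⟨d, rfl⟩ := D.e.surjective d
    simpa using D.prB_smul r d
  smulB_add r d₁ d₂ d h := by
    have h1 := D.smulA_add r (D.e.symm d₁) (D.e.symm d₂) (D.e.symm d) (by simpa using h)
    exact h1
  smul_smul r s d := by
    have h1 := D.smul_smul s r (D.e.symm d)
    have h2 := congrArg D.e h1
    simpa using h2.symm
  core c := D.e (D.core c)
  core_smooth := D.e_smooth.comp D.core_smooth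
  core_injective := D.e.injective.comp D.core_injective
  core_prA := D.core_prB
  core_prB c := by simpa using D.core_prA c
  core_surj d m h₁ h₂ := by
    obtain ⟨c, hc⟩ := D.core_surj (D.e.symm d) m h₂ (by simpa using h₁)
    exact ⟨c, by simp [hc]⟩
  core_addA := D.core_addB
  core_addB c₁ c₂ c h := by simpa using D.core_addA c₁ c₂ c h
  core_smulA := D.core_smulB
  core_smulB r c := by simpa using D.core_smulA r c

/-- `η : B → D` is the core section `c^†`, i.e. `η b_m = 0_{b_m} +_A c(m)`. -/
def IsCoreSec (D : DoubleVB A B C DA DB) (c : C.Sec) (η : DB.Sec) : Prop :=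
  ∀ b : B.Tot, DA.IsAdd (D.e.symm (DB.zeroT b)) (D.core ⟨b.1, c b.1⟩) (D.e.symm ⟨b, η b⟩)

/-- `ξ : B → D` is a linear section over `a`: a bundle morphism from `B → M` to `D → A` over `a`. -/
structure IsLinearSec (D : DoubleVB A B C DA DB) (a : A.Sec) (ξ : DB.Sec) : Prop where
  base : ∀ b : B.Tot, (D.e.symm ⟨b, ξ b⟩).proj = ⟨b.1, a b.1⟩
  add : ∀ b₁ b₂ b : B.Tot, B.IsAdd b₁ b₂ b →
    DA.IsAdd (D.e.symm ⟨b₁, ξ b₁⟩) (D.e.symm ⟨b₂, ξ b₂⟩) (D.e.symm ⟨b, ξ b⟩)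
  smul : ∀ (r : ℝ) (b : B.Tot),
    D.e.symm ⟨B.smulT r b, ξ (B.smulT r b)⟩ = DA.smulT r (D.e.symm ⟨b, ξ b⟩)

end DoubleVB

/-- A linear splitting: an (automatically injective) morphism of double vector bundles
`Σ : A ×_M B → D` over the identities of `A` and `B`. -/
structure LinearSplitting (D : DoubleVB A B C DA DB) where
  toFun : ∀ m, A.V m → B.V m → DA.Tot
  smooth : ContMDiff (I.prod 𝓘(ℝ, A.F × B.F)) DA.model ∞
    (fun p : TotalSpace (A.F × B.F) (A.V ×ᵇ B.V) => toFun p.1 p.2.1 p.2.2)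
  prA : ∀ m a b, (toFun m a b).proj = ⟨m, a⟩
  prB : ∀ m a b, (D.e (toFun m a b)).proj = ⟨m, b⟩
  addA : ∀ m a b₁ b₂, DA.IsAdd (toFun m a b₁) (toFun m a b₂) (toFun m a (b₁ + b₂))
  addB : ∀ m a₁ a₂ b, DB.IsAdd (D.e (toFun m a₁ b)) (D.e (toFun m a₂ b)) (D.e (toFun m (a₁ + a₂) b))
  smulA : ∀ (r : ℝ) m a b, toFun m a (r • b) = DA.smulT r (toFun m a b)
  smulB : ∀ (r : ℝ) m a b, D.e (toFun m (r • a) b) = DB.smulT r (D.e (toFun m a b))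

/-! ### VB-algebroids and double Lie algebroids -/

variable [IsManifold I ∞ M]

/-- `(D → B; A → M)` is a VB-algebroid: the anchor of `D → B` is a bundle morphism from `D → A`
to `TB → TM` over the anchor of `A`, the bracket is linear, and the Lie algebroid structure of `A`
is the induced one. -/
structure IsVBAlgebroid (D : DoubleVB A B C DA DB) (LA : LieAlgebroid A) (LDB : LieAlgebroid DB) :
    Prop where
  anchor_over : ∀ d : DA.Tot,
    tangentMap B.model I (TotalSpace.proj : B.Tot → M) ⟨(D.e d).1, LDB.anchor _ (D.e d).2⟩ =
      ⟨d.1.1, LA.anchor _ d.1.2⟩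
  anchor_add : ∀ d₁ d₂ d : DA.Tot, DA.IsAdd d₁ d₂ d →
    B.IsTangentAdd ⟨(D.e d₁).1, LDB.anchor _ (D.e d₁).2⟩ ⟨(D.e d₂).1, LDB.anchor _ (D.e d₂).2⟩
      ⟨(D.e d).1, LDB.anchor _ (D.e d).2⟩
  anchor_smul : ∀ (r : ℝ) (d : DA.Tot),
    (⟨(D.e (DA.smulT r d)).1, LDB.anchor _ (D.e (DA.smulT r d)).2⟩ : TangentBundle B.model B.Tot) =
      tangentMap B.model B.model (B.smulT r) ⟨(D.e d).1, LDB.anchor _ (D.e d).2⟩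
  linear_linear : ∀ (a₁ a₂ : A.Sec) (ξ₁ ξ₂ : DB.Sec), D.IsLinearSec a₁ ξ₁ → D.IsLinearSec a₂ ξ₂ →
    D.IsLinearSec (LA.bracket a₁ a₂) (LDB.bracket ξ₁ ξ₂)
  linear_core : ∀ (a : A.Sec) (c : C.Sec) (ξ η : DB.Sec), D.IsLinearSec a ξ → D.IsCoreSec c η →
    ∃ c' : C.Sec, D.IsCoreSec c' (LDB.bracket ξ η)
  core_core : ∀ (c₁ c₂ : C.Sec) (η₁ η₂ : DB.Sec), D.IsCoreSec c₁ η₁ → D.IsCoreSec c₂ η₂ →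
    LDB.bracket η₁ η₂ = 0

namespace DoubleVB

/-- The projection to `C^*` of the dual `D^{*A}` of `D → A`:
`⟨π_{C^*}(Φ), c⟩ = ⟨Φ, 0_a +_B c⟩` for `Φ` over `a`. -/
def prCstar (D : DoubleVB A B C DA DB) (Φ : DA.dual.Tot) : C.dual.Tot :=
  ⟨Φ.1.1, Classical.epsilon fun γ : C.dual.V Φ.1.1 => ∀ (c : C.V Φ.1.1) (x : DA.V Φ.1),
    DB.IsAdd (D.e (DA.zeroT Φ.1)) (D.e (D.core ⟨Φ.1.1, c⟩)) (D.e ⟨Φ.1, x⟩) → γ c = Φ.2 x⟩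

/-- The pairing `⟨⟨Φ, Ψ⟩⟩ = ⟨Φ, d⟩_A - ⟨Ψ, d⟩_B` of `D^{*A}` and `D^{*B}` over `C^*`, with any `d`
such that `π_A d = π_A Φ` and `π_B d = π_B Ψ`. -/
def pairing (D : DoubleVB A B C DA DB) (Φ : DA.dual.Tot) (Ψ : DB.dual.Tot) : ℝ :=
  Classical.epsilon fun r : ℝ => ∃ d : DA.Tot, d.1 = Φ.1 ∧ (D.e d).1 = Ψ.1 ∧
    r = DA.eval Φ d - DB.eval Ψ (D.e d)

/-- A smooth section of `D^{*A} → C^*`. -/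
structure DualSec (D : DoubleVB A B C DA DB) where
  toFun : C.dual.Tot → DA.dual.Tot
  smooth : ContMDiff C.dual.model DA.dual.model ∞ toFun
  prCstar_toFun : ∀ γ, D.prCstar (toFun γ) = γ

/-- A section `s` of `D^{*A} → C^*`, as a function on `D^{*B}` linear over `C^*`, through the
identification `Φ ↦ -⟨⟨Φ, ·⟩⟩` of `D^{*A}` with the dual of `D^{*B} → C^*`. For `D.flip` this reads
a section of `D^{*B} → C^*` as a function on `D^{*A}` through `Ψ ↦ ⟨⟨·, Ψ⟩⟩`. -/
def ellCstar (D : DoubleVB A B C DA DB) (s : D.DualSec) (Ψ : DB.dual.Tot) : ℝ :=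
  D.flip.pairing Ψ (s.toFun (D.flip.prCstar Ψ))

/-- The bracket of the Lie algebroid `D^{*A} → C^*` induced by the VB-algebroid `(D → B; A → M)`:
the linear Poisson structure on `D^{*B}` dual to `D → B` is also linear over `C^*`, and the Lie
algebroid structure on `D^{*A} → C^*` is the one dual to it, `ℓ_[s, t] = {ℓ_s, ℓ_t}`. -/
def dualBracket (D : DoubleVB A B C DA DB) (LDB : LieAlgebroid DB) (s t : D.DualSec) : D.DualSec :=
  @Classical.epsilon _ ⟨s⟩ fun u : D.DualSec =>
    ∀ Ψ, D.ellCstar u Ψ = liePoisson LDB (D.ellCstar s) (D.ellCstar t) Ψ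

/-- The anchor `Θ` of that Lie algebroid `D^{*A} → C^*`, at `Φ` in the fibre over `γ`: it is given by
`{ℓ_s, π^* F} = π^*(Θ(s) F)`, where `π : D^{*B} → C^*` is the projection. -/
def dualAnchor (D : DoubleVB A B C DA DB) (LDB : LieAlgebroid DB) (γ : C.dual.Tot)
    (Φ : DA.dual.Tot) : TangentSpace C.dual.model γ :=
  Classical.epsilon fun v : TangentSpace C.dual.model γ =>
    ∀ s : D.DualSec, s.toFun γ = Φ → ∀ (F : C^∞⟮C.dual.model, C.dual.Tot; ℝ⟯) (Ψ : DB.dual.Tot),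
      D.flip.prCstar Ψ = γ →
      liePoisson LDB (D.ellCstar s) (fun Ψ' => F (D.flip.prCstar Ψ')) Ψ =
        diffAt C.dual.model F γ v

/-- The derivation `Θ(s)` of functions on `C^*` for a section `s` of `D^{*A} → C^*`. -/
def dualAct (D : DoubleVB A B C DA DB) (LDB : LieAlgebroid DB) (s : D.DualSec)
    (F : C.dual.Tot → ℝ) (γ : C.dual.Tot) : ℝ :=
  diffAt C.dual.model F γ (D.dualAnchor LDB γ (s.toFun γ))

end DoubleVB

/-- `(D; A, B; M)` with the four given Lie algebroid structures is a double Lie algebroid: both pairs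
of parallel structures are VB-algebroids, and `(D^{*A}, D^{*B})` with the induced Lie algebroid
structures over `C^*` and the pairing `⟨⟨·, ·⟩⟩` is a Lie bialgebroid. -/
structure IsDoubleLieAlgebroid (D : DoubleVB A B C DA DB) (LA : LieAlgebroid A)
    (LB : LieAlgebroid B) (LDA : LieAlgebroid DA) (LDB : LieAlgebroid DB) : Prop where
  vbB : IsVBAlgebroid D LA LDB
  vbA : IsVBAlgebroid D.flip LB LDA
  bialgebroid : IsLieBialgebroid
    (fun (s : D.DualSec) (t : D.flip.DualSec) γ => D.pairing (s.toFun γ) (t.toFun γ))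
    (D.dualBracket LDB) (D.dualAct LDB) (D.flip.dualBracket LDA) (D.flip.dualAct LDA)

namespace DoubleVB

/-- With `Θ_A : D^{*A} → TC^*` the anchor, the dual map `Θ_A^* : T^*C^* → D^{*B}`, where `D^{*B}` is
the dual of `D^{*A}` through the pairing: `⟨⟨Φ, Θ_A^* μ⟩⟩ = μ(Θ_A Φ)`. -/
def dualAnchorStar (D : DoubleVB A B C DA DB) (LDB : LieAlgebroid DB) (γ : C.dual.Tot)
    (μ : TangentSpace C.dual.model γ →L[ℝ] ℝ) : DB.dual.Tot :=
  @Classical.epsilon _ ⟨⟨B.zeroT γ.1, 0⟩⟩ fun Ψ : DB.dual.Tot => D.flip.prCstar Ψ = γ ∧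
    ∀ Φ : DA.dual.Tot, D.prCstar Φ = γ → D.pairing Φ Ψ = μ (D.dualAnchor LDB γ Φ)

/-- The map `Θ_B ∘ Θ_A^* : T^*C^* → TC^*` of the Poisson structure on `C^*` induced by the Lie
bialgebroid `(D^{*A}, D^{*B})`. -/
def cstarSharp (D : DoubleVB A B C DA DB) (LDA : LieAlgebroid DA) (LDB : LieAlgebroid DB)
    (γ : C.dual.Tot) (μ : TangentSpace C.dual.model γ →L[ℝ] ℝ) : TangentSpace C.dual.model γ :=
  D.flip.dualAnchor LDA γ (D.dualAnchorStar LDB γ μ)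

/-- The core-anchor `∂_B : Γ(C) → Γ(B)` of the VB-algebroid `(D → B; A → M)`: the anchor of `D → B`
sends `c^†` to the vertical lift of `∂_B c`. -/
def coreAnchor (D : DoubleVB A B C DA DB) (LDB : LieAlgebroid DB) (c : C.Sec) : B.Sec :=
  @Classical.epsilon _ ⟨0⟩ fun b : B.Sec => ∃ η : DB.Sec, D.IsCoreSec c η ∧
    ∀ x : B.Tot, LDB.anchor x (η x) = B.vertLift x (b x.1)

/-- The connection `∇ : Γ(A) × Γ(C) → Γ(C)` defined by the VB-algebroid `(D → B; A → M)` and a linear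
splitting `S`: `[σ_A(a), c^†] = (∇_a c)^†`, where `σ_A(a)(b_m) = S(a(m), b_m)`. -/
def coreConn (D : DoubleVB A B C DA DB) (LDB : LieAlgebroid DB)
    (S : ∀ m, A.V m → B.V m → DA.Tot) (a : A.Sec) (c : C.Sec) : C.Sec :=
  @Classical.epsilon _ ⟨0⟩ fun c' : C.Sec => ∃ ξ η : DB.Sec,
    (∀ b : B.Tot, D.e.symm ⟨b, ξ b⟩ = S b.1 (a b.1) b.2) ∧ D.IsCoreSec c η ∧
    D.IsCoreSec c' (LDB.bracket ξ η)

end DoubleVB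

namespace LinearSplitting

variable {D : DoubleVB A B C DA DB} (S : LinearSplitting D) (LDA : LieAlgebroid DA)
  (LDB : LieAlgebroid DB)

/-- The connection `∇^{AC}` of the 2-representation of `A` on `∂_B : C → B`. -/
def connAC (a : A.Sec) (c : C.Sec) : C.Sec := D.coreConn LDB S.toFun a c

/-- The connection `∇^{BC}` of the 2-representation of `B` on `∂_A : C → A`. -/
def connBC (b : B.Sec) (c : C.Sec) : C.Sec :=
  D.flip.coreConn LDA (fun m b a => D.e (S.toFun m a b)) b c

/-- The bracket `[c₁, c₂] = ∇_{∂_A c₁} c₂ - ∇_{∂_B c₂} c₁` on sections of the core. -/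
def coreBracket (c₁ c₂ : C.Sec) : C.Sec :=
  S.connAC LDB (D.flip.coreAnchor LDA c₁) c₂ - S.connBC LDA (D.coreAnchor LDB c₂) c₁

end LinearSplitting

end Double

end

noncomputable section

set_option linter.checkUnivs false
set_option linter.unusedSectionVars false

/-! ### Smooth maps into vector bundles -/

namespace SmoothVB

variable {EN HN : Type*} [NormedAddCommGroup EN] [NormedSpace ℝ EN] [TopologicalSpace HN]
  {I : ModelWithCorners ℝ EN HN} {N : Type*} [TopologicalSpace N] [ChartedSpace HN N]
  {EX HX : Type*} [NormedAddCommGroup EX] [NormedSpace ℝ EX] [TopologicalSpace HX]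
  {J : ModelWithCorners ℝ EX HX} {X : Type*} [TopologicalSpace X] [ChartedSpace HX X]

/-! The splitting identifies D with A ⊕ B ⊕ C, hence D^{*A} with A ⊕ B^* ⊕ C^* and D^{*B} with B ⊕
A^* ⊕ C^*. In these components the pairing over γ ∈ C^* is ⟨⟨(a, β), (b, α)⟩⟩ = β(b) - α(a)
(`pairing_cov`), and a section (a, β) of D^{*A} → C^* is the function α(a) - β(b) on D^{*B}.

The induced Lie algebroid D^{*A} → C^* therefore lives inside the linear Poisson bracket on D^{*B}.
That bracket has to be shown well defined (`genBracket_eq_zero`) and to satisfy the Jacobi identity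
(`jacobiator_eq_zero`). With π the projection of D^{*B} to C^*, the VB-algebroid axioms say that
pullbacks along π Poisson-commute, that bracketing a function linear over C^* with a pullback gives
a pullback, and that two functions linear over C^* have a bracket of the same kind. Together these
give the bracket (`ellCstar_dualBracket`) and the anchor (`diffAt_dualAnchor`), and the algebroid
identities follow from the Leibniz and Jacobi rules on D^{*B}.

That a Lie bialgebroid induces a Poisson bracket {F, G} = Θ_B(dF) G on its base, where dF stands for
Θ_A^*(dF), is pure algebra over the ring of functions. Inserting fY for Y in the compatibility
condition leaves a first-order identity (`act_lie`). Inserting gX for X in that gives skew-symmetry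
(`act_d_skew`), and taking α = dg gives [dg, df]_* = d{g, f} (`pair_br_d`), hence Jacobi. Removing Y
from the first identity requires a section that annihilates a given one without vanishing, so the
rank of D^{*A} → C^*, which is rank A + rank B, must be at least two. In rank zero the bracket is
zero, and rank one is excluded by hypothesis.

It remains to evaluate the bracket. Since ℓ_{c^†} = π^* ℓ_c (`ell_coreSec`), the bracket [σ_A(a),
c^†] = (∇_a c)^† and the core-anchor determine Θ_A^*(dℓ_c): its component in B is ∂_B c, and its
component in A^* sends a to -ℓ_{∇_a c}. Applying Θ_B gives {ℓ_c, ℓ_c'} = ℓ_{∇_{∂_B c} c'} -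
ℓ_{∇_{∂_A c'} c}, {ℓ_c, q^*f} = q^*(ρ_B(∂_B c) f) and {q^*f, ℓ_c} = -q^*(ρ_A(∂_A c) f).
Skew-symmetry turns the first into the stated bracket and equates the two anchors. The Lie algebroid
axioms for C are then those of the Poisson bracket, read through the injective map c ↦ ℓ_c. -/

instance t2Space_fiber (E : SmoothVB I N) (x : N) : T2Space (E.V x) :=
  FiberBundle.t2Space E.F E.V x

instance finiteDimensional_fiber (E : SmoothVB I N) (x : N) : FiniteDimensional ℝ (E.V x) :=
  LinearEquiv.finiteDimensional
    ((trivializationAt E.F E.V x).continuousLinearEquivAt ℝ x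
      (FiberBundle.mem_baseSet_trivializationAt' x)).symm.toLinearEquiv

theorem finrank_fiber (E : SmoothVB I N) (x : N) :
    Module.finrank ℝ (E.V x) = Module.finrank ℝ E.F :=
  LinearEquiv.finrank_eq ((trivializationAt E.F E.V x).continuousLinearEquivAt ℝ x
      (FiberBundle.mem_baseSet_trivializationAt' x)).toLinearEquiv

/-- The total spaces of A and B are the bases of D → A and D → B, and bump functions are needed on
them too. -/
instance t2Space_tot [T2Space N] (E : SmoothVB I N) : T2Space E.Tot := by
  refine ⟨fun v w h => ?_⟩
  by_cases hp : v.1 = w.1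
  · obtain ⟨x, v⟩ := v
    obtain ⟨y, w⟩ := w
    obtain rfl : x = y := hp
    have hne : (trivializationAt E.F E.V x ⟨x, v⟩).2 ≠ (trivializationAt E.F E.V x ⟨x, w⟩).2 := by
      intro hvw
      apply h
      have := ((trivializationAt E.F E.V x).continuousLinearEquivAt ℝ x
        (FiberBundle.mem_baseSet_trivializationAt' x)).injective (a₁ := v) (a₂ := w) hvw
      rw [this]
    have hs : ∀ u : E.V x, (⟨x, u⟩ : E.Tot) ∈ (trivializationAt E.F E.V x).source := fun u => by
      rw [Bundle.Trivialization.mem_source]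
      exact FiberBundle.mem_baseSet_trivializationAt' x
    obtain ⟨U, W, hU, hW, hvU, hwW, hUW⟩ := t2_separation hne
    set T := trivializationAt E.F E.V x
    have ho : ∀ O : Set E.F, IsOpen O → IsOpen (T.source ∩ {u | (T u).2 ∈ O}) := fun O hO =>
      (continuous_snd.comp_continuousOn T.continuousOn).isOpen_inter_preimage T.open_source hO
    exact ⟨_, _, ho U hU, ho W hW, ⟨hs v, hvU⟩, ⟨hs w, hwW⟩,
      Set.disjoint_left.2 fun u hu hu' => Set.disjoint_left.1 hUW hu.2 hu'.2⟩
  · exact separated_by_continuous (FiberBundle.continuous_proj E.F E.V) hp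

theorem contMDiffAt_iff_trivializationAt (E : SmoothVB I N) {f : X → E.Tot} {x₀ : X} :
    ContMDiffAt J E.model ∞ f x₀ ↔ ContMDiffAt J I ∞ (fun x => (f x).proj) x₀ ∧
      ContMDiffAt J 𝓘(ℝ, E.F) ∞ (fun x => (trivializationAt E.F E.V (f x₀).proj (f x)).2) x₀ :=
  Bundle.contMDiffAt_totalSpace (E := E.V)

theorem eventually_mem_baseSet (E : SmoothVB I N) {p : X → N} {x₀ : X}
    (hp : ContMDiffAt J I ∞ p x₀) :
    ∀ᶠ x in nhds x₀, p x ∈ (trivializationAt E.F E.V (p x₀)).baseSet :=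
  hp.continuousAt ((trivializationAt E.F E.V (p x₀)).open_baseSet.mem_nhds
    (FiberBundle.mem_baseSet_trivializationAt' (p x₀)))

/-- A finite linear combination of smooth maps to `E` over a common map to the base is smooth. -/
theorem contMDiffAt_sum_smul (E : SmoothVB I N) {ι : Type*} (s : Finset ι) {p : X → N}
    {r : ι → X → ℝ} {v : ι → ∀ x, E.V (p x)} {x₀ : X} (hp : ContMDiffAt J I ∞ p x₀)
    (hr : ∀ i ∈ s, ContMDiffAt J 𝓘(ℝ, ℝ) ∞ (r i) x₀)
    (hv : ∀ i ∈ s, ContMDiffAt J E.model ∞ (fun x => (⟨p x, v i x⟩ : E.Tot)) x₀) :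
    ContMDiffAt J E.model ∞ (fun x => (⟨p x, ∑ i ∈ s, r i x • v i x⟩ : E.Tot)) x₀ := by
  rw [contMDiffAt_iff_trivializationAt]
  refine ⟨hp, ?_⟩
  have h : ContMDiffAt J 𝓘(ℝ, E.F) ∞ (fun x => ∑ i ∈ s, r i x •
      (trivializationAt E.F E.V (p x₀) ⟨p x, v i x⟩).2) x₀ :=
    ContMDiffAt.sum fun i hi =>
      (hr i hi).smul (E.contMDiffAt_iff_trivializationAt.1 (hv i hi)).2
  refine h.congr_of_eventuallyEq ?_
  filter_upwards [E.eventually_mem_baseSet hp] with x hx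
  have hl := fun w : E.V (p x) => Bundle.Trivialization.continuousLinearMapAt_apply_of_mem (R := ℝ)
    (trivializationAt E.F E.V (p x₀)) hx w
  rw [← hl, map_sum]
  refine Finset.sum_congr rfl fun i _ => ?_
  rw [map_smul, hl]

theorem contMDiffAt_add (E : SmoothVB I N) {p : X → N} {v w : ∀ x, E.V (p x)} {x₀ : X}
    (hv : ContMDiffAt J E.model ∞ (fun x => (⟨p x, v x⟩ : E.Tot)) x₀)
    (hw : ContMDiffAt J E.model ∞ (fun x => (⟨p x, w x⟩ : E.Tot)) x₀) :
    ContMDiffAt J E.model ∞ (fun x => (⟨p x, v x + w x⟩ : E.Tot)) x₀ := by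
  have h := E.contMDiffAt_sum_smul (Finset.univ : Finset (Fin 2)) (p := p) (r := fun _ _ => 1)
    (v := ![v, w]) (x₀ := x₀) (E.contMDiffAt_iff_trivializationAt.1 hv).1
    (fun _ _ => contMDiffAt_const) (by intro i _; fin_cases i <;> assumption)
  simpa [Fin.sum_univ_two] using h

theorem contMDiffAt_smul (E : SmoothVB I N) {p : X → N} {r : X → ℝ} {v : ∀ x, E.V (p x)} {x₀ : X}
    (hr : ContMDiffAt J 𝓘(ℝ, ℝ) ∞ r x₀)
    (hv : ContMDiffAt J E.model ∞ (fun x => (⟨p x, v x⟩ : E.Tot)) x₀) :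
    ContMDiffAt J E.model ∞ (fun x => (⟨p x, r x • v x⟩ : E.Tot)) x₀ := by
  have h := E.contMDiffAt_sum_smul (Finset.univ : Finset Unit) (p := p) (r := fun _ => r)
    (v := fun _ => v) (x₀ := x₀) (E.contMDiffAt_iff_trivializationAt.1 hv).1
    (fun _ _ => hr) (fun _ _ => hv)
  simpa using h

theorem contMDiff_isAdd (E : SmoothVB I N) {u v w : X → E.Tot} (hu : ContMDiff J E.model ∞ u)
    (hv : ContMDiff J E.model ∞ v) (h : ∀ x, E.IsAdd (u x) (v x) (w x)) :
    ContMDiff J E.model ∞ w := by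
  choose p a b h₁ h₂ h₃ using h
  obtain rfl : u = fun x => ⟨p x, a x⟩ := funext h₁
  obtain rfl : v = fun x => ⟨p x, b x⟩ := funext h₂
  obtain rfl : w = fun x => ⟨p x, a x + b x⟩ := funext h₃
  exact fun x => E.contMDiffAt_add (hu x) (hv x)

theorem contMDiff_smulT (E : SmoothVB I N) {r : X → ℝ} {v : X → E.Tot}
    (hr : ContMDiff J 𝓘(ℝ, ℝ) ∞ r) (hv : ContMDiff J E.model ∞ v) :
    ContMDiff J E.model ∞ (fun x => E.smulT (r x) (v x)) :=
  fun x => E.contMDiffAt_smul (p := fun x => (v x).1) (v := fun x => (v x).2) (hr x) (hv x)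

theorem contMDiff_zeroT (E : SmoothVB I N) : ContMDiff I E.model ∞ E.zeroT :=
  Bundle.contMDiff_zeroSection ℝ E.V

theorem contMDiff_sec (E : SmoothVB I N) (s : E.Sec) :
    ContMDiff I E.model ∞ (fun x => (⟨x, s x⟩ : E.Tot)) := s.contMDiff

theorem contMDiff_proj (E : SmoothVB I N) : ContMDiff E.model I ∞ (fun v : E.Tot => v.1) :=
  Bundle.contMDiff_proj E.V

@[simp] theorem fsmul_apply (E : SmoothVB I N) (f : C^∞⟮I, N; ℝ⟯) (s : E.Sec) (x : N) :
    E.fsmul f s x = f x • s x := rfl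

section Dual

variable [IsManifold I ∞ N]

@[simp] theorem ell_apply (E : SmoothVB I N) (ξ : E.Sec) (φ : E.dual.Tot) :
    E.ell ξ φ = φ.2 (ξ φ.1) := rfl

theorem contMDiffAt_eval (E : SmoothVB I N) {p : X → N} {φ : ∀ x, E.dual.V (p x)}
    {v : ∀ x, E.V (p x)} {x₀ : X}
    (hφ : ContMDiffAt J E.dual.model ∞ (fun x => (⟨p x, φ x⟩ : E.dual.Tot)) x₀)
    (hv : ContMDiffAt J E.model ∞ (fun x => (⟨p x, v x⟩ : E.Tot)) x₀) :
    ContMDiffAt J 𝓘(ℝ, ℝ) ∞ (fun x => (φ x (v x) : ℝ)) x₀ := by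
  have h1 := ContMDiffAt.clm_bundle_apply (n := ∞) (IB := I) (F₁ := E.F) (E₁ := E.V) (F₂ := ℝ)
    (E₂ := Bundle.Trivial N ℝ) (b := p) (ϕ := φ) (v := v) hφ hv
  simpa using (Bundle.contMDiffAt_totalSpace.1 h1).2

/-- The fibrewise linear function on `E` defined by a section of the dual bundle. -/
def lin (E : SmoothVB I N) (θ : E.dual.Sec) : C^∞⟮E.model, E.Tot; ℝ⟯ where
  val v := θ v.1 v.2
  property x := E.contMDiffAt_eval (p := fun v : E.Tot => v.1) (v := fun v : E.Tot => v.2)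
    (((E.dual.contMDiff_sec θ).comp E.contMDiff_proj) x) contMDiffAt_id

end Dual

end SmoothVB

/-! ### Bump functions, frames and tensoriality -/

section Bump

variable {EN HN : Type*} [NormedAddCommGroup EN] [NormedSpace ℝ EN] [FiniteDimensional ℝ EN]
  [TopologicalSpace HN] {I : ModelWithCorners ℝ EN HN} {N : Type*} [TopologicalSpace N]
  [ChartedSpace HN N] [IsManifold I ∞ N] [T2Space N]

variable (I) in
theorem exists_bump (x₀ : N) {U : Set N} (hU : U ∈ nhds x₀) :
    ∃ χ : C^∞⟮I, N; ℝ⟯, (∀ᶠ x in nhds x₀, χ x = 1) ∧ tsupport (χ : N → ℝ) ⊆ U := by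
  obtain ⟨f, -, hf⟩ := (SmoothBumpFunction.nhds_basis_tsupport (I := I) x₀).mem_iff.1 hU
  exact ⟨⟨f, f.contMDiff⟩, f.eventuallyEq_one, hf⟩

theorem exists_smooth_extension {G : Type*} [NormedAddCommGroup G] [NormedSpace ℝ G]
    {χ : C^∞⟮I, N; ℝ⟯} {U : Set N}
    (hχ : tsupport (χ : N → ℝ) ⊆ U) {f : N → G} (hf : ∀ x ∈ U, ContMDiffAt I 𝓘(ℝ, G) ∞ f x) :
    ContMDiff I 𝓘(ℝ, G) ∞ (fun x => χ x • f x) := by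
  refine contMDiff_of_tsupport fun x hx => ?_
  exact χ.contMDiff.contMDiffAt.smul (hf x (hχ (tsupport_smul_subset_left _ _ hx)))

theorem SmoothVB.exists_section_extension (E : SmoothVB I N) {χ : C^∞⟮I, N; ℝ⟯} {U : Set N}
    (hχ : tsupport (χ : N → ℝ) ⊆ U) {σ : ∀ x, E.V x}
    (hσ : ∀ x ∈ U, ContMDiffAt I E.model ∞ (fun x => (⟨x, σ x⟩ : E.Tot)) x) :
    ∃ s : E.Sec, ∀ x, s x = χ x • σ x := by
  refine ⟨⟨fun x => χ x • σ x, fun x => ?_⟩, fun x => rfl⟩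
  by_cases hx : x ∈ tsupport (χ : N → ℝ)
  · exact E.contMDiffAt_smul (p := fun x => x) χ.contMDiff.contMDiffAt (hσ x (hχ hx))
  · refine (E.contMDiff_zeroT x).congr_of_eventuallyEq ?_
    have := notMem_tsupport_iff_eventuallyEq.1 hx
    filter_upwards [this] with y hy
    simp only [hy, Pi.zero_apply, zero_smul]
    rfl

namespace SmoothVB

/-- Sections of the dual bundle from a local trivialization and a bump function. -/
theorem exists_dual_sec_of_trivialization (E : SmoothVB I N) (x₀ : N) {χ : C^∞⟮I, N; ℝ⟯}
    (hχ : tsupport (χ : N → ℝ) ⊆ (trivializationAt E.F E.V x₀).baseSet) (ψ : E.F →L[ℝ] ℝ) :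
    ∃ θ : E.dual.Sec, ∀ (x : N) (v : E.V x),
      (θ x v : ℝ) = χ x * ψ ((trivializationAt E.F E.V x₀).continuousLinearMapAt ℝ x v) := by
  set T := trivializationAt E.F E.V x₀ with hT
  obtain ⟨θ, hθ⟩ : ∃ s : E.dual.Sec, ∀ x, s x = χ x •
      (ψ.comp (T.continuousLinearMapAt ℝ x) : E.V x →L[ℝ] ℝ) := by
    refine E.dual.exists_section_extension hχ fun x hx => ?_
    rw [Bundle.Trivialization.contMDiffAt_section_iff
      (trivializationAt E.dual.F E.dual.V x₀) (by
        simpa [hom_trivializationAt_baseSet] using hx)]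
    refine (contMDiffAt_const (c := ψ)).congr_of_eventuallyEq ?_
    filter_upwards [T.open_baseSet.mem_nhds hx] with y hy
    rw [hom_trivializationAt_apply]
    ext v
    rw [ContinuousLinearMap.inCoordinates_eq hy (by simp)]
    have h := T.continuousLinearMapAt_symmL (R := ℝ) hy v
    rw [T.symmL_apply hy] at h
    simpa [← hT] using congrArg ψ h
  exact ⟨θ, fun x v => by rw [hθ]; rfl⟩

/-- A local frame and its dual frame, cut off to global sections. The resulting identity holds at
every point of the base, so it can be used inside brackets and tensorial maps, which only accept
global sections. -/
theorem exists_frame (E : SmoothVB I N) (x₀ : N) :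
    ∃ (n : ℕ) (e : Fin n → E.Sec) (θ : Fin n → E.dual.Sec) (χ : C^∞⟮I, N; ℝ⟯),
      (∀ᶠ x in nhds x₀, χ x = 1) ∧
      ∀ (x : N) (v : E.V x), ∑ i, (θ i x v : ℝ) • e i x = χ x • v := by
  set T := trivializationAt E.F E.V x₀ with hT
  have hU : T.baseSet ∈ nhds x₀ :=
    T.open_baseSet.mem_nhds (FiberBundle.mem_baseSet_trivializationAt' x₀)
  obtain ⟨χ, hχ, hs⟩ := exists_bump I x₀ hU
  let b := Module.finBasis ℝ E.F
  have h₁ : ∀ i, ∃ s : E.Sec, ∀ x, s x = χ x • T.localFrame b i x := fun i =>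
    E.exists_section_extension hs fun x hx => contMDiffAt_localFrame_of_mem ∞ T b i hx
  have h₂ := fun i => E.exists_dual_sec_of_trivialization x₀ hs
    (LinearMap.toContinuousLinearMap (b.coord i))
  choose e he using h₁
  choose θ hθ using h₂
  simp only [← hT] at hθ
  -- Both the frame and the dual frame carry the factor χ, so their contraction carries χ².
  refine ⟨_, e, θ, χ * χ, ?_, fun x v => ?_⟩
  · filter_upwards [hχ] with x hx
    simp [hx]
  · by_cases hx : x ∈ T.baseSet
    · have h := (T.basisAt b hx).sum_repr v
      simp only [he, hθ, T.localFrame_apply_of_mem_baseSet b hx]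
      calc _ = ∑ i, (χ * χ) x • ((T.basisAt b hx).repr v i • T.basisAt b hx i) := by
            refine Finset.sum_congr rfl fun i _ => ?_
            rw [smul_smul, smul_smul]
            congr 1
            simp [Bundle.Trivialization.basisAt, hx]
            ring
        _ = _ := by rw [← Finset.smul_sum, h]
    · have : χ x = 0 := by
        by_contra h
        exact hx (hs (subset_tsupport _ h))
      simp [he, this]

theorem exists_sec_apply_eq (E : SmoothVB I N) (x : N) (v : E.V x) : ∃ s : E.Sec, s x = v := by
  obtain ⟨n, e, θ, χ, hχ, h⟩ := E.exists_frame x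
  refine ⟨∑ i, (θ i x v : ℝ) • e i, ?_⟩
  have : (∑ i, (θ i x v : ℝ) • e i : E.Sec) x = ∑ i, (θ i x v : ℝ) • e i x := by
    rw [← ContMDiffSection.coeAddHom_apply, map_sum, Finset.sum_apply]
    rfl
  rw [this, h, hχ.self_of_nhds, one_smul]

theorem eq_of_dual_sec (E : SmoothVB I N) {x : N} {v w : E.V x}
    (h : ∀ θ : E.dual.Sec, (θ x v : ℝ) = θ x w) : v = w := by
  obtain ⟨n, e, θ, χ, hχ, hf⟩ := E.exists_frame x
  have hv := hf x v
  have hw := hf x w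
  simp only [h, hw, hχ.self_of_nhds, one_smul] at hv
  exact hv.symm

/-- The function `⟨θ, e⟩` on the base. -/
def pairing (E : SmoothVB I N) (θ : E.dual.Sec) (e : E.Sec) : C^∞⟮I, N; ℝ⟯ :=
  ⟨fun x => θ x (e x), (E.lin θ).contMDiff.comp (E.contMDiff_sec e)⟩

@[simp] theorem pairing_apply (E : SmoothVB I N) (θ : E.dual.Sec) (e : E.Sec) (x : N) :
    E.pairing θ e x = θ x (e x) := rfl

theorem sum_sec_apply (E : SmoothVB I N) {ι : Type*} (s : Finset ι) (e : ι → E.Sec) (x : N) :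
    (∑ i ∈ s, e i : E.Sec) x = ∑ i ∈ s, e i x := by
  rw [← ContMDiffSection.coeAddHom_apply, map_sum, Finset.sum_apply]
  rfl

section Lift

variable {EX HX : Type*} [NormedAddCommGroup EX] [NormedSpace ℝ EX] [TopologicalSpace HX]
  {J : ModelWithCorners ℝ EX HX} {X : Type*} [TopologicalSpace X] [ChartedSpace HX X]

/-- A map to a vector bundle is smooth if its pairings with the sections of the dual are. -/
theorem contMDiffAt_of_dual_sec (E : SmoothVB I N) {p : X → N} {v : ∀ x, E.V (p x)} {x₀ : X}
    (hp : ContMDiffAt J I ∞ p x₀)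
    (h : ∀ θ : E.dual.Sec, ContMDiffAt J 𝓘(ℝ, ℝ) ∞ (fun x => (θ (p x) (v x) : ℝ)) x₀) :
    ContMDiffAt J E.model ∞ (fun x => (⟨p x, v x⟩ : E.Tot)) x₀ := by
  obtain ⟨n, e, θ, χ, hχ, hf⟩ := E.exists_frame (p x₀)
  refine (E.contMDiffAt_sum_smul Finset.univ (v := fun i x => e i (p x)) hp (fun i _ => h (θ i))
    fun i _ => (E.contMDiff_sec (e i)).contMDiffAt.comp x₀ hp).congr_of_eventuallyEq ?_
  filter_upwards [hp.continuousAt.eventually hχ] with x hx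
  rw [hf, hx, one_smul]

/-- A map to a dual bundle is smooth if its values on sections are. -/
theorem contMDiffAt_dual_of_sec (E : SmoothVB I N) {p : X → N} {φ : ∀ x, E.dual.V (p x)} {x₀ : X}
    (hp : ContMDiffAt J I ∞ p x₀)
    (h : ∀ e : E.Sec, ContMDiffAt J 𝓘(ℝ, ℝ) ∞ (fun x => (φ x (e (p x)) : ℝ)) x₀) :
    ContMDiffAt J E.dual.model ∞ (fun x => (⟨p x, φ x⟩ : E.dual.Tot)) x₀ := by
  obtain ⟨n, e, θ, χ, hχ, hf⟩ := E.exists_frame (p x₀)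
  refine (E.dual.contMDiffAt_sum_smul Finset.univ (v := fun i x => θ i (p x)) hp
    (fun i _ => h (e i))
    fun i _ => (E.dual.contMDiff_sec (θ i)).contMDiffAt.comp x₀ hp).congr_of_eventuallyEq ?_
  filter_upwards [hp.continuousAt.eventually hχ] with x hx
  congr 1
  ext v
  have h₁ : (φ x (∑ i, (θ i (p x) v : ℝ) • e i (p x)) : ℝ) = φ x v := by
    rw [hf, hx, one_smul]
  rw [← h₁, map_sum, sum_apply]
  refine Finset.sum_congr rfl fun i _ => ?_
  rw [map_smul]
  exact mul_comm (θ i (p x) v : ℝ) (φ x (e i (p x)) : ℝ)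

/-- A tensorial map from the sections of a bundle to the functions on `X` is given by a lift of
`p : X → N` to the dual bundle. -/
theorem exists_dual_lift (E : SmoothVB I N) {p : X → N} (hp : ContMDiff J I ∞ p)
    (Λ : E.Sec → X → ℝ) (hΛ : ∀ e, ContMDiff J 𝓘(ℝ, ℝ) ∞ (Λ e))
    (hadd : ∀ e e' x, Λ (e + e') x = Λ e x + Λ e' x)
    (hsmul : ∀ (f : C^∞⟮I, N; ℝ⟯) e x, Λ (E.fsmul f e) x = f (p x) * Λ e x) :
    ∃ ε : ∀ x, E.dual.V (p x), ContMDiff J E.dual.model ∞ (fun x => (⟨p x, ε x⟩ : E.dual.Tot)) ∧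
      ∀ e x, (ε x (e (p x)) : ℝ) = Λ e x := by
  have key : ∀ x, ∃ φ : E.V (p x) →L[ℝ] ℝ, ∀ e, φ (e (p x)) = Λ e x := fun x => by
    obtain ⟨n, e, θ, χ, hχ, hf⟩ := E.exists_frame (p x)
    refine ⟨∑ i, Λ (e i) x • (θ i (p x) : E.V (p x) →L[ℝ] ℝ), fun s => ?_⟩
    -- The frame identity for s as an equality of global sections: tensoriality then expresses Λ(s)
    -- at x through the numbers Λ(e_i)(x).
    have h₁ : E.fsmul χ s = ∑ i, E.fsmul (E.pairing (θ i) s) (e i) := by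
      ext y
      rw [sum_sec_apply]
      exact (hf y (s y)).symm
    have h₂ : Λ (E.fsmul χ s) x = ∑ i, Λ (E.fsmul (E.pairing (θ i) s) (e i)) x := by
      rw [h₁]
      exact map_sum (AddMonoidHom.mk' (fun e => Λ e x) fun a b => hadd a b x) _ _
    rw [hsmul, hχ.self_of_nhds, one_mul] at h₂
    rw [h₂, sum_apply]
    refine Finset.sum_congr rfl fun i _ => ?_
    rw [hsmul, mul_comm]
    rfl
  choose ε hε using key
  refine ⟨ε, fun x => E.contMDiffAt_dual_of_sec (φ := ε) (hp x) fun e => ?_, fun e x => hε x e⟩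
  exact (hΛ e x).congr_of_eventuallyEq (Filter.Eventually.of_forall fun y => hε y e)

/-- A tensorial map from the sections of a dual bundle to the functions on `X` is given by a lift
of `p : X → N` to the bundle. -/
theorem exists_lift (E : SmoothVB I N) {p : X → N} (hp : ContMDiff J I ∞ p)
    (Λ : E.dual.Sec → X → ℝ) (hΛ : ∀ e, ContMDiff J 𝓘(ℝ, ℝ) ∞ (Λ e))
    (hadd : ∀ e e' x, Λ (e + e') x = Λ e x + Λ e' x)
    (hsmul : ∀ (f : C^∞⟮I, N; ℝ⟯) e x, Λ (E.dual.fsmul f e) x = f (p x) * Λ e x) :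
    ∃ v : ∀ x, E.V (p x), ContMDiff J E.model ∞ (fun x => (⟨p x, v x⟩ : E.Tot)) ∧
      ∀ (θ : E.dual.Sec) x, (θ (p x) (v x) : ℝ) = Λ θ x := by
  have key : ∀ x, ∃ v : E.V (p x), ∀ θ : E.dual.Sec, (θ (p x) v : ℝ) = Λ θ x := fun x => by
    obtain ⟨n, e, θ, χ, hχ, hf⟩ := E.exists_frame (p x)
    refine ⟨∑ i, Λ (θ i) x • e i (p x), fun s => ?_⟩
    have h₁ : E.dual.fsmul χ s = ∑ i, E.dual.fsmul (E.pairing s (e i)) (θ i) := by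
      ext y v
      rw [sum_sec_apply, sum_apply]
      have h := congrArg (fun w => (s y w : ℝ)) (hf y v)
      simp only [map_sum, map_smul] at h
      refine Eq.trans h.symm (Finset.sum_congr rfl fun i _ => ?_)
      exact mul_comm (θ i y v : ℝ) (s y (e i y) : ℝ)
    have h₂ : Λ (E.dual.fsmul χ s) x = ∑ i, Λ (E.dual.fsmul (E.pairing s (e i)) (θ i)) x := by
      rw [h₁]
      exact map_sum (AddMonoidHom.mk' (fun e => Λ e x) fun a b => hadd a b x) _ _
    rw [hsmul, hχ.self_of_nhds, one_mul] at h₂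
    rw [h₂, map_sum]
    refine Finset.sum_congr rfl fun i _ => ?_
    rw [hsmul, mul_comm, map_smul]
    rfl
  choose v hv using key
  refine ⟨v, fun x => E.contMDiffAt_of_dual_sec (v := v) (hp x) fun e => ?_, fun e x => hv x e⟩
  exact (hΛ e x).congr_of_eventuallyEq (Filter.Eventually.of_forall fun y => hv y e)

end Lift

/-- Every section of the bidual is the evaluation on a section. -/
theorem exists_sec_of_bidual (E : SmoothVB I N) (Z : E.dual.dual.Sec) :
    ∃ e : E.Sec, ∀ x (θ : E.dual.V x), (Z x θ : ℝ) = θ (e x) := by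
  obtain ⟨v, hv, h⟩ := E.exists_lift (p := id) contMDiff_id (fun θ x => (Z x (θ x) : ℝ))
    (fun θ => (E.dual.lin Z).contMDiff.comp (E.dual.contMDiff_sec θ))
    (fun θ θ' x => map_add (Z x) (θ x) (θ' x)) (fun f θ x => map_smul (Z x) (f x) (θ x))
  refine ⟨⟨v, hv⟩, fun x θ => ?_⟩
  obtain ⟨s, rfl⟩ := E.dual.exists_sec_apply_eq x θ
  exact (h s x).symm

end SmoothVB
end Bump

/-! ### Differentials of functions -/

section DiffAt

variable {EN HN : Type*} [NormedAddCommGroup EN] [NormedSpace ℝ EN]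
  [TopologicalSpace HN] {I : ModelWithCorners ℝ EN HN} {N : Type*} [TopologicalSpace N]
  [ChartedSpace HN N]
  {EX HX : Type*} [NormedAddCommGroup EX] [NormedSpace ℝ EX] [TopologicalSpace HX]
  {J : ModelWithCorners ℝ EX HX} {X : Type*} [TopologicalSpace X] [ChartedSpace HX X]

theorem diffAt_congr {f g : N → ℝ} {x : N} (h : f =ᶠ[nhds x] g) : diffAt I f x = diffAt I g x :=
  h.mfderiv_eq

theorem diffAt_const (c : ℝ) (x : N) : diffAt I (fun _ => c) x = 0 := mfderiv_const

theorem diffAt_add {f g : N → ℝ} {x : N} (hf : ContMDiffAt I 𝓘(ℝ, ℝ) ∞ f x)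
    (hg : ContMDiffAt I 𝓘(ℝ, ℝ) ∞ g x) : diffAt I (f + g) x = diffAt I f x + diffAt I g x :=
  mfderiv_add (hf.mdifferentiableAt (by simp)) (hg.mdifferentiableAt (by simp))

theorem diffAt_mul {f g : N → ℝ} {x : N} (hf : ContMDiffAt I 𝓘(ℝ, ℝ) ∞ f x)
    (hg : ContMDiffAt I 𝓘(ℝ, ℝ) ∞ g x) :
    diffAt I (f * g) x = f x • diffAt I g x + g x • diffAt I f x := by
  have h := ((hf.mdifferentiableAt (by simp)).hasMFDerivAt.mul
    (hg.mdifferentiableAt (by simp)).hasMFDerivAt).mfderiv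
  exact h

theorem diffAt_const_smul {f : N → ℝ} {x : N} (c : ℝ) (hf : ContMDiffAt I 𝓘(ℝ, ℝ) ∞ f x) :
    diffAt I (fun y => c * f y) x = c • diffAt I f x := by
  have h := diffAt_mul (I := I) (f := fun _ => c) contMDiffAt_const hf
  rw [diffAt_const, smul_zero, add_zero] at h
  exact h

theorem diffAt_sum {ι : Type*} (s : Finset ι) {f : ι → N → ℝ} {x : N}
    (hf : ∀ i ∈ s, ContMDiffAt I 𝓘(ℝ, ℝ) ∞ (f i) x) :
    diffAt I (fun y => ∑ i ∈ s, f i y) x = ∑ i ∈ s, diffAt I (f i) x := by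
  classical
  induction s using Finset.induction_on with
  | empty => simpa using diffAt_const (I := I) 0 x
  | insert a s ha ih =>
    rw [Finset.sum_insert ha, ← ih fun i hi => hf i (Finset.mem_insert_of_mem hi)]
    simp only [Finset.sum_insert ha]
    exact diffAt_add (hf a (Finset.mem_insert_self _ _))
      (ContMDiffAt.sum fun i hi => hf i (Finset.mem_insert_of_mem hi))

theorem diffAt_comp {f : N → ℝ} {g : X → N} {x : X} (hf : ContMDiffAt I 𝓘(ℝ, ℝ) ∞ f (g x))
    (hg : ContMDiffAt J I ∞ g x) :
    diffAt J (fun y => f (g y)) x = (diffAt I f (g x)).comp (mfderiv J I g x) :=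
  mfderiv_comp x (hf.mdifferentiableAt (by simp)) (hg.mdifferentiableAt (by simp))

theorem sum_smul_clm_comp {V W ι : Type*} [AddCommGroup V] [Module ℝ V] [TopologicalSpace V]
    [AddCommGroup W] [Module ℝ W] [TopologicalSpace W] (s : Finset ι) (c : ι → ℝ)
    (f : ι → W →L[ℝ] ℝ) (A : V →L[ℝ] W) :
    (∑ i ∈ s, c i • f i).comp A = ∑ i ∈ s, c i • (f i).comp A := by
  ext
  simp

/-- If functions agree with the coordinates of a chart, the differentials of smooth functions are
combinations of their differentials, with a symmetric matrix of second derivatives. -/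
theorem exists_diffAt_eq_sum [I.Boundaryless] [IsManifold I ∞ N] {ι : Type*} [Fintype ι]
    (b : Module.Basis ι ℝ EN) (x₀ : N) (y : ι → N → ℝ)
    (hy : ∀ᶠ x in nhds x₀, ∀ k, y k x = b.repr (extChartAt I x₀ x) k) :
    (∀ μ : TangentSpace I x₀ →L[ℝ] ℝ, ∃ c : ι → ℝ, μ = ∑ k, c k • diffAt I (y k) x₀) ∧
    ∀ F : N → ℝ, ContMDiff I 𝓘(ℝ, ℝ) ∞ F → ∃ G : ι → N → ℝ,
      (∀ k, ContMDiffAt I 𝓘(ℝ, ℝ) ∞ (G k) x₀) ∧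
      (∀ᶠ x in nhds x₀, diffAt I F x = ∑ k, G k x • diffAt I (y k) x) ∧
      ∃ H : ι → ι → ℝ, (∀ k l, H k l = H l k) ∧
        ∀ k, diffAt I (G k) x₀ = ∑ l, H k l • diffAt I (y l) x₀ := by
  have : FiniteDimensional ℝ EN := b.finiteDimensional_of_finite
  let bc : ι → EN →L[ℝ] ℝ := fun k => LinearMap.toContinuousLinearMap (b.coord k)
  have hsrc : ∀ᶠ x in nhds x₀, x ∈ (extChartAt I x₀).source :=
    extChartAt_source_mem_nhds x₀
  have hchart : ∀ x ∈ (extChartAt I x₀).source, ContMDiffAt I 𝓘(ℝ, EN) ∞ (extChartAt I x₀) x :=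
    fun x hx => contMDiffAt_extChartAt' (by simpa using hx)
  have hdy : ∀ᶠ x in nhds x₀, ∀ k, diffAt I (y k) x =
      (bc k).comp (mfderiv I 𝓘(ℝ, EN) (extChartAt I x₀) x) := by
    filter_upwards [hy.eventually_nhds, hsrc] with x hx hxs k
    have : y k =ᶠ[nhds x] fun z => bc k (extChartAt I x₀ z) := by
      filter_upwards [hx] with z hz using hz k
    rw [diffAt_congr this, diffAt_comp (bc k).contMDiff.contMDiffAt (hchart x hxs)]
    congr 1
    exact (bc k).mfderiv_eq
  have hexp : ∀ (ψ : EN →L[ℝ] ℝ), ψ = ∑ k, ψ (b k) • bc k := fun ψ => by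
    ext z
    have h := congrArg ψ (b.sum_repr z)
    simp only [map_sum, map_smul] at h
    rw [← h]
    simp [bc, mul_comm]
  have hcomp : ∀ᶠ x in nhds x₀, ∀ ψ : EN →L[ℝ] ℝ,
      ψ.comp (mfderiv I 𝓘(ℝ, EN) (extChartAt I x₀) x) = ∑ k, ψ (b k) • diffAt I (y k) x := by
    filter_upwards [hdy] with x hx ψ
    conv_lhs => rw [hexp ψ]
    simp only [hx]
    exact sum_smul_clm_comp _ _ _ _
  have hg : ∀ᶠ x in nhds x₀, ∀ g : EN → ℝ, ContDiffAt ℝ ∞ g (extChartAt I x₀ x) →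
      diffAt I (fun z => g (extChartAt I x₀ z)) x =
        ∑ k, fderiv ℝ g (extChartAt I x₀ x) (b k) • diffAt I (y k) x := by
    filter_upwards [hcomp, hsrc] with x hx hxs g hgx
    rw [← hx (fderiv ℝ g (extChartAt I x₀ x)), diffAt_comp hgx.contMDiffAt (hchart x hxs)]
    congr 1
    exact mfderiv_eq_fderiv
  refine ⟨fun μ => ?_, fun F hF => ?_⟩
  -- The chart has invertible differential at x₀, so each covector there is pulled back from the
  -- model space.
  · obtain ⟨A, hA⟩ := isInvertible_mfderiv_extChartAt (I := I) (mem_extChartAt_source x₀)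
    refine ⟨_, Eq.trans ?_ (hcomp.self_of_nhds (μ.comp A.symm.toContinuousLinearMap))⟩
    ext w
    have : mfderiv I 𝓘(ℝ, EN) (extChartAt I x₀) x₀ w = A w := by rw [← hA]; rfl
    refine Eq.trans ?_ (congrArg (fun z => μ (A.symm z)) this).symm
    exact congrArg μ (A.symm_apply_apply w).symm
  · set g : EN → ℝ := F ∘ (extChartAt I x₀).symm with hgdef
    have hgs : ∀ x ∈ (extChartAt I x₀).source, ContDiffAt ℝ ∞ g (extChartAt I x₀ x) := by
      intro x hx
      have h := (contMDiffAt_iff_source_of_mem_source (x' := x) (by simpa using hx)).1 (hF x)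
      rw [ModelWithCorners.range_eq_univ, contMDiffWithinAt_univ, contMDiffAt_iff_contDiffAt] at h
      exact h
    have hg0 := hgs x₀ (mem_extChartAt_source x₀)
    have hg' : ContDiffAt ℝ ∞ (fderiv ℝ g) (extChartAt I x₀ x₀) := hg0.fderiv_right (by simp)
    have hgk : ∀ k, ContDiffAt ℝ ∞ (fun z => fderiv ℝ g z (b k)) (extChartAt I x₀ x₀) :=
      fun k => hg'.clm_apply contDiffAt_const
    -- G consists of the partial derivatives of F in the chart and H of the second ones at x₀,
    -- symmetric by Schwarz. The symmetry is what makes the second-order terms of the Jacobiator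
    -- cancel.
    refine ⟨fun k x => fderiv ℝ g (extChartAt I x₀ x) (b k), fun k => ?_, ?_,
      fun k l => fderiv ℝ (fderiv ℝ g) (extChartAt I x₀ x₀) (b l) (b k), fun k l => ?_, fun k => ?_⟩
    · exact (hgk k).contMDiffAt.comp x₀ (hchart x₀ (mem_extChartAt_source x₀))
    · filter_upwards [hg, hsrc] with x hx hxs
      rw [← hx g (hgs x hxs)]
      refine diffAt_congr ?_
      filter_upwards [(isOpen_extChartAt_source x₀).mem_nhds hxs] with z hz
      exact (congrArg F ((extChartAt I x₀).left_inv hz)).symm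
    · exact hg0.isSymmSndFDerivAt (by
        rw [minSmoothness_of_isRCLikeNormedField]
        exact WithTop.coe_le_coe.2 (le_top (a := (2 : ℕ∞)))) _ _
    · rw [hg.self_of_nhds _ (hgk k)]
      refine Finset.sum_congr rfl fun l _ => ?_
      congr 1
      rw [fderiv_clm_apply (hg'.differentiableAt (by simp)) (differentiableAt_const _)]
      simp

end DiffAt

/-! ### Coordinates on a vector bundle by linear and basic functions -/

namespace SmoothVB

variable {EN HN : Type*} [NormedAddCommGroup EN] [NormedSpace ℝ EN] [FiniteDimensional ℝ EN]
  [TopologicalSpace HN] {I : ModelWithCorners ℝ EN HN} [I.Boundaryless] {N : Type*}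
  [TopologicalSpace N] [ChartedSpace HN N] [IsManifold I ∞ N] [T2Space N]

/-- A finite family of functions on a manifold whose differentials generate the differentials of
smooth functions near a point, with a symmetric matrix of second derivatives at the point. -/
structure IsCoordinateFamily {EP HP : Type*} [NormedAddCommGroup EP] [NormedSpace ℝ EP]
    [TopologicalSpace HP] (K : ModelWithCorners ℝ EP HP) {P : Type*} [TopologicalSpace P]
    [ChartedSpace HP P] {ι : Type*} [Fintype ι] (y : ι → P → ℝ) (x₀ : P) : Prop where
  smooth : ∀ k, ContMDiff K 𝓘(ℝ, ℝ) ∞ (y k)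
  span : ∀ μ : TangentSpace K x₀ →L[ℝ] ℝ, ∃ c : ι → ℝ, μ = ∑ k, c k • diffAt K (y k) x₀
  expand : ∀ F : P → ℝ, ContMDiff K 𝓘(ℝ, ℝ) ∞ F → ∃ G : ι → P → ℝ,
      (∀ k, ContMDiffAt K 𝓘(ℝ, ℝ) ∞ (G k) x₀) ∧
      (∀ᶠ x in nhds x₀, diffAt K F x = ∑ k, G k x • diffAt K (y k) x) ∧
      ∃ H : ι → ι → ℝ, (∀ k l, H k l = H l k) ∧
        ∀ k, diffAt K (G k) x₀ = ∑ l, H k l • diffAt K (y l) x₀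

/-- Over a trivializing chart the coordinates of E are those of the base and the linear fibre
coordinates. Multiplied by a bump function from the base they become globally defined and keep the
form ℓ_θ + q^*f. -/
theorem exists_coordinates (E : SmoothVB I N) (v₀ : E.Tot) :
    ∃ (ι : Type) (_ : Fintype ι) (y : ι → E.Tot → ℝ),
      (∀ k, ∃ (θ : E.dual.Sec) (f : C^∞⟮I, N; ℝ⟯), ∀ v, y k v = θ v.1 v.2 + f v.1) ∧
      IsCoordinateFamily E.model y v₀ := by
  set T := trivializationAt E.F E.V v₀.1 with hT
  have hU : T.baseSet ∩ (chartAt HN v₀.1).source ∈ nhds v₀.1 := Filter.inter_mem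
    (T.open_baseSet.mem_nhds (FiberBundle.mem_baseSet_trivializationAt' v₀.1))
    (chart_source_mem_nhds HN v₀.1)
  obtain ⟨χ, hχ, hs⟩ := exists_bump I v₀.1 hU
  let b₁ := Module.finBasis ℝ EN
  let b₂ := Module.finBasis ℝ E.F
  have h₁ : ∀ i, ∃ f : C^∞⟮I, N; ℝ⟯, ∀ x, f x = χ x * b₁.repr (extChartAt I v₀.1 x) i := fun i =>
    ⟨⟨_, exists_smooth_extension (hs.trans Set.inter_subset_right)
      (f := fun x => LinearMap.toContinuousLinearMap (b₁.coord i) (extChartAt I v₀.1 x))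
      fun x hx => (ContinuousLinearMap.contMDiff _).contMDiffAt.comp x
        (contMDiffAt_extChartAt' hx)⟩, fun x => rfl⟩
  have h₂ := fun i => E.exists_dual_sec_of_trivialization v₀.1 (hs.trans Set.inter_subset_left)
    (LinearMap.toContinuousLinearMap (b₂.coord i))
  choose f hf using h₁
  choose θ hθ using h₂
  simp only [← hT] at hθ
  let y : Fin (Module.finrank ℝ EN) ⊕ Fin (Module.finrank ℝ E.F) → E.Tot → ℝ :=
    Sum.elim (fun i v => f i v.1) (fun i v => θ i v.1 v.2)
  have hev : ∀ᶠ v in nhds v₀, ∀ k, y k v =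
      (b₁.prod b₂).repr (extChartAt E.model v₀ v) k := by
    filter_upwards [(FiberBundle.continuous_proj E.F E.V).continuousAt.eventually hχ,
      (FiberBundle.continuous_proj E.F E.V).continuousAt.eventually hU] with v hv hvU k
    have hext : extChartAt E.model v₀ v = (extChartAt I v₀.1 v.1, (T v).2) := by
      rw [FiberBundle.extChartAt]
      have : (T v).1 = v.1 := T.coe_fst (T.mem_source.2 hvU.1)
      simp [← hT, this]
    rw [hext]
    rcases k with i | i
    · simp [y, hf, hv]
    · simp only [y, Sum.elim_inr, hθ, hv, one_mul]
      have := T.continuousLinearMapAt_apply_of_mem (R := ℝ) hvU.1 v.2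
      simp [T.coe_linearMapAt_of_mem hvU.1]
  obtain ⟨hspan, hexp⟩ := exists_diffAt_eq_sum (I := E.model) (b₁.prod b₂) v₀ y hev
  refine ⟨_, inferInstance, y, ?_, ?_, hspan, hexp⟩
  · rintro (i | i)
    · exact ⟨0, f i, fun v => (zero_add _).symm⟩
    · exact ⟨θ i, 0, fun v => (add_zero _).symm⟩
  · rintro (i | i)
    · exact (E.pull (f i)).contMDiff
    · exact (E.lin (θ i)).contMDiff

/-- On E^* the fibre coordinates come from sections of the bidual, which are evaluations at sections
of E. -/
theorem exists_dual_coordinates (E : SmoothVB I N) (φ₀ : E.dual.Tot) :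
    ∃ (ι : Type) (_ : Fintype ι) (ξ : ι → E.Sec) (f : ι → C^∞⟮I, N; ℝ⟯),
      IsCoordinateFamily E.dual.model (fun k => (E.ell (ξ k) + E.dual.pull (f k) : E.dual.Tot → ℝ))
        φ₀ := by
  obtain ⟨ι, hι, y, hy, h⟩ := E.dual.exists_coordinates φ₀
  choose Z f hZ using hy
  choose ξ hξ using fun k => E.exists_sec_of_bidual (Z k)
  refine ⟨ι, hι, ξ, f, ?_⟩
  convert h using 3 with k
  ext φ
  rw [hZ, hξ]
  rfl

/-- Tangent vectors of a vector bundle are separated by the fibrewise linear functions and the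
functions from the base. -/
theorem tangent_ext (E : SmoothVB I N) {v₀ : E.Tot} {u w : TangentSpace E.model v₀}
    (h₁ : ∀ θ : E.dual.Sec, diffAt E.model (E.lin θ) v₀ u = diffAt E.model (E.lin θ) v₀ w)
    (h₂ : ∀ f : C^∞⟮I, N; ℝ⟯, diffAt E.model (E.pull f) v₀ u = diffAt E.model (E.pull f) v₀ w) :
    u = w := by
  have key : ∀ μ : TangentSpace E.model v₀ →L[ℝ] ℝ, μ u = μ w := fun μ => by
    obtain ⟨ι, hι, y, hy, h⟩ := E.exists_coordinates v₀
    obtain ⟨c, rfl⟩ := h.span μ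
    simp only [sum_apply, smul_apply]
    refine Finset.sum_congr rfl fun k _ => ?_
    obtain ⟨θ, f, hk⟩ := hy k
    have : y k = (E.lin θ : E.Tot → ℝ) + E.pull f := funext hk
    rw [this, diffAt_add (E.lin θ).contMDiff.contMDiffAt (E.pull f).contMDiff.contMDiffAt,
      add_apply, add_apply, h₁, h₂]
  by_contra hne
  obtain ⟨μ, hμ⟩ := SeparatingDual.exists_separating_of_ne (R := ℝ) (V := EN × E.F) hne
  exact hμ (key μ)

end SmoothVB

/-! ### The linear Poisson structure on the dual of a Lie algebroid -/

namespace SmoothVB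

variable {EN HN : Type*} [NormedAddCommGroup EN] [NormedSpace ℝ EN]
  [TopologicalSpace HN] {I : ModelWithCorners ℝ EN HN} {N : Type*}
  [TopologicalSpace N] [ChartedSpace HN N] [IsManifold I ∞ N] (E : SmoothVB I N)

theorem ell_add (ξ η : E.Sec) (φ : E.dual.Tot) : E.ell (ξ + η) φ = E.ell ξ φ + E.ell η φ :=
  map_add φ.2 (ξ φ.1) (η φ.1)

theorem ell_smul (c : ℝ) (ξ : E.Sec) (φ : E.dual.Tot) : E.ell (c • ξ) φ = c * E.ell ξ φ :=
  map_smul φ.2 c (ξ φ.1)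

theorem ell_neg (ξ : E.Sec) (φ : E.dual.Tot) : E.ell (-ξ) φ = -E.ell ξ φ :=
  map_neg φ.2 (ξ φ.1)

theorem ell_sub (ξ η : E.Sec) (φ : E.dual.Tot) : E.ell (ξ - η) φ = E.ell ξ φ - E.ell η φ :=
  map_sub φ.2 (ξ φ.1) (η φ.1)

theorem ell_zero (φ : E.dual.Tot) : E.ell 0 φ = 0 :=
  map_zero φ.2

theorem ell_fsmul (f : C^∞⟮I, N; ℝ⟯) (ξ : E.Sec) (φ : E.dual.Tot) :
    E.ell (E.fsmul f ξ) φ = f φ.1 * E.ell ξ φ :=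
  map_smul φ.2 (f φ.1) (ξ φ.1)

end SmoothVB

namespace LieAlgebroid

variable {EN HN : Type*} [NormedAddCommGroup EN] [NormedSpace ℝ EN] [FiniteDimensional ℝ EN]
  [TopologicalSpace HN] {I : ModelWithCorners ℝ EN HN} [I.Boundaryless] {N : Type*}
  [TopologicalSpace N] [ChartedSpace HN N] [IsManifold I ∞ N] [T2Space N]
  {E : SmoothVB I N} (L : LieAlgebroid E)

theorem contMDiff_diffAt_apply {EX HX : Type*} [NormedAddCommGroup EX] [NormedSpace ℝ EX]
    [TopologicalSpace HX] {J : ModelWithCorners ℝ EX HX} {X : Type*} [TopologicalSpace X]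
    [ChartedSpace HX X] (f : C^∞⟮I, N; ℝ⟯) {v : X → TangentBundle I N}
    (hv : ContMDiff J I.tangent ∞ v) :
    ContMDiff J 𝓘(ℝ, ℝ) ∞ (fun x => diffAt I f (v x).1 (v x).2) := by
  have h : ContMDiff I.tangent 𝓘(ℝ, ℝ).tangent ∞ (tangentMap I 𝓘(ℝ, ℝ) f) :=
    f.contMDiff.contMDiff_tangentMap (by simp)
  exact (contMDiff_snd_tangentBundle_modelSpace ℝ 𝓘(ℝ, ℝ)).comp (h.comp hv)

/-- The derivative of a function along the anchor of a section. -/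
def act (a : E.Sec) (f : C^∞⟮I, N; ℝ⟯) : C^∞⟮I, N; ℝ⟯ :=
  ⟨fun x => diffAt I f x (L.anchor x (a x)),
    contMDiff_diffAt_apply f (L.anchor_smooth.comp (E.contMDiff_sec a))⟩

theorem act_apply (a : E.Sec) (f : C^∞⟮I, N; ℝ⟯) (x : N) :
    L.act a f x = diffAt I f x (L.anchor x (a x)) := rfl

theorem bracket_skew (a b : E.Sec) : L.bracket a b = -L.bracket b a := by
  have h := L.bracket_self (a + b)
  simp only [map_add, LinearMap.add_apply, L.bracket_self, zero_add, add_zero] at h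
  exact eq_neg_of_add_eq_zero_right h

theorem bracket_fsmul (a b : E.Sec) (f : C^∞⟮I, N; ℝ⟯) :
    L.bracket a (E.fsmul f b) = E.fsmul f (L.bracket a b) + E.fsmul (L.act a f) b := by
  ext x
  exact L.leibniz a b f x

theorem act_mul (a : E.Sec) (f g : C^∞⟮I, N; ℝ⟯) (x : N) :
    L.act a (f * g) x = f x * L.act a g x + g x * L.act a f x := by
  simp only [act_apply, ContMDiffMap.coe_mul]
  rw [diffAt_mul f.contMDiff.contMDiffAt g.contMDiff.contMDiffAt]
  rfl

/-- Not an axiom: expanding the Jacobi identity for a, b and fc by the Leibniz rule leaves the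
difference of the two sides times c(x), and c can be chosen nonzero at x. If the fibre at x is zero,
every anchor occurring here vanishes. -/
theorem act_bracket (a b : E.Sec) (f : C^∞⟮I, N; ℝ⟯) (x : N) :
    L.act (L.bracket a b) f x = L.act a (L.act b f) x - L.act b (L.act a f) x := by
  by_cases hx : Subsingleton (E.V x)
  · have h0 : ∀ s : E.Sec, s x = 0 := fun s => Subsingleton.elim _ _
    simp [act_apply, h0]
  · rw [not_subsingleton_iff_nontrivial] at hx
    obtain ⟨v, hv⟩ := exists_ne (0 : E.V x)
    obtain ⟨c, rfl⟩ := E.exists_sec_apply_eq x v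
    have h := congrArg (fun s : E.Sec => s x) (L.jacobi a b (E.fsmul f c))
    have h' := congrArg (fun s : E.Sec => s x) (L.jacobi a b c)
    simp only [bracket_fsmul, map_add, ContMDiffSection.coe_add, Pi.add_apply,
      SmoothVB.fsmul_apply] at h h'
    have : (L.act (L.bracket a b) f x - (L.act a (L.act b f) x - L.act b (L.act a f) x)) • c x
        = 0 := by
      rw [h'] at h
      rw [← neg_eq_zero, ← sub_eq_zero.2 h]
      module
    rcases smul_eq_zero.1 this with h0 | h0
    · linarith
    · exact absurd h0 hv

theorem act_add_right (a : E.Sec) (f g : C^∞⟮I, N; ℝ⟯) (x : N) :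
    L.act a (f + g) x = L.act a f x + L.act a g x := by
  simp only [act_apply, ContMDiffMap.coe_add]
  rw [diffAt_add f.contMDiff.contMDiffAt g.contMDiff.contMDiffAt]
  rfl

theorem act_smul_right (a : E.Sec) (c : ℝ) (f : C^∞⟮I, N; ℝ⟯) (x : N) :
    L.act a (c • f) x = c * L.act a f x := by
  simp only [act_apply]
  exact congrArg (fun μ : TangentSpace I x →L[ℝ] ℝ => μ (L.anchor x (a x)))
    (diffAt_const_smul c f.contMDiff.contMDiffAt)

theorem sum_smooth_apply {ι : Type*} (s : Finset ι) (f : ι → C^∞⟮I, N; ℝ⟯) (x : N) :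
    (∑ i ∈ s, f i) x = ∑ i ∈ s, f i x :=
  map_sum (AddMonoidHom.mk' (fun f : C^∞⟮I, N; ℝ⟯ => f x) fun _ _ => rfl) f s

theorem act_sum (a : E.Sec) {ι : Type*} (s : Finset ι) (f : ι → C^∞⟮I, N; ℝ⟯) (x : N) :
    L.act a (∑ i ∈ s, f i) x = ∑ i ∈ s, L.act a (f i) x :=
  map_sum (AddMonoidHom.mk' (fun f => L.act a f x) fun f g => L.act_add_right a f g x) f s

theorem act_add_left (a b : E.Sec) (f : C^∞⟮I, N; ℝ⟯) (x : N) :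
    L.act (a + b) f x = L.act a f x + L.act b f x := by
  simp [act_apply]

theorem act_smul_left (a : E.Sec) (c : ℝ) (f : C^∞⟮I, N; ℝ⟯) (x : N) :
    L.act (c • a) f x = c * L.act a f x := by
  simp [act_apply]

/-- The differential of `ℓ_ξ + q^* f` at `φ`, as a linear map. -/
def diffGen (E : SmoothVB I N) (φ : E.dual.Tot) :
    (E.Sec × C^∞⟮I, N; ℝ⟯) →ₗ[ℝ] (TangentSpace E.dual.model φ →L[ℝ] ℝ) where
  toFun z := diffAt E.dual.model (E.ell z.1 + E.dual.pull z.2 : E.dual.Tot → ℝ) φ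
  map_add' z w := by
    rw [← diffAt_add ((E.ell z.1).contMDiff.add (E.dual.pull z.2).contMDiff).contMDiffAt
      ((E.ell w.1).contMDiff.add (E.dual.pull w.2).contMDiff).contMDiffAt]
    congr 1
    ext φ
    simp only [Pi.add_apply, Prod.fst_add, Prod.snd_add]
    rw [E.ell_add]
    exact add_add_add_comm _ _ _ _
  map_smul' c z := by
    rw [RingHom.id_apply, ← diffAt_const_smul c
      ((E.ell z.1).contMDiff.add (E.dual.pull z.2).contMDiff).contMDiffAt]
    congr 1
    ext φ
    simp only [Pi.add_apply, Prod.smul_fst, Prod.smul_snd]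
    rw [E.ell_smul]
    exact (mul_add _ _ _).symm

theorem diffGen_surjective (E : SmoothVB I N) (φ : E.dual.Tot) :
    Function.Surjective (diffGen E φ) := fun μ => by
  obtain ⟨ι, hι, ξ, f, h⟩ := E.exists_dual_coordinates φ
  obtain ⟨c, rfl⟩ := h.span μ
  refine ⟨∑ k, c k • (ξ k, f k), ?_⟩
  rw [map_sum]
  simp only [map_smul]
  rfl

/-- The value at `φ` of the linear Poisson bracket of `ℓ_ξ + q^* f` and `ℓ_η + q^* g`. -/
def genBracket (φ : E.dual.Tot) :
    (E.Sec × C^∞⟮I, N; ℝ⟯) →ₗ[ℝ] (E.Sec × C^∞⟮I, N; ℝ⟯) →ₗ[ℝ] ℝ :=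
  LinearMap.mk₂ ℝ (fun z w => E.ell (L.bracket z.1 w.1) φ + L.act z.1 w.2 φ.1 - L.act w.1 z.2 φ.1)
    (fun z z' w => by
      simp only [Prod.fst_add, Prod.snd_add, map_add, LinearMap.add_apply]
      rw [E.ell_add, act_add_left, act_add_right]
      ring)
    (fun c z w => by
      simp only [Prod.smul_fst, Prod.smul_snd, map_smul, LinearMap.smul_apply]
      rw [E.ell_smul, act_smul_left, act_smul_right, smul_eq_mul]
      ring)
    (fun z w w' => by
      simp only [Prod.fst_add, Prod.snd_add, map_add]
      rw [E.ell_add, act_add_left, act_add_right]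
      ring)
    (fun c z w => by
      simp only [Prod.smul_fst, Prod.smul_snd, map_smul]
      rw [E.ell_smul, act_smul_left, act_smul_right, smul_eq_mul]
      ring)

theorem genBracket_apply (φ : E.dual.Tot) (z w : E.Sec × C^∞⟮I, N; ℝ⟯) :
    L.genBracket φ z w =
      E.ell (L.bracket z.1 w.1) φ + L.act z.1 w.2 φ.1 - L.act w.1 z.2 φ.1 := rfl

theorem genBracket_skew (φ : E.dual.Tot) (z w : E.Sec × C^∞⟮I, N; ℝ⟯) :
    L.genBracket φ z w = -L.genBracket φ w z := by
  rw [genBracket_apply, genBracket_apply, L.bracket_skew, E.ell_neg]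
  ring

/-- The section of the dual bundle through `φ` given by a frame. -/
theorem exists_sec_dual_apply_eq (E : SmoothVB I N) (φ : E.dual.Tot) :
    ∃ θ : E.dual.Sec, (⟨φ.1, θ φ.1⟩ : E.dual.Tot) = φ := by
  obtain ⟨θ, h⟩ := E.dual.exists_sec_apply_eq φ.1 φ.2
  exact ⟨θ, by rw [h]⟩

/-- Along a line φ + tθ in the fibre, ℓ_ξ + q^*f has derivative θ(ξ). -/
theorem apply_eq_zero_of_diffGen_eq_zero {φ : E.dual.Tot} {z : E.Sec × C^∞⟮I, N; ℝ⟯}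
    (hz : diffGen E φ z = 0) : z.1 φ.1 = 0 := by
  refine E.eq_of_dual_sec fun θ => ?_
  let c : ℝ → E.dual.Tot := fun t => ⟨φ.1, φ.2 + t • θ φ.1⟩
  have hc : ContMDiff 𝓘(ℝ, ℝ) E.dual.model ∞ c := fun t =>
    E.dual.contMDiffAt_add (p := fun _ => φ.1) contMDiffAt_const
      (E.dual.contMDiffAt_smul contMDiffAt_id contMDiffAt_const)
  have hc0 : c 0 = φ := by simp [c]
  have hs := ((E.ell z.1).contMDiff.add (E.dual.pull z.2).contMDiff).contMDiffAt (x := c 0)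
  have h := diffAt_comp hs (hc 0)
  have h0 : diffAt E.dual.model (E.ell z.1 + E.dual.pull z.2 : E.dual.Tot → ℝ) (c 0) = 0 := by
    rw [hc0]
    exact hz
  rw [h0, ContinuousLinearMap.zero_comp] at h
  have h' : HasDerivAt (fun t : ℝ => (φ.2 (z.1 φ.1) + z.2 φ.1 : ℝ) + t * θ φ.1 (z.1 φ.1))
      (θ φ.1 (z.1 φ.1)) 0 := by
    simpa using ((hasDerivAt_id (0 : ℝ)).mul_const (θ φ.1 (z.1 φ.1) : ℝ)).const_add (φ.2 (z.1 φ.1) + z.2 φ.1 : ℝ)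
  have h2 : deriv (fun t : ℝ => (E.ell z.1 + E.dual.pull z.2 : E.dual.Tot → ℝ) (c t)) 0 = 0 := by
    rw [← fderiv_apply_one_eq_deriv, ← mfderiv_eq_fderiv]
    exact congrArg (fun μ : ℝ →L[ℝ] ℝ => μ 1) h
  have h3 : (fun t : ℝ => (E.ell z.1 + E.dual.pull z.2 : E.dual.Tot → ℝ) (c t)) =
      fun t : ℝ => (φ.2 (z.1 φ.1) + z.2 φ.1 : ℝ) + t * θ φ.1 (z.1 φ.1) := by
    ext t
    change (φ.2 (z.1 φ.1) + t * θ φ.1 (z.1 φ.1) : ℝ) + z.2 φ.1 = _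
    ring
  rw [h3, h'.deriv] at h2
  rw [h2]
  exact (map_zero (θ φ.1)).symm

/-- This makes the bracket depend on differentials only. Write z = (ξ, f), w = (η, g), and let Φ be
a section of E^* extending φ. As ξ vanishes at the base point, ⟨φ, [ξ, η]⟩ is minus the derivative
of ⟨Φ, ξ⟩ along ρ(η), and ρ(ξ)g = 0. What remains is -ρ(η)(⟨Φ, ξ⟩ + f), which is zero because ⟨Φ, ξ⟩
+ f is the pullback of ℓ_ξ + q^*f along Φ. -/
theorem genBracket_eq_zero {φ : E.dual.Tot} {z : E.Sec × C^∞⟮I, N; ℝ⟯}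
    (hz : diffGen E φ z = 0) (w : E.Sec × C^∞⟮I, N; ℝ⟯) : L.genBracket φ z w = 0 := by
  obtain ⟨n, e, θ, χ, hχ, hf⟩ := E.exists_frame φ.1
  have h0 := apply_eq_zero_of_diffGen_eq_zero hz
  -- the function `⟨Φ, ξ⟩ + f` for an extension `Φ` of `φ`
  obtain ⟨Φ, hΦ⟩ := exists_sec_dual_apply_eq E φ
  have hΦ' : ∀ v : E.V φ.1, (Φ φ.1 v : ℝ) = φ.2 v := fun v => by
    have := congrArg (fun ψ : E.dual.Tot => E.eval ψ ⟨φ.1, v⟩) hΦ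
    simpa [SmoothVB.eval] using this
  have hk : diffAt I (E.pairing Φ z.1 + z.2 : N → ℝ) φ.1 = 0 := by
    have hs := ((E.ell z.1).contMDiff.add (E.dual.pull z.2).contMDiff).contMDiffAt
      (x := (⟨φ.1, Φ φ.1⟩ : E.dual.Tot))
    have h := diffAt_comp (g := fun x => (⟨x, Φ x⟩ : E.dual.Tot)) (x := φ.1) hs
      (E.dual.contMDiff_sec Φ φ.1)
    have h0 : diffAt E.dual.model (E.ell z.1 + E.dual.pull z.2 : E.dual.Tot → ℝ)
        (⟨φ.1, Φ φ.1⟩ : E.dual.Tot) = 0 := by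
      rw [hΦ]
      exact hz
    rw [h0, ContinuousLinearMap.zero_comp] at h
    exact h
  -- bracket in terms of the frame
  have hb : L.bracket z.1 w.1 φ.1 = - ∑ i, L.act w.1 (E.pairing (θ i) z.1) φ.1 • e i φ.1 := by
    have h₁ : E.fsmul χ z.1 = ∑ i, E.fsmul (E.pairing (θ i) z.1) (e i) := by
      ext y
      rw [SmoothVB.sum_sec_apply]
      exact (hf y (z.1 y)).symm
    have h₂ := congrArg (fun s : E.Sec => s φ.1) (congrArg (L.bracket w.1) h₁)
    simp only [map_sum, bracket_fsmul, SmoothVB.sum_sec_apply, ContMDiffSection.coe_add,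
      Pi.add_apply, SmoothVB.fsmul_apply, h0, smul_zero, add_zero, hχ.self_of_nhds, one_smul,
      SmoothVB.pairing_apply] at h₂
    rw [L.bracket_skew, ContMDiffSection.coe_neg, Pi.neg_apply, h₂]
    congr 1
    refine Finset.sum_congr rfl fun i _ => ?_
    have : (θ i φ.1 0 : ℝ) = 0 := map_zero (θ i φ.1)
    rw [this, zero_smul, zero_add]
  have hsum : L.act w.1 (E.pairing Φ z.1) φ.1 =
      ∑ i, L.act w.1 (E.pairing (θ i) z.1) φ.1 * φ.2 (e i φ.1) := by
    have h₁ : χ * E.pairing Φ z.1 = ∑ i, E.pairing (θ i) z.1 * E.pairing Φ (e i) := by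
      ext y
      have h := congrArg (fun v => (Φ y v : ℝ)) (hf y (z.1 y))
      simp only [map_sum, map_smul] at h
      rw [sum_smooth_apply]
      exact h.symm
    have h₂ := congrArg (fun f => L.act w.1 f φ.1) h₁
    simp only [act_sum, act_mul, SmoothVB.pairing_apply, h0, hΦ', map_zero, hχ.self_of_nhds,
      one_mul, zero_mul, add_zero, zero_add] at h₂
    rw [h₂]
    exact Finset.sum_congr rfl fun i _ => mul_comm _ _
  have hkw : L.act w.1 (E.pairing Φ z.1) φ.1 + L.act w.1 z.2 φ.1 = 0 := by
    rw [← act_add_right]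
    exact congrArg (fun μ : TangentSpace I φ.1 →L[ℝ] ℝ => μ (L.anchor φ.1 (w.1 φ.1))) hk
  rw [genBracket_apply]
  have h1 : L.act z.1 w.2 φ.1 = 0 := by simp [act_apply, h0]
  have h2 : E.ell (L.bracket z.1 w.1) φ = - L.act w.1 (E.pairing Φ z.1) φ.1 := by
    rw [hsum, SmoothVB.ell_apply, hb, map_neg, map_sum]
    congr 1
    exact Finset.sum_congr rfl fun i _ => map_smul φ.2 _ _
  rw [h1, h2]
  linarith

end LieAlgebroid

/-! ### The Poisson bivector and the Jacobi identity -/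

namespace LieAlgebroid

variable {EN HN : Type*} [NormedAddCommGroup EN] [NormedSpace ℝ EN] [FiniteDimensional ℝ EN]
  [TopologicalSpace HN] {I : ModelWithCorners ℝ EN HN} [I.Boundaryless] {N : Type*}
  [TopologicalSpace N] [ChartedSpace HN N] [IsManifold I ∞ N] [T2Space N]
  {E : SmoothVB I N} (L : LieAlgebroid E)

/-- The form on generators descends along the surjection `diffGen`: the first argument by
`genBracket_eq_zero`, the second by skew-symmetry. -/
theorem exists_bivector (φ : E.dual.Tot) :
    ∃ w₂ : (TangentSpace E.dual.model φ →L[ℝ] ℝ) →ₗ[ℝ] (TangentSpace E.dual.model φ →L[ℝ] ℝ) →ₗ[ℝ] ℝ,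
      ∀ z w, w₂ (diffGen E φ z) (diffGen E φ w) = L.genBracket φ z w := by
  obtain ⟨σ, hσ⟩ := (diffGen E φ).exists_rightInverse_of_surjective
    (LinearMap.range_eq_top.2 (diffGen_surjective E φ))
  have hσ' : ∀ μ, diffGen E φ (σ μ) = μ := fun μ => LinearMap.congr_fun hσ μ
  refine ⟨(L.genBracket φ).compl₁₂ σ σ, fun z w => ?_⟩
  have h : ∀ z w, L.genBracket φ (σ (diffGen E φ z)) w = L.genBracket φ z w := fun z w => by
    rw [← sub_eq_zero, ← LinearMap.sub_apply, ← map_sub]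
    exact L.genBracket_eq_zero (by rw [map_sub, hσ', sub_self]) w
  rw [LinearMap.compl₁₂_apply, h, L.genBracket_skew, h, ← L.genBracket_skew]

/-- The bivector of the linear Poisson structure on `E^*`. -/
def bivector (φ : E.dual.Tot) :
    (TangentSpace E.dual.model φ →L[ℝ] ℝ) →ₗ[ℝ] (TangentSpace E.dual.model φ →L[ℝ] ℝ) →ₗ[ℝ] ℝ :=
  Classical.choose (L.exists_bivector φ)

theorem bivector_diffGen (φ : E.dual.Tot) (z w : E.Sec × C^∞⟮I, N; ℝ⟯) :
    L.bivector φ (diffGen E φ z) (diffGen E φ w) = L.genBracket φ z w :=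
  Classical.choose_spec (L.exists_bivector φ) z w

theorem bivector_skew (φ : E.dual.Tot) (μ ν : TangentSpace E.dual.model φ →L[ℝ] ℝ) :
    L.bivector φ μ ν = -L.bivector φ ν μ := by
  obtain ⟨z, rfl⟩ := diffGen_surjective E φ μ
  obtain ⟨w, rfl⟩ := diffGen_surjective E φ ν
  rw [bivector_diffGen, bivector_diffGen, genBracket_skew]

/-- Representing generators exist, and whichever ones the choice operator selects, the value is that
of the bivector. From here on the bracket is handled as a bilinear form in the differentials. -/
theorem liePoisson_eq_bivector (F G : E.dual.Tot → ℝ) (φ : E.dual.Tot) :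
    liePoisson L F G φ = L.bivector φ (diffAt E.dual.model F φ) (diffAt E.dual.model G φ) := by
  have h : ∃ r : ℝ, ∃ (ξ η : E.Sec) (f g : C^∞⟮I, N; ℝ⟯),
    diffAt E.dual.model F φ = diffAt E.dual.model (E.ell ξ + E.dual.pull f) φ ∧
    diffAt E.dual.model G φ = diffAt E.dual.model (E.ell η + E.dual.pull g) φ ∧
    r = E.ell (L.bracket ξ η) φ + diffAt I g φ.1 (L.anchor φ.1 (ξ φ.1))
      - diffAt I f φ.1 (L.anchor φ.1 (η φ.1)) := by
    obtain ⟨z, hz⟩ := diffGen_surjective E φ (diffAt E.dual.model F φ)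
    obtain ⟨w, hw⟩ := diffGen_surjective E φ (diffAt E.dual.model G φ)
    exact ⟨_, z.1, w.1, z.2, w.2, hz.symm, hw.symm, rfl⟩
  obtain ⟨ξ, η, f, g, h₁, h₂, h₃⟩ := Classical.epsilon_spec h
  rw [liePoisson, h₃, h₁, h₂]
  exact (L.bivector_diffGen φ (ξ, f) (η, g)).symm

variable {L}

theorem liePoisson_congr {F F' G G' : E.dual.Tot → ℝ} {φ : E.dual.Tot} (hF : F =ᶠ[nhds φ] F')
    (hG : G =ᶠ[nhds φ] G') : liePoisson L F G φ = liePoisson L F' G' φ := by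
  rw [liePoisson_eq_bivector, liePoisson_eq_bivector, diffAt_congr hF, diffAt_congr hG]

theorem liePoisson_skew (F G : E.dual.Tot → ℝ) (φ : E.dual.Tot) :
    liePoisson L F G φ = -liePoisson L G F φ := by
  rw [liePoisson_eq_bivector, liePoisson_eq_bivector, bivector_skew]

variable {φ : E.dual.Tot}

theorem liePoisson_of_diffAt_right_eq_sum {ι : Type*} {s : Finset ι} {F G : E.dual.Tot → ℝ}
    {c : ι → ℝ} {y : ι → E.dual.Tot → ℝ}
    (h : diffAt E.dual.model G φ = ∑ i ∈ s, c i • diffAt E.dual.model (y i) φ) :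
    liePoisson L F G φ = ∑ i ∈ s, c i * liePoisson L F (y i) φ := by
  simp only [liePoisson_eq_bivector, h, map_sum, map_smul, smul_eq_mul]

theorem liePoisson_of_diffAt_left_eq_sum {ι : Type*} {s : Finset ι} {F G : E.dual.Tot → ℝ}
    {c : ι → ℝ} {y : ι → E.dual.Tot → ℝ}
    (h : diffAt E.dual.model F φ = ∑ i ∈ s, c i • diffAt E.dual.model (y i) φ) :
    liePoisson L F G φ = ∑ i ∈ s, c i * liePoisson L (y i) G φ := by
  rw [liePoisson_skew, liePoisson_of_diffAt_right_eq_sum h, ← Finset.sum_neg_distrib]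
  refine Finset.sum_congr rfl fun i _ => ?_
  rw [liePoisson_skew G]
  ring

theorem liePoisson_add_right {F G H : E.dual.Tot → ℝ}
    (hG : ContMDiffAt E.dual.model 𝓘(ℝ, ℝ) ∞ G φ) (hH : ContMDiffAt E.dual.model 𝓘(ℝ, ℝ) ∞ H φ) :
    liePoisson L F (G + H) φ = liePoisson L F G φ + liePoisson L F H φ := by
  simp only [liePoisson_eq_bivector, diffAt_add hG hH, map_add]

theorem liePoisson_add_left {F G H : E.dual.Tot → ℝ}
    (hG : ContMDiffAt E.dual.model 𝓘(ℝ, ℝ) ∞ G φ) (hH : ContMDiffAt E.dual.model 𝓘(ℝ, ℝ) ∞ H φ) :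
    liePoisson L (G + H) F φ = liePoisson L G F φ + liePoisson L H F φ := by
  simp only [liePoisson_eq_bivector, diffAt_add hG hH, map_add, LinearMap.add_apply]

theorem liePoisson_mul_right {F G H : E.dual.Tot → ℝ}
    (hG : ContMDiffAt E.dual.model 𝓘(ℝ, ℝ) ∞ G φ) (hH : ContMDiffAt E.dual.model 𝓘(ℝ, ℝ) ∞ H φ) :
    liePoisson L F (G * H) φ = G φ * liePoisson L F H φ + H φ * liePoisson L F G φ := by
  simp only [liePoisson_eq_bivector, diffAt_mul hG hH, map_add, map_smul, smul_eq_mul]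

theorem liePoisson_mul_left {F G H : E.dual.Tot → ℝ}
    (hG : ContMDiffAt E.dual.model 𝓘(ℝ, ℝ) ∞ G φ) (hH : ContMDiffAt E.dual.model 𝓘(ℝ, ℝ) ∞ H φ) :
    liePoisson L (G * H) F φ = G φ * liePoisson L H F φ + H φ * liePoisson L G F φ := by
  simp only [liePoisson_eq_bivector, diffAt_mul hG hH, map_add, map_smul, smul_eq_mul,
    LinearMap.add_apply, LinearMap.smul_apply]

theorem liePoisson_sum_right {ι : Type*} {s : Finset ι} {F : E.dual.Tot → ℝ}
    {y : ι → E.dual.Tot → ℝ} (hy : ∀ i ∈ s, ContMDiffAt E.dual.model 𝓘(ℝ, ℝ) ∞ (y i) φ) :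
    liePoisson L F (fun ψ => ∑ i ∈ s, y i ψ) φ = ∑ i ∈ s, liePoisson L F (y i) φ := by
  simp only [liePoisson_eq_bivector, diffAt_sum s hy, map_sum]

theorem liePoisson_sum_left {ι : Type*} {s : Finset ι} {F : E.dual.Tot → ℝ}
    {y : ι → E.dual.Tot → ℝ} (hy : ∀ i ∈ s, ContMDiffAt E.dual.model 𝓘(ℝ, ℝ) ∞ (y i) φ) :
    liePoisson L (fun ψ => ∑ i ∈ s, y i ψ) F φ = ∑ i ∈ s, liePoisson L (y i) F φ := by
  rw [liePoisson_skew, liePoisson_sum_right hy, ← Finset.sum_neg_distrib]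
  exact Finset.sum_congr rfl fun i _ => (liePoisson_skew _ _ _).symm

/-- The function `ℓ_ξ + q^* f`. -/
def gen (E : SmoothVB I N) (z : E.Sec × C^∞⟮I, N; ℝ⟯) : C^∞⟮E.dual.model, E.dual.Tot; ℝ⟯ :=
  E.ell z.1 + E.dual.pull z.2

variable (L) in
/-- The bracket of generators, as a generator. -/
def genBr (z w : E.Sec × C^∞⟮I, N; ℝ⟯) : E.Sec × C^∞⟮I, N; ℝ⟯ :=
  (L.bracket z.1 w.1, L.act z.1 w.2 - L.act w.1 z.2)

theorem liePoisson_gen (z w : E.Sec × C^∞⟮I, N; ℝ⟯) (φ : E.dual.Tot) :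
    liePoisson L (gen E z) (gen E w) φ = gen E (L.genBr z w) φ := by
  rw [liePoisson_eq_bivector]
  refine (L.bivector_diffGen φ z w).trans ?_
  rw [genBracket_apply]
  exact add_sub_assoc _ _ _

theorem act_sub_right (a : E.Sec) (f g : C^∞⟮I, N; ℝ⟯) (x : N) :
    L.act a (f - g) x = L.act a f x - L.act a g x :=
  map_sub (AddMonoidHom.mk' (fun f => L.act a f x) fun f g => L.act_add_right a f g x) f g

/-- The linear parts cancel by the Jacobi identity of E, the basic parts because the anchor
preserves brackets. -/
theorem gen_jacobi (z w u : E.Sec × C^∞⟮I, N; ℝ⟯) (φ : E.dual.Tot) :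
    gen E (L.genBr z (L.genBr w u)) φ + gen E (L.genBr w (L.genBr u z)) φ +
      gen E (L.genBr u (L.genBr z w)) φ = 0 := by
  have h : ∀ z w u : E.Sec × C^∞⟮I, N; ℝ⟯, gen E (L.genBr z (L.genBr w u)) φ =
      E.ell (L.bracket z.1 (L.bracket w.1 u.1)) φ + (L.act z.1 (L.act w.1 u.2) φ.1 -
        L.act z.1 (L.act u.1 w.2) φ.1 - (L.act w.1 (L.act u.1 z.2) φ.1 -
          L.act u.1 (L.act w.1 z.2) φ.1)) := fun z w u => by
    rw [← act_bracket, ← act_sub_right]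
    rfl
  rw [h, h, h]
  have hj : L.bracket z.1 (L.bracket w.1 u.1) + L.bracket w.1 (L.bracket u.1 z.1) +
      L.bracket u.1 (L.bracket z.1 w.1) = 0 := by
    rw [L.jacobi z.1 w.1 u.1, L.bracket_skew u.1 z.1, L.bracket_skew u.1 (L.bracket z.1 w.1),
      map_neg]
    abel
  have hj' := congrArg (fun s => E.ell s φ) hj
  simp only at hj'
  rw [E.ell_add, E.ell_add, E.ell_zero] at hj'
  linarith

theorem contMDiff_liePoisson {F G : E.dual.Tot → ℝ} (hF : ContMDiff E.dual.model 𝓘(ℝ, ℝ) ∞ F)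
    (hG : ContMDiff E.dual.model 𝓘(ℝ, ℝ) ∞ G) :
    ContMDiff E.dual.model 𝓘(ℝ, ℝ) ∞ (liePoisson L F G) := fun φ => by
  obtain ⟨ι, hι, ξ, f, h⟩ := E.exists_dual_coordinates φ
  -- Near φ both differentials are combinations of differentials of generators with smooth
  -- coefficients, and the bracket of two generators is a generator, hence smooth.
  obtain ⟨c, hc, hcF, -⟩ := h.expand F hF
  obtain ⟨d, hd, hdG, -⟩ := h.expand G hG
  have hs : ContMDiffAt E.dual.model 𝓘(ℝ, ℝ) ∞
      (fun ψ => ∑ k, c k ψ * ∑ l, d l ψ * gen E (L.genBr (ξ k, f k) (ξ l, f l)) ψ) φ :=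
    ContMDiffAt.sum fun k _ => (hc k).mul (ContMDiffAt.sum fun l _ =>
      (hd l).mul (gen E _).contMDiff.contMDiffAt)
  refine hs.congr_of_eventuallyEq ?_
  filter_upwards [hcF, hdG] with ψ h₁ h₂
  rw [liePoisson_of_diffAt_left_eq_sum h₁]
  refine Finset.sum_congr rfl fun k _ => ?_
  rw [liePoisson_of_diffAt_right_eq_sum h₂]
  congr 1
  refine Finset.sum_congr rfl fun l _ => ?_
  rw [← liePoisson_gen]
  rfl

variable (L) in
/-- The Jacobiator of three functions. -/
def jacobiator (F G H : E.dual.Tot → ℝ) (φ : E.dual.Tot) : ℝ :=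
  liePoisson L F (liePoisson L G H) φ + liePoisson L G (liePoisson L H F) φ +
    liePoisson L H (liePoisson L F G) φ

theorem jacobiator_cycle (F G H : E.dual.Tot → ℝ) (φ : E.dual.Tot) :
    jacobiator L F G H φ = jacobiator L G H F φ := by
  rw [jacobiator, jacobiator]
  ring

theorem liePoisson_swap_right {F G H : E.dual.Tot → ℝ}
    (hF : ContMDiff E.dual.model 𝓘(ℝ, ℝ) ∞ F) (hH : ContMDiff E.dual.model 𝓘(ℝ, ℝ) ∞ H)
    (φ : E.dual.Tot) :
    liePoisson L G (liePoisson L H F) φ = -liePoisson L G (liePoisson L F H) φ := by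
  have h1 : liePoisson L H F = fun ψ => (-1 : ℝ) * liePoisson L F H ψ := by
    funext ψ
    rw [liePoisson_skew]
    ring
  have h2 := diffAt_const_smul (-1) (contMDiff_liePoisson (L := L) hF hH φ)
  rw [liePoisson_eq_bivector, liePoisson_eq_bivector, ← neg_one_mul, ← smul_eq_mul, ← map_smul,
    ← h2, h1]

/-- The Jacobiator depends on H through dH only. With dH = Σ c_k dy_k near φ and dc_k = Σ d_kl dy_l
at φ, it equals Σ c_k times the Jacobiators of the generators y_k, plus terms in d_kl that cancel by
symmetry. -/
theorem jacobiator_eq_zero_of_gen {F G H : E.dual.Tot → ℝ}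
    (hF : ContMDiff E.dual.model 𝓘(ℝ, ℝ) ∞ F)
    (hG : ContMDiff E.dual.model 𝓘(ℝ, ℝ) ∞ G) (hH : ContMDiff E.dual.model 𝓘(ℝ, ℝ) ∞ H)
    (φ : E.dual.Tot) (h : ∀ z, jacobiator L F G (gen E z) φ = 0) : jacobiator L F G H φ = 0 := by
  obtain ⟨ι, hι, ξ, f, hy⟩ := E.exists_dual_coordinates φ
  obtain ⟨c, hc, hcH, d, hd, hcd⟩ := hy.expand H hH
  set y : ι → E.dual.Tot → ℝ := fun k => gen E (ξ k, f k) with hydef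
  have hys : ∀ k, ContMDiff E.dual.model 𝓘(ℝ, ℝ) ∞ (y k) := fun k => (gen E _).contMDiff
  have expand : ∀ {K : E.dual.Tot → ℝ}, liePoisson L K H =ᶠ[nhds φ]
      fun ψ => ∑ k, c k ψ * liePoisson L K (y k) ψ := fun {K} => by
    filter_upwards [hcH] with ψ hψ
    exact liePoisson_of_diffAt_right_eq_sum hψ
  have expand2 : ∀ {K K' : E.dual.Tot → ℝ}, ContMDiff E.dual.model 𝓘(ℝ, ℝ) ∞ K' →
      liePoisson L K (liePoisson L K' H) φ =
        ∑ k, (c k φ * liePoisson L K (liePoisson L K' (y k)) φ +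
          (∑ l, d k l * liePoisson L K (y l) φ) * liePoisson L K' (y k) φ) := fun {K K'} hK' => by
    rw [liePoisson_congr (Filter.EventuallyEq.refl _ K) expand]
    refine (liePoisson_sum_right
      fun k _ => (hc k).mul (contMDiff_liePoisson hK' (hys k)).contMDiffAt).trans ?_
    refine Finset.sum_congr rfl fun k _ => ?_
    refine (liePoisson_mul_right (hc k) (contMDiff_liePoisson hK' (hys k)).contMDiffAt).trans ?_
    rw [liePoisson_of_diffAt_right_eq_sum (y := y) (hcd k)]
    ring
  have e1 : liePoisson L G (liePoisson L H F) φ = -liePoisson L G (liePoisson L F H) φ :=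
    liePoisson_swap_right hF hH φ
  have e2 : liePoisson L H (liePoisson L F G) φ = - ∑ k, c k φ * liePoisson L (liePoisson L F G) (y k) φ := by
    rw [liePoisson_skew, expand.self_of_nhds]
  have hk : ∀ k, liePoisson L F (liePoisson L G (y k)) φ - liePoisson L G (liePoisson L F (y k)) φ
      - liePoisson L (liePoisson L F G) (y k) φ = 0 := fun k => by
    have h1 := h (ξ k, f k)
    rw [jacobiator, liePoisson_swap_right hF (gen E _).contMDiff, liePoisson_skew (gen E _ : E.dual.Tot → ℝ)] at h1
    linarith
  -- The only place where the symmetry of the second derivatives enters.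
  have hsym : ∑ k, (∑ l, d k l * liePoisson L F (y l) φ) * liePoisson L G (y k) φ =
      ∑ k, (∑ l, d k l * liePoisson L G (y l) φ) * liePoisson L F (y k) φ := by
    simp only [Finset.sum_mul]
    rw [Finset.sum_comm]
    refine Finset.sum_congr rfl fun k _ => Finset.sum_congr rfl fun l _ => ?_
    rw [hd k l]
    ring
  rw [jacobiator, e1, e2, expand2 hG, expand2 hF, Finset.sum_add_distrib, Finset.sum_add_distrib,
    hsym]
  have h0 : ∑ k, c k φ * (liePoisson L F (liePoisson L G (y k)) φ -
      liePoisson L G (liePoisson L F (y k)) φ - liePoisson L (liePoisson L F G) (y k) φ) = 0 :=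
    Finset.sum_eq_zero fun k _ => by rw [hk, mul_zero]
  simp only [mul_sub, Finset.sum_sub_distrib] at h0
  linarith

/-- By cyclic symmetry the arguments can be replaced by generators one at a time. -/
theorem jacobiator_eq_zero {F G H : E.dual.Tot → ℝ}
    (hF : ContMDiff E.dual.model 𝓘(ℝ, ℝ) ∞ F)
    (hG : ContMDiff E.dual.model 𝓘(ℝ, ℝ) ∞ G) (hH : ContMDiff E.dual.model 𝓘(ℝ, ℝ) ∞ H)
    (φ : E.dual.Tot) : jacobiator L F G H φ = 0 := by
  refine jacobiator_eq_zero_of_gen hF hG hH φ fun u => ?_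
  rw [← jacobiator_cycle]
  refine jacobiator_eq_zero_of_gen (gen E u).contMDiff hF hG φ fun w => ?_
  rw [← jacobiator_cycle]
  refine jacobiator_eq_zero_of_gen (gen E w).contMDiff (gen E u).contMDiff hF φ fun z => ?_
  have h : ∀ z w : E.Sec × C^∞⟮I, N; ℝ⟯, liePoisson L (gen E z) (gen E w) = gen E (L.genBr z w) :=
    fun z w => funext (liePoisson_gen z w)
  simp only [jacobiator, h]
  exact gen_jacobi _ _ _ φ

theorem liePoisson_jacobi {F G H : E.dual.Tot → ℝ}
    (hF : ContMDiff E.dual.model 𝓘(ℝ, ℝ) ∞ F)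
    (hG : ContMDiff E.dual.model 𝓘(ℝ, ℝ) ∞ G) (hH : ContMDiff E.dual.model 𝓘(ℝ, ℝ) ∞ H)
    (φ : E.dual.Tot) :
    liePoisson L (liePoisson L F G) H φ =
      liePoisson L F (liePoisson L G H) φ - liePoisson L G (liePoisson L F H) φ := by
  have h := jacobiator_eq_zero (L := L) hF hG hH φ
  rw [jacobiator, liePoisson_swap_right hF hH, liePoisson_skew H] at h
  linarith

end LieAlgebroid

/-! ### Smooth families of injective linear maps -/

section Injective

variable {EX HX : Type*} [NormedAddCommGroup EX] [NormedSpace ℝ EX] [TopologicalSpace HX]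
  {J : ModelWithCorners ℝ EX HX} {X : Type*} [TopologicalSpace X] [ChartedSpace HX X]

/-- For a left inverse R of T(x₀), the endomorphism R T(x) is the identity at x₀ and so invertible
nearby; there κ = (R T)⁻¹ R (T κ), and inversion is smooth. -/
theorem contMDiffAt_of_injective_clm {F W : Type*} [NormedAddCommGroup F] [NormedSpace ℝ F]
    [FiniteDimensional ℝ F] [NormedAddCommGroup W] [NormedSpace ℝ W] [FiniteDimensional ℝ W]
    {T : X → F →L[ℝ] W} {κ : X → F} {x₀ : X}
    (hT : ContMDiffAt J 𝓘(ℝ, F →L[ℝ] W) ∞ T x₀) (hinj : Function.Injective (T x₀))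
    (h : ContMDiffAt J 𝓘(ℝ, W) ∞ (fun x => T x (κ x)) x₀) :
    ContMDiffAt J 𝓘(ℝ, F) ∞ κ x₀ := by
  have : CompleteSpace F := FiniteDimensional.complete ℝ F
  obtain ⟨R, hR⟩ := (T x₀ : F →ₗ[ℝ] W).exists_leftInverse_of_injective
    (LinearMap.ker_eq_bot.2 hinj)
  set R' : W →L[ℝ] F := R.toContinuousLinearMap
  have hG : ContMDiffAt J 𝓘(ℝ, F →L[ℝ] F) ∞ (fun x => R'.comp (T x)) x₀ :=
    (contMDiffAt_const (c := R')).clm_comp hT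
  have h0 : R'.comp (T x₀) = ((1 : (F →L[ℝ] F)ˣ) : F →L[ℝ] F) := by
    ext v
    exact LinearMap.congr_fun hR v
  have hinv : ContMDiffAt J 𝓘(ℝ, F →L[ℝ] F) ∞ (fun x => Ring.inverse (R'.comp (T x))) x₀ := by
    have h1 := contDiffAt_ringInverse (n := ∞) ℝ (1 : (F →L[ℝ] F)ˣ)
    rw [← h0] at h1
    exact h1.contMDiffAt.comp x₀ hG
  have h2 := hinv.clm_apply ((contMDiffAt_const (c := R')).clm_apply h)
  refine h2.congr_of_eventuallyEq ?_
  have h3 : ∀ᶠ x in nhds x₀, IsUnit (R'.comp (T x)) :=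
    hG.continuousAt.eventually (Units.isOpen.mem_nhds (by
      change IsUnit (R'.comp (T x₀))
      rw [h0]
      exact Units.isUnit 1))
  filter_upwards [h3] with x hx
  exact (congrArg (fun f : F →L[ℝ] F => f (κ x)) (Ring.inverse_mul_cancel _ hx)).symm

variable {EN HN : Type*} [NormedAddCommGroup EN] [NormedSpace ℝ EN] [FiniteDimensional ℝ EN]
  [TopologicalSpace HN] {I : ModelWithCorners ℝ EN HN} {N : Type*} [TopologicalSpace N]
  [ChartedSpace HN N] [IsManifold I ∞ N] [T2Space N]
  {EN' HN' : Type*} [NormedAddCommGroup EN'] [NormedSpace ℝ EN']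
  [TopologicalSpace HN'] {I' : ModelWithCorners ℝ EN' HN'} {N' : Type*} [TopologicalSpace N']
  [ChartedSpace HN' N']

theorem SmoothVB.exists_local_basis (E : SmoothVB I N) (x₀ : N) :
    ∃ (n : ℕ) (b : Module.Basis (Fin n) ℝ E.F) (e : Fin n → E.Sec), ∀ᶠ x in nhds x₀,
      x ∈ (trivializationAt E.F E.V x₀).baseSet ∧
      ∀ i, (trivializationAt E.F E.V x₀ ⟨x, e i x⟩).2 = b i := by
  set T := trivializationAt E.F E.V x₀ with hT
  have hU : T.baseSet ∈ nhds x₀ :=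
    T.open_baseSet.mem_nhds (FiberBundle.mem_baseSet_trivializationAt' x₀)
  obtain ⟨χ, hχ, hs⟩ := exists_bump I x₀ hU
  let b := Module.finBasis ℝ E.F
  have h₁ : ∀ i, ∃ s : E.Sec, ∀ x, s x = χ x • T.localFrame b i x := fun i =>
    E.exists_section_extension hs fun x hx => contMDiffAt_localFrame_of_mem ∞ T b i hx
  choose e he using h₁
  refine ⟨_, b, e, ?_⟩
  filter_upwards [hχ, hU] with x hx hxU
  refine ⟨hxU, fun i => ?_⟩
  rw [he, hx, one_smul, T.localFrame_apply_of_mem_baseSet b hxU]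
  simp [Bundle.Trivialization.basisAt, hxU]

/-- If `g` is a smooth family of injective linear maps between the fibres of vector bundles and
`g ∘ c` is smooth, then so is `c`. -/
theorem SmoothVB.contMDiffAt_of_injective (E : SmoothVB I N) (E' : SmoothVB I' N') {p : X → N}
    {p' : X → N'} (g : ∀ x, E.V (p x) →ₗ[ℝ] E'.V (p' x)) {c : ∀ x, E.V (p x)} {x₀ : X}
    (hinj : Function.Injective (g x₀)) (hp : ContMDiffAt J I ∞ p x₀)
    (hg : ∀ e : E.Sec, ContMDiffAt J E'.model ∞ (fun x => (⟨p' x, g x (e (p x))⟩ : E'.Tot)) x₀)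
    (h : ContMDiffAt J E'.model ∞ (fun x => (⟨p' x, g x (c x)⟩ : E'.Tot)) x₀) :
    ContMDiffAt J E.model ∞ (fun x => (⟨p x, c x⟩ : E.Tot)) x₀ := by
  obtain ⟨n, b, e, he⟩ := E.exists_local_basis (p x₀)
  set T := trivializationAt E.F E.V (p x₀) with hT
  set T' := trivializationAt E'.F E'.V (p' x₀) with hT'
  have hp' := (E'.contMDiffAt_iff_trivializationAt.1 h).1
  set G : X → E.F →L[ℝ] E'.F := fun x => ∑ i, (b.coord i).toContinuousLinearMap.smulRight
    (T' ⟨p' x, g x (e i (p x))⟩).2 with hG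
  have hGs : ContMDiffAt J 𝓘(ℝ, E.F →L[ℝ] E'.F) ∞ G x₀ := by
    refine ContMDiffAt.sum fun i _ => ?_
    exact (ContinuousLinearMap.contMDiff
      (ContinuousLinearMap.smulRightL ℝ E.F E'.F (b.coord i).toContinuousLinearMap)).contMDiffAt.comp
        x₀ (E'.contMDiffAt_iff_trivializationAt.1 (hg (e i))).2
  have hGv : ∀ x v, p' x ∈ T'.baseSet →
      G x v = (T' ⟨p' x, g x (∑ i, b.repr v i • e i (p x))⟩).2 := fun x v hx => by
    have hl : ∀ w, (T' ⟨p' x, w⟩).2 = T'.continuousLinearEquivAt ℝ (p' x) hx w := fun w => rfl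
    rw [hl, map_sum, map_sum, hG, sum_apply]
    refine Finset.sum_congr rfl fun i _ => ?_
    rw [map_smul, map_smul, ← hl]
    rfl
  have hTe : ∀ x v, (p x ∈ T.baseSet ∧ ∀ i, (T ⟨p x, e i (p x)⟩).2 = b i) →
      (T ⟨p x, ∑ i, b.repr v i • e i (p x)⟩).2 = v := fun x v hx => by
    have hl : ∀ w, (T ⟨p x, w⟩).2 = T.continuousLinearEquivAt ℝ (p x) hx.1 w := fun w => rfl
    rw [hl, map_sum]
    refine Eq.trans (Finset.sum_congr rfl fun i _ => ?_) (b.sum_repr v)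
    rw [map_smul, ← hl, hx.2]
  have he' := hp.continuousAt.eventually he
  have hb' := E'.eventually_mem_baseSet hp'
  refine E.contMDiffAt_iff_trivializationAt.2 ⟨hp, contMDiffAt_of_injective_clm hGs ?_ ?_⟩
  · refine (injective_iff_map_eq_zero _).2 fun v hv => ?_
    rw [hGv x₀ v hb'.self_of_nhds] at hv
    have h1 : ∑ i, b.repr v i • e i (p x₀) = 0 := by
      apply hinj
      rw [map_zero]
      exact (T'.continuousLinearEquivAt ℝ (p' x₀) hb'.self_of_nhds).map_eq_zero_iff.1 hv
    rw [← hTe x₀ v he'.self_of_nhds, h1]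
    exact (T.continuousLinearEquivAt ℝ (p x₀) he'.self_of_nhds.1).map_zero
  · refine (E'.contMDiffAt_iff_trivializationAt.1 h).2.congr_of_eventuallyEq ?_
    filter_upwards [he', hb'] with x hx hx'
    rw [hGv x _ hx']
    congr 4
    exact (T.continuousLinearEquivAt ℝ (p x) hx.1).injective (hTe x _ hx)

end Injective

/-! ### Fibre products and fibrewise addition -/

section Prod

variable {EN HN : Type*} [NormedAddCommGroup EN] [NormedSpace ℝ EN]
  [TopologicalSpace HN] {I : ModelWithCorners ℝ EN HN} {N : Type*} [TopologicalSpace N]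
  [ChartedSpace HN N]
  {EX HX : Type*} [NormedAddCommGroup EX] [NormedSpace ℝ EX] [TopologicalSpace HX]
  {J : ModelWithCorners ℝ EX HX} {X : Type*} [TopologicalSpace X] [ChartedSpace HX X]

theorem SmoothVB.contMDiff_prod_mk (A B : SmoothVB I N) {p : X → N} {a : ∀ x, A.V (p x)}
    {b : ∀ x, B.V (p x)} (ha : ContMDiff J A.model ∞ (fun x => (⟨p x, a x⟩ : A.Tot)))
    (hb : ContMDiff J B.model ∞ (fun x => (⟨p x, b x⟩ : B.Tot))) :
    ContMDiff J (I.prod 𝓘(ℝ, A.F × B.F)) ∞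
      (fun x => (⟨p x, (a x, b x)⟩ : TotalSpace (A.F × B.F) (A.V ×ᵇ B.V))) := fun x₀ => by
  rw [Bundle.contMDiffAt_totalSpace]
  have h1 := A.contMDiffAt_iff_trivializationAt.1 (ha x₀)
  have h2 := B.contMDiffAt_iff_trivializationAt.1 (hb x₀)
  exact ⟨h1.1, h1.2.prodMk_space h2.2⟩

end Prod

namespace SmoothVB

variable {EN HN : Type*} [NormedAddCommGroup EN] [NormedSpace ℝ EN] [TopologicalSpace HN]
  {I : ModelWithCorners ℝ EN HN} {N : Type*} [TopologicalSpace N] [ChartedSpace HN N]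
  {E : SmoothVB I N}

theorem isAdd_mk (x : N) (v w : E.V x) : E.IsAdd ⟨x, v⟩ ⟨x, w⟩ ⟨x, v + w⟩ := ⟨x, v, w, rfl, rfl, rfl⟩

theorem isAdd_mk_iff {x : N} {v w u : E.V x} :
    E.IsAdd ⟨x, v⟩ ⟨x, w⟩ ⟨x, u⟩ ↔ u = v + w := by
  refine ⟨?_, by rintro rfl; exact isAdd_mk x v w⟩
  rintro ⟨y, v', w', h₁, h₂, h₃⟩
  obtain rfl : x = y := congrArg (·.1) h₁
  obtain rfl := TotalSpace.mk_injective x h₁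
  obtain rfl := TotalSpace.mk_injective x h₂
  exact TotalSpace.mk_injective x h₃

theorem mk_inj {x : N} {v w : E.V x} : (⟨x, v⟩ : E.Tot) = ⟨x, w⟩ ↔ v = w :=
  ⟨fun h => TotalSpace.mk_injective x h, fun h => h ▸ rfl⟩

theorem exists_eq_mk {x : N} {v : E.Tot} (h : v.1 = x) : ∃ w : E.V x, v = ⟨x, w⟩ := by
  subst h
  exact ⟨v.2, rfl⟩

namespace IsAdd

variable {u v w u' : E.Tot}

theorem left_proj (h : E.IsAdd v w u) : v.1 = u.1 := by
  obtain ⟨x, a, b, rfl, rfl, rfl⟩ := h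
  rfl

theorem right_proj (h : E.IsAdd v w u) : w.1 = u.1 := by
  obtain ⟨x, a, b, rfl, rfl, rfl⟩ := h
  rfl

theorem unique (h : E.IsAdd v w u) (h' : E.IsAdd v w u') : u = u' := by
  obtain ⟨x, a, b, rfl, rfl, rfl⟩ := h
  obtain ⟨z, rfl⟩ := exists_eq_mk h'.left_proj.symm
  rw [isAdd_mk_iff.1 h']

theorem right_unique {w' : E.Tot} (h : E.IsAdd v w u) (h' : E.IsAdd v w' u) : w = w' := by
  obtain ⟨x, a, b, rfl, rfl, rfl⟩ := h
  obtain ⟨z, rfl⟩ := exists_eq_mk h'.right_proj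
  rw [add_left_cancel (isAdd_mk_iff.1 h')]

end IsAdd

theorem exists_isAdd {v w : E.Tot} (h : v.1 = w.1) : ∃ u, E.IsAdd v w u := by
  obtain ⟨z, rfl⟩ := exists_eq_mk h
  exact ⟨_, isAdd_mk _ _ _⟩

theorem exists_isAdd_right {v u : E.Tot} (h : v.1 = u.1) : ∃ w, E.IsAdd v w u := by
  obtain ⟨z, rfl⟩ := exists_eq_mk h
  exact ⟨⟨u.1, u.2 - z⟩, isAdd_mk_iff.2 (by abel)⟩

theorem isAdd_zeroT_left (v : E.Tot) : E.IsAdd (E.zeroT v.1) v v :=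
  isAdd_mk_iff.2 (zero_add _).symm

theorem isAdd_zeroT_right (v : E.Tot) : E.IsAdd v (E.zeroT v.1) v :=
  isAdd_mk_iff.2 (add_zero _).symm

theorem smulT_zero (v : E.Tot) : E.smulT 0 v = E.zeroT v.1 := by
  simp [smulT, zeroT]

theorem smulT_zeroT (r : ℝ) (x : N) : E.smulT r (E.zeroT x) = E.zeroT x :=
  congrArg (TotalSpace.mk x) (smul_zero (A := E.V x) r)

theorem contMDiff_prod_fst (A B : SmoothVB I N) :
    ContMDiff (I.prod 𝓘(ℝ, A.F × B.F)) A.model ∞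
      (fun p : TotalSpace (A.F × B.F) (A.V ×ᵇ B.V) => (⟨p.1, p.2.1⟩ : A.Tot)) := fun p₀ => by
  have h := (Bundle.contMDiffAt_totalSpace (F := A.F × B.F) (E := (A.V ×ᵇ B.V))).1
    (contMDiffAt_id (I := I.prod 𝓘(ℝ, A.F × B.F)) (n := ∞) (x := p₀))
  exact A.contMDiffAt_iff_trivializationAt.2 ⟨h.1,
    (ContinuousLinearMap.fst ℝ A.F B.F).contMDiff.contMDiffAt.comp p₀ h.2⟩

theorem contMDiff_prod_snd (A B : SmoothVB I N) :
    ContMDiff (I.prod 𝓘(ℝ, A.F × B.F)) B.model ∞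
      (fun p : TotalSpace (A.F × B.F) (A.V ×ᵇ B.V) => (⟨p.1, p.2.2⟩ : B.Tot)) := fun p₀ => by
  have h := (Bundle.contMDiffAt_totalSpace (F := A.F × B.F) (E := (A.V ×ᵇ B.V))).1
    (contMDiffAt_id (I := I.prod 𝓘(ℝ, A.F × B.F)) (n := ∞) (x := p₀))
  exact B.contMDiffAt_iff_trivializationAt.2 ⟨h.1,
    (ContinuousLinearMap.snd ℝ A.F B.F).contMDiff.contMDiffAt.comp p₀ h.2⟩

end SmoothVB

/-! ### Decomposition of a double vector bundle by a linear splitting -/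

section Geometry

open SmoothVB

variable {EM HM : Type*} [NormedAddCommGroup EM] [NormedSpace ℝ EM] [TopologicalSpace HM]
  {I : ModelWithCorners ℝ EM HM} {M : Type*} [TopologicalSpace M] [ChartedSpace HM M]
  {A B C : SmoothVB I M} {DA : SmoothVB A.model A.Tot} {DB : SmoothVB B.model B.Tot}

namespace DoubleVB

variable (D : DoubleVB A B C DA DB)

theorem flip_flip : D.flip.flip = D := by
  cases D
  simp [flip]

theorem e_zeroT_proj (a : A.Tot) : (D.e (DA.zeroT a)).proj = B.zeroT a.1 := by
  rw [← smulT_zeroT 0 a, D.prB_smul, smulT_zero, D.proj_comm]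
  rfl

theorem core_zero (m : M) : D.core (C.zeroT m) = DA.zeroT (A.zeroT m) := by
  rw [← smulT_zeroT 0 m, D.core_smulA, smulT_zero, D.core_prA]
  rfl

theorem e_core_zero (m : M) : D.e (D.core (C.zeroT m)) = DB.zeroT (B.zeroT m) :=
  D.flip.core_zero m

theorem exists_ker (a : A.Tot) (c : C.V a.1) :
    ∃ x : DA.V a, DB.IsAdd (D.e (DA.zeroT a)) (D.e (D.core ⟨a.1, c⟩)) (D.e ⟨a, x⟩) := by
  obtain ⟨u, hu⟩ := exists_isAdd (E := DB) (v := D.e (DA.zeroT a)) (w := D.e (D.core ⟨a.1, c⟩))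
    (by rw [D.e_zeroT_proj, D.core_prB])
  obtain ⟨k, rfl⟩ := D.e.surjective u
  have h := D.prA_add _ _ _ hu
  rw [D.core_prA] at h
  obtain ⟨x, rfl⟩ := exists_eq_mk (h.unique (isAdd_zeroT_right a))
  exact ⟨x, hu⟩

/-- The vector `0_a +_B c`. -/
def kerFun (a : A.Tot) (c : C.V a.1) : DA.V a := Classical.choose (D.exists_ker a c)

theorem isAdd_kerFun (a : A.Tot) (c : C.V a.1) :
    DB.IsAdd (D.e (DA.zeroT a)) (D.e (D.core ⟨a.1, c⟩)) (D.e ⟨a, D.kerFun a c⟩) :=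
  Classical.choose_spec (D.exists_ker a c)

theorem e_kerFun_proj (a : A.Tot) (c : C.V a.1) :
    (D.e ⟨a, D.kerFun a c⟩).proj = B.zeroT a.1 := by
  rw [← (D.isAdd_kerFun a c).left_proj, D.e_zeroT_proj]

/-- The linear map `c ↦ 0_a +_B c` from the core to the fibre of `D → A`. -/
def ker (a : A.Tot) : C.V a.1 →ₗ[ℝ] DA.V a where
  toFun := D.kerFun a
  map_add' c c' := by
    -- The map is defined by addition over B, while linearity is meant over A. The interchange law
    -- for 0_a +_A 0_a = 0_a and c +_A c' = c + c' relates the two.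
    obtain ⟨w, hw, hw'⟩ := D.interchange (DA.zeroT a) (DA.zeroT a) (D.core ⟨a.1, c⟩)
      (D.core ⟨a.1, c'⟩) (DA.zeroT a) (D.core ⟨a.1, c + c'⟩) _ _ (isAdd_zeroT_left (DA.zeroT a))
      (D.core_addA _ _ _ (isAdd_mk _ _ _)) (D.isAdd_kerFun a c) (D.isAdd_kerFun a c')
    have h := D.e.injective (hw.unique (D.isAdd_kerFun a (c + c')))
    rw [h] at hw'
    exact isAdd_mk_iff.1 hw'
  map_smul' r c := by
    have h := D.smulA_add r _ _ _ (D.isAdd_kerFun a c)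
    rw [smulT_zeroT, ← D.core_smulA] at h
    exact mk_inj.1 (D.e.injective ((D.isAdd_kerFun a (r • c)).unique h))

theorem isAdd_ker (a : A.Tot) (c : C.V a.1) :
    DB.IsAdd (D.e (DA.zeroT a)) (D.e (D.core ⟨a.1, c⟩)) (D.e ⟨a, D.ker a c⟩) :=
  D.isAdd_kerFun a c

theorem ker_injective (a : A.Tot) : Function.Injective (D.ker a) := by
  refine (injective_iff_map_eq_zero _).2 fun c hc => ?_
  have h := D.isAdd_ker a c
  rw [hc] at h
  have h1 := h.right_unique (isAdd_zeroT_right (D.e (DA.zeroT a)))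
  rw [D.e_zeroT_proj, ← D.e_core_zero] at h1
  exact mk_inj.1 (D.core_injective (D.e.injective h1))

/-- Subtracting 0_a over B gives an element that projects to zero in both A and B, hence an element
of the core. -/
theorem exists_ker_eq (a : A.Tot) (x : DA.V a) (hx : (D.e ⟨a, x⟩).proj = B.zeroT a.1) :
    ∃ c, D.ker a c = x := by
  obtain ⟨w, hw⟩ := exists_isAdd_right (E := DB) (v := D.e (DA.zeroT a)) (u := D.e ⟨a, x⟩)
    (by rw [D.e_zeroT_proj, hx])
  obtain ⟨w, rfl⟩ := D.e.surjective w
  obtain ⟨c, rfl⟩ := D.core_surj w a.1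
    ((D.prA_add _ _ _ hw).right_unique (isAdd_zeroT_right a)) (by rw [hw.right_proj, hx])
  have h1 : c.1 = a.1 := by
    have := congrArg (·.1) (hw.right_proj)
    rw [hx] at this
    rw [D.core_prB] at this
    exact this
  obtain ⟨c, rfl⟩ := exists_eq_mk h1
  exact ⟨c, mk_inj.1 (D.e.injective ((D.isAdd_ker a c).unique hw))⟩

theorem contMDiff_ker {EX HX : Type*} [NormedAddCommGroup EX] [NormedSpace ℝ EX]
    [TopologicalSpace HX] {J : ModelWithCorners ℝ EX HX} {X : Type*} [TopologicalSpace X]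
    [ChartedSpace HX X] {a : X → A.Tot} {c : ∀ x, C.V (a x).1} (ha : ContMDiff J A.model ∞ a)
    (hc : ContMDiff J C.model ∞ (fun x => (⟨(a x).1, c x⟩ : C.Tot))) :
    ContMDiff J DA.model ∞ (fun x => (⟨a x, D.ker (a x) (c x)⟩ : DA.Tot)) := by
  have h := DB.contMDiff_isAdd (w := fun x => D.e ⟨a x, D.ker (a x) (c x)⟩)
    ((D.e_smooth.comp DA.contMDiff_zeroT).comp ha)
    ((D.e_smooth.comp D.core_smooth).comp hc) fun x => D.isAdd_ker _ _
  have h' := D.e_symm_smooth.comp h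
  refine h'.congr fun x => ?_
  simp

end DoubleVB

namespace LinearSplitting

variable {D : DoubleVB A B C DA DB} (S : LinearSplitting D)

/-- The same splitting for the flipped double vector bundle. -/
def flip : LinearSplitting D.flip where
  toFun m b a := D.e (S.toFun m a b)
  smooth := D.e_smooth.comp (S.smooth.comp
    (contMDiff_prod_mk A B (contMDiff_prod_snd B A) (contMDiff_prod_fst B A)))
  prA m a b := S.prB m b a
  prB m a b := (congrArg (·.proj) (D.e.symm_apply_apply _)).trans (S.prA m b a)
  addA m b a₁ a₂ := S.addB m a₁ a₂ b
  addB m b₁ b₂ a := by simpa [DoubleVB.flip] using S.addA m a b₁ b₂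
  smulA r m b a := S.smulB r m a b
  smulB r m b a := by simpa [DoubleVB.flip] using S.smulA r m a b

theorem exists_mk (a : A.Tot) (b : B.V a.1) : ∃ x : DA.V a, S.toFun a.1 a.2 b = ⟨a, x⟩ :=
  exists_eq_mk (S.prA _ _ _)

/-- The vector `Σ(a, b)` as an element of the fibre of `D → A`. -/
def liftFun (a : A.Tot) (b : B.V a.1) : DA.V a := Classical.choose (S.exists_mk a b)

theorem toFun_eq (a : A.Tot) (b : B.V a.1) : S.toFun a.1 a.2 b = ⟨a, S.liftFun a b⟩ :=
  Classical.choose_spec (S.exists_mk a b)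

/-- The linear map `b ↦ Σ(a, b)`. -/
def lift (a : A.Tot) : B.V a.1 →ₗ[ℝ] DA.V a where
  toFun := S.liftFun a
  map_add' b b' := by
    have h := S.addA a.1 a.2 b b'
    rw [toFun_eq, toFun_eq, toFun_eq] at h
    exact isAdd_mk_iff.1 h
  map_smul' r b := by
    have h := S.smulA r a.1 a.2 b
    rw [toFun_eq, toFun_eq] at h
    exact mk_inj.1 h

theorem mk_lift (a : A.Tot) (b : B.V a.1) : (⟨a, S.lift a b⟩ : DA.Tot) = S.toFun a.1 a.2 b :=
  (S.toFun_eq a b).symm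

theorem e_lift_proj (a : A.Tot) (b : B.V a.1) : (D.e ⟨a, S.lift a b⟩).proj = ⟨a.1, b⟩ := by
  rw [mk_lift, S.prB]

/-- The linear map `(b, c) ↦ Σ(a, b) +_A (0_a +_B c)`. -/
def decompLin (a : A.Tot) : (B.V a.1 × C.V a.1) →ₗ[ℝ] DA.V a := (S.lift a).coprod (D.ker a)

theorem e_decompLin_proj (a : A.Tot) (b : B.V a.1) (c : C.V a.1) :
    (D.e ⟨a, S.decompLin a (b, c)⟩).proj = ⟨a.1, b⟩ := by
  have h := D.prB_add _ _ _ (isAdd_mk a (S.lift a b) (D.ker a c))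
  rw [S.e_lift_proj, show (D.e ⟨a, D.ker a c⟩).proj = B.zeroT a.1 from D.e_kerFun_proj a c] at h
  exact h.unique (isAdd_zeroT_right (⟨a.1, b⟩ : B.Tot))

/-- The core is the kernel of the projection of the fibre over a to B, and b ↦ Σ(a, b) splits this
projection. -/
theorem decompLin_bijective (a : A.Tot) : Function.Bijective (S.decompLin a) := by
  constructor
  · refine (injective_iff_map_eq_zero _).2 ?_
    rintro ⟨b, c⟩ h
    have h1 := S.e_decompLin_proj a b c
    rw [h] at h1
    have hb : b = 0 := (mk_inj.1 ((D.e_zeroT_proj a).symm.trans h1)).symm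
    subst hb
    have h2 : D.ker a c = 0 := by simpa [decompLin] using h
    rw [(injective_iff_map_eq_zero _).1 (D.ker_injective a) c h2]
    rfl
  · intro x
    have hp : (D.e ⟨a, x⟩).proj.proj = a.1 := D.proj_comm _
    obtain ⟨b, hb⟩ := exists_eq_mk hp
    have h := D.prB_add _ _ _ (isAdd_mk a (S.lift a b) (x - S.lift a b))
    rw [S.e_lift_proj, add_sub_cancel, hb] at h
    obtain ⟨c, hc⟩ := D.exists_ker_eq a (x - S.lift a b)
      (h.right_unique (isAdd_zeroT_right (⟨a.1, b⟩ : B.Tot)))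
    exact ⟨(b, c), by simp [decompLin, hc]⟩

/-- The decomposition of the fibre of `D → A` defined by a linear splitting. -/
def decomp (a : A.Tot) : (B.V a.1 × C.V a.1) ≃ₗ[ℝ] DA.V a :=
  LinearEquiv.ofBijective (S.decompLin a) (S.decompLin_bijective a)

theorem decomp_apply (a : A.Tot) (b : B.V a.1) (c : C.V a.1) :
    S.decomp a (b, c) = S.lift a b + D.ker a c := rfl

theorem e_decomp_proj (a : A.Tot) (b : B.V a.1) (c : C.V a.1) :
    (D.e ⟨a, S.decomp a (b, c)⟩).proj = ⟨a.1, b⟩ := S.e_decompLin_proj a b c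

/-- The interchange law gives Σ(a, b) +_A (0_a +_B c) = Σ(a, b) +_B (0_b +_A c). Hence both bundle
structures see the same triple (a, b, c), and the core terms of the pairing can cancel. -/
theorem e_decomp (m : M) (a : A.V m) (b : B.V m) (c : C.V m) :
    D.e ⟨⟨m, a⟩, S.decomp ⟨m, a⟩ (b, c)⟩ = ⟨⟨m, b⟩, S.flip.decomp ⟨m, b⟩ (a, c)⟩ := by
  have hS : D.e ⟨⟨m, a⟩, S.lift ⟨m, a⟩ b⟩ = ⟨⟨m, b⟩, S.flip.lift ⟨m, b⟩ a⟩ := by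
    rw [mk_lift, mk_lift]
    rfl
  have h3 : DB.IsAdd (D.e ⟨⟨m, a⟩, S.lift ⟨m, a⟩ b⟩) (D.e (D.e.symm (DB.zeroT ⟨m, b⟩)))
      (D.e ⟨⟨m, a⟩, S.lift ⟨m, a⟩ b⟩) := by
    rw [Equiv.apply_symm_apply, hS]
    exact isAdd_zeroT_right _
  obtain ⟨w, hw, hw'⟩ := D.interchange ⟨⟨m, a⟩, S.lift ⟨m, a⟩ b⟩ (DA.zeroT ⟨m, a⟩)
    (D.e.symm (DB.zeroT ⟨m, b⟩)) (D.core ⟨m, c⟩) _ (D.e.symm ⟨⟨m, b⟩, D.flip.ker ⟨m, b⟩ c⟩) _ _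
    (isAdd_zeroT_right _) (by
      have h := D.flip.isAdd_ker ⟨m, b⟩ c
      simpa [DoubleVB.flip] using h) h3 (D.isAdd_ker ⟨m, a⟩ c)
  rw [hS, Equiv.apply_symm_apply] at hw
  rw [S.decomp_apply, ← hw'.unique (isAdd_mk _ _ _), hw.unique (isAdd_mk _ _ _)]
  rfl

end LinearSplitting

end Geometry

/-! ### The dual bundles over C^* in components -/

section DualGeometry

open SmoothVB

variable {EM HM : Type*} [NormedAddCommGroup EM] [NormedSpace ℝ EM] [FiniteDimensional ℝ EM]
  [TopologicalSpace HM] {I : ModelWithCorners ℝ EM HM} {M : Type*} [TopologicalSpace M]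
  [ChartedSpace HM M] [IsManifold I ∞ M] [T2Space M]
  {A B C : SmoothVB I M} {DA : SmoothVB A.model A.Tot} {DB : SmoothVB B.model B.Tot}
  {D : DoubleVB A B C DA DB} (S : LinearSplitting D)
  {EX HX : Type*} [NormedAddCommGroup EX] [NormedSpace ℝ EX] [TopologicalSpace HX]
  {J : ModelWithCorners ℝ EX HX} {X : Type*} [TopologicalSpace X] [ChartedSpace HX X]

namespace LinearSplitting

section Smooth

variable {a : X → A.Tot}

theorem contMDiff_lift (ha : ContMDiff J A.model ∞ a) {b : ∀ x, B.V (a x).1}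
    (hb : ContMDiff J B.model ∞ (fun x => (⟨(a x).1, b x⟩ : B.Tot))) :
    ContMDiff J DA.model ∞ (fun x => (⟨a x, S.lift (a x) (b x)⟩ : DA.Tot)) := by
  have h := S.smooth.comp (contMDiff_prod_mk A B (p := fun x => (a x).1) (a := fun x => (a x).2)
    ha hb)
  exact h.congr fun x => S.mk_lift _ _

variable {z : ∀ x, DA.V (a x)}

theorem contMDiff_decomp_symm_fst
    (hz : ContMDiff J DA.model ∞ (fun x => (⟨a x, z x⟩ : DA.Tot))) :
    ContMDiff J B.model ∞ (fun x => (⟨(a x).1, ((S.decomp (a x)).symm (z x)).1⟩ : B.Tot)) := by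
  refine (DB.contMDiff_proj.comp (D.e_smooth.comp hz)).congr fun x => ?_
  have h := S.e_decomp_proj (a x) ((S.decomp (a x)).symm (z x)).1 ((S.decomp (a x)).symm (z x)).2
  rw [Prod.mk.eta, LinearEquiv.apply_symm_apply] at h
  exact h.symm

/-- The component in B is a projection of D, but the one in C is only known through its image under
the injective map `ker`, so its smoothness comes from `contMDiffAt_of_injective`. -/
theorem contMDiff_decomp_symm_snd (ha : ContMDiff J A.model ∞ a)
    (hz : ContMDiff J DA.model ∞ (fun x => (⟨a x, z x⟩ : DA.Tot))) :
    ContMDiff J C.model ∞ (fun x => (⟨(a x).1, ((S.decomp (a x)).symm (z x)).2⟩ : C.Tot)) :=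
  fun x₀ => by
  refine C.contMDiffAt_of_injective DA (p := fun x => (a x).1) (p' := a) (fun x => D.ker (a x))
    (D.ker_injective _) ((A.contMDiff_proj.comp ha) x₀)
    (fun e => D.contMDiff_ker ha (C.contMDiff_sec e |>.comp (A.contMDiff_proj.comp ha)) x₀) ?_
  have h := DA.contMDiffAt_add (hz x₀) (DA.contMDiffAt_smul
    (contMDiffAt_const (c := (-1 : ℝ))) (S.contMDiff_lift ha (S.contMDiff_decomp_symm_fst hz) x₀))
  refine h.congr_of_eventuallyEq (Filter.Eventually.of_forall fun x => mk_inj.2 ?_)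
  have h1 := S.decomp_apply (a x) ((S.decomp (a x)).symm (z x)).1 ((S.decomp (a x)).symm (z x)).2
  rw [Prod.mk.eta, LinearEquiv.apply_symm_apply] at h1
  rw [neg_one_smul, ← sub_eq_add_neg]
  exact eq_sub_of_add_eq' h1.symm

end Smooth

/-- The covector `(b, c) ↦ β(b) + γ(c)` on the fibre of `D → A`. -/
def cov (a : A.Tot) (β : B.dual.V a.1) (γ : C.dual.V a.1) : DA.dual.V a :=
  LinearMap.toContinuousLinearMap ((((show B.V a.1 →L[ℝ] ℝ from β) : B.V a.1 →ₗ[ℝ] ℝ).coprod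
    ((show C.V a.1 →L[ℝ] ℝ from γ) : C.V a.1 →ₗ[ℝ] ℝ)).comp (S.decomp a).symm.toLinearMap)

theorem cov_apply (a : A.Tot) (β : B.dual.V a.1) (γ : C.dual.V a.1) (z : DA.V a) :
    (S.cov a β γ z : ℝ) = β ((S.decomp a).symm z).1 + γ ((S.decomp a).symm z).2 := rfl

theorem cov_decomp (a : A.Tot) (β : B.dual.V a.1) (γ : C.dual.V a.1) (b : B.V a.1) (c : C.V a.1) :
    (S.cov a β γ (S.decomp a (b, c)) : ℝ) = β b + γ c := by
  rw [cov_apply, LinearEquiv.symm_apply_apply]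

/-- The component in `B^*` of a covector on the fibre of `D → A`. -/
def covB (a : A.Tot) (Φ : DA.dual.V a) : B.dual.V a.1 :=
  LinearMap.toContinuousLinearMap (((show DA.V a →L[ℝ] ℝ from Φ) : DA.V a →ₗ[ℝ] ℝ).comp (S.lift a))

theorem covB_apply (a : A.Tot) (Φ : DA.dual.V a) (b : B.V a.1) :
    (S.covB a Φ b : ℝ) = Φ (S.lift a b) := rfl

end LinearSplitting

namespace DoubleVB

variable (D)

/-- The component in `C^*` of a covector on the fibre of `D → A`. -/
def covC (a : A.Tot) (Φ : DA.dual.V a) : C.dual.V a.1 :=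
  LinearMap.toContinuousLinearMap (((show DA.V a →L[ℝ] ℝ from Φ) : DA.V a →ₗ[ℝ] ℝ).comp (D.ker a))

theorem covC_apply (a : A.Tot) (Φ : DA.dual.V a) (c : C.V a.1) :
    (D.covC a Φ c : ℝ) = Φ (D.ker a c) := rfl

/-- The condition in the choice defining `prCstar` prescribes the covector on every core vector, and
Φ ∘ `ker` satisfies it. -/
theorem prCstar_mk (a : A.Tot) (Φ : DA.dual.V a) : D.prCstar ⟨a, Φ⟩ = ⟨a.1, D.covC a Φ⟩ := by
  have h : ∃ γ : C.dual.V a.1, ∀ (c : C.V a.1) (x : DA.V a),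
    DB.IsAdd (D.e (DA.zeroT a)) (D.e (D.core ⟨a.1, c⟩)) (D.e ⟨a, x⟩) → γ c = Φ x := by
    refine ⟨D.covC a Φ, fun c x hx => ?_⟩
    rw [mk_inj.1 (D.e.injective (hx.unique (D.isAdd_ker a c)))]
    rfl
  refine congrArg (TotalSpace.mk a.1) (ContinuousLinearMap.ext fun c => ?_)
  exact Classical.epsilon_spec h c _ (D.isAdd_ker a c)

variable {a : X → A.Tot} {Φ : ∀ x, DA.dual.V (a x)}

theorem contMDiff_covC (ha : ContMDiff J A.model ∞ a)
    (hΦ : ContMDiff J DA.dual.model ∞ (fun x => (⟨a x, Φ x⟩ : DA.dual.Tot))) :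
    ContMDiff J C.dual.model ∞ (fun x => (⟨(a x).1, D.covC (a x) (Φ x)⟩ : C.dual.Tot)) := fun x₀ => by
  refine C.contMDiffAt_dual_of_sec (p := fun x => (a x).1) ((A.contMDiff_proj.comp ha) x₀) fun e => ?_
  exact DA.contMDiffAt_eval (hΦ x₀)
    (D.contMDiff_ker ha (C.contMDiff_sec e |>.comp (A.contMDiff_proj.comp ha)) x₀)

theorem contMDiff_prCstar : ContMDiff DA.dual.model C.dual.model ∞ D.prCstar :=
  (D.contMDiff_covC (a := fun Φ : DA.dual.Tot => Φ.1) (Φ := fun Φ => Φ.2) DA.dual.contMDiff_proj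
    contMDiff_id).congr fun Φ => D.prCstar_mk Φ.1 Φ.2

end DoubleVB

namespace LinearSplitting

section Smooth

variable {a : X → A.Tot}

theorem contMDiff_covB (ha : ContMDiff J A.model ∞ a) {Φ : ∀ x, DA.dual.V (a x)}
    (hΦ : ContMDiff J DA.dual.model ∞ (fun x => (⟨a x, Φ x⟩ : DA.dual.Tot))) :
    ContMDiff J B.dual.model ∞ (fun x => (⟨(a x).1, S.covB (a x) (Φ x)⟩ : B.dual.Tot)) := fun x₀ => by
  refine B.contMDiffAt_dual_of_sec (p := fun x => (a x).1) ((A.contMDiff_proj.comp ha) x₀) fun e => ?_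
  exact DA.contMDiffAt_eval (hΦ x₀)
    (S.contMDiff_lift ha (B.contMDiff_sec e |>.comp (A.contMDiff_proj.comp ha)) x₀)

theorem contMDiff_cov (ha : ContMDiff J A.model ∞ a)
    {β : ∀ x, B.dual.V (a x).1} {γ : ∀ x, C.dual.V (a x).1}
    (hβ : ContMDiff J B.dual.model ∞ (fun x => (⟨(a x).1, β x⟩ : B.dual.Tot)))
    (hγ : ContMDiff J C.dual.model ∞ (fun x => (⟨(a x).1, γ x⟩ : C.dual.Tot))) :
    ContMDiff J DA.dual.model ∞ (fun x => (⟨a x, S.cov (a x) (β x) (γ x)⟩ : DA.dual.Tot)) :=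
  fun x₀ => by
  refine DA.contMDiffAt_dual_of_sec (ha x₀) fun e => ?_
  have he : ContMDiff J DA.model ∞ (fun x => (⟨a x, e (a x)⟩ : DA.Tot)) :=
    (DA.contMDiff_sec e).comp ha
  exact (B.contMDiffAt_eval (hβ x₀) (S.contMDiff_decomp_symm_fst he x₀)).add
    (C.contMDiffAt_eval (hγ x₀) (S.contMDiff_decomp_symm_snd ha he x₀))

end Smooth

theorem cov_covB_covC (a : A.Tot) (Φ : DA.dual.V a) : S.cov a (S.covB a Φ) (D.covC a Φ) = Φ := by
  refine ContinuousLinearMap.ext fun z => ?_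
  obtain ⟨⟨b, c⟩, rfl⟩ := (S.decomp a).surjective z
  refine (S.cov_decomp a _ _ b c).trans ?_
  rw [covB_apply, D.covC_apply, decomp_apply]
  exact ((show DA.V a →L[ℝ] ℝ from Φ).map_add _ _).symm

theorem covC_cov (a : A.Tot) (β : B.dual.V a.1) (γ : C.dual.V a.1) :
    D.covC a (S.cov a β γ) = γ := by
  refine ContinuousLinearMap.ext fun c => ?_
  have h := S.cov_decomp a β γ 0 c
  rw [decomp_apply, map_zero, zero_add] at h
  exact h.trans ((congrArg (· + (γ c : ℝ)) (show B.V a.1 →L[ℝ] ℝ from β).map_zero).trans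
    (zero_add _))

theorem covB_cov (a : A.Tot) (β : B.dual.V a.1) (γ : C.dual.V a.1) :
    S.covB a (S.cov a β γ) = β := by
  refine ContinuousLinearMap.ext fun b => ?_
  have h := S.cov_decomp a β γ b 0
  rw [decomp_apply, map_zero, add_zero] at h
  exact h.trans ((congrArg ((β b : ℝ) + ·) (show C.V a.1 →L[ℝ] ℝ from γ).map_zero).trans
    (add_zero _))

theorem prCstar_cov (a : A.Tot) (β : B.dual.V a.1) (γ : C.dual.V a.1) :
    D.prCstar ⟨a, S.cov a β γ⟩ = ⟨a.1, γ⟩ := by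
  rw [D.prCstar_mk, covC_cov]

theorem exists_cov {Φ : DA.dual.Tot} {γ : C.dual.Tot} (h : D.prCstar Φ = γ) :
    ∃ (a : A.V γ.1) (β : B.dual.V γ.1), Φ = ⟨⟨γ.1, a⟩, S.cov ⟨γ.1, a⟩ β γ.2⟩ := by
  obtain ⟨a, Φ⟩ := Φ
  rw [D.prCstar_mk] at h
  subst h
  exact ⟨a.2, S.covB a Φ, by rw [cov_covB_covC]⟩

/-- Both evaluations on d = (a, b, c) contain γ(c). It cancels, so the pairing does not depend on d.
-/
theorem eval_cov_sub_eval_cov {m : M} {a : A.V m} {b : B.V m} (β : B.dual.V m) (α : A.dual.V m)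
    (γ : C.dual.V m) {d : DA.Tot} (h₁ : d.1 = ⟨m, a⟩) (h₂ : (D.e d).1 = ⟨m, b⟩) :
    DA.eval ⟨⟨m, a⟩, S.cov ⟨m, a⟩ β γ⟩ d - DB.eval ⟨⟨m, b⟩, S.flip.cov ⟨m, b⟩ α γ⟩ (D.e d) =
      β b - α a := by
  obtain ⟨x, rfl⟩ := exists_eq_mk h₁
  obtain ⟨⟨b', c⟩, rfl⟩ := (S.decomp ⟨m, a⟩).surjective x
  have hb : b' = b := mk_inj.1 ((S.e_decomp_proj _ _ _).symm.trans h₂)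
  subst hb
  rw [S.e_decomp, eval_mk, eval_mk]
  refine (congrArg₂ (· - ·) (S.cov_decomp ⟨m, a⟩ β γ b' c)
    (S.flip.cov_decomp ⟨m, b'⟩ α γ a c)).trans ?_
  exact add_sub_add_right_eq_sub _ _ _

variable {m : M} (a : A.V m) (b : B.V m) (β : B.dual.V m) (α : A.dual.V m) (γ : C.dual.V m)

theorem pairing_cov : D.pairing ⟨⟨m, a⟩, S.cov ⟨m, a⟩ β γ⟩ ⟨⟨m, b⟩, S.flip.cov ⟨m, b⟩ α γ⟩ =
    β b - α a := by
  have h : ∃ r : ℝ, ∃ d : DA.Tot, d.1 = ⟨m, a⟩ ∧ (D.e d).1 = ⟨m, b⟩ ∧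
    r = DA.eval ⟨⟨m, a⟩, S.cov ⟨m, a⟩ β γ⟩ d -
      DB.eval ⟨⟨m, b⟩, S.flip.cov ⟨m, b⟩ α γ⟩ (D.e d) :=
    ⟨_, S.toFun m a b, S.prA _ _ _, S.prB _ _ _, rfl⟩
  obtain ⟨d, h₁, h₂, h₃⟩ := Classical.epsilon_spec h
  exact h₃.trans (S.eval_cov_sub_eval_cov β α γ h₁ h₂)

theorem flip_pairing_cov :
    D.flip.pairing ⟨⟨m, b⟩, S.flip.cov ⟨m, b⟩ α γ⟩ ⟨⟨m, a⟩, S.cov ⟨m, a⟩ β γ⟩ = α a - β b := by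
  have h : ∃ r : ℝ, ∃ d : DB.Tot, d.1 = ⟨m, b⟩ ∧ (D.e.symm d).1 = ⟨m, a⟩ ∧
    r = DB.eval ⟨⟨m, b⟩, S.flip.cov ⟨m, b⟩ α γ⟩ d -
      DA.eval ⟨⟨m, a⟩, S.cov ⟨m, a⟩ β γ⟩ (D.e.symm d) :=
    ⟨_, D.e (S.toFun m a b), S.prB _ _ _, by
      rw [Equiv.symm_apply_apply]
      exact S.prA _ _ _, rfl⟩
  obtain ⟨d, h₁, h₂, h₃⟩ := Classical.epsilon_spec h
  obtain ⟨d, rfl⟩ := D.e.surjective d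
  rw [Equiv.symm_apply_apply] at h₂ h₃
  refine h₃.trans ?_
  rw [← neg_sub, S.eval_cov_sub_eval_cov β α γ h₂ h₁, neg_sub]

/-! Components of sections of `D^{*A} → C^*`. -/

variable (s : D.DualSec)

theorem exists_sec_components (γ : C.dual.Tot) :
    ∃ z : A.V γ.1 × B.dual.V γ.1, s.toFun γ = ⟨⟨γ.1, z.1⟩, S.cov ⟨γ.1, z.1⟩ z.2 γ.2⟩ := by
  obtain ⟨a, β, h⟩ := S.exists_cov (s.prCstar_toFun γ)
  exact ⟨(a, β), h⟩

/-- The component in `A` of a section of `D^{*A} → C^*`. -/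
def secA (γ : C.dual.Tot) : A.V γ.1 := (Classical.choose (S.exists_sec_components s γ)).1

/-- The component in `B^*` of a section of `D^{*A} → C^*`. -/
def secB (γ : C.dual.Tot) : B.dual.V γ.1 := (Classical.choose (S.exists_sec_components s γ)).2

theorem toFun_eq_cov (γ : C.dual.Tot) :
    s.toFun γ = ⟨⟨γ.1, S.secA s γ⟩, S.cov ⟨γ.1, S.secA s γ⟩ (S.secB s γ) γ.2⟩ :=
  Classical.choose_spec (S.exists_sec_components s γ)

theorem contMDiff_secA :
    ContMDiff C.dual.model A.model ∞ (fun γ => (⟨γ.1, S.secA s γ⟩ : A.Tot)) :=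
  (DA.dual.contMDiff_proj.comp s.smooth).congr fun γ => by
    rw [Function.comp_apply, S.toFun_eq_cov]

theorem contMDiff_secB :
    ContMDiff C.dual.model B.dual.model ∞ (fun γ => (⟨γ.1, S.secB s γ⟩ : B.dual.Tot)) :=
  (S.contMDiff_covB (a := fun γ => (s.toFun γ).1) (Φ := fun γ => (s.toFun γ).2)
    (DA.dual.contMDiff_proj.comp s.smooth) s.smooth).congr fun γ => by
    rw [S.toFun_eq_cov, covB_cov]

theorem eq_and_eq_of_mk_cov_eq {γ : C.dual.Tot} {a a' : A.V γ.1} {β β' : B.dual.V γ.1}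
    (h : (⟨⟨γ.1, a⟩, S.cov ⟨γ.1, a⟩ β γ.2⟩ : DA.dual.Tot) = ⟨⟨γ.1, a'⟩, S.cov ⟨γ.1, a'⟩ β' γ.2⟩) :
    a = a' ∧ β = β' := by
  obtain rfl : a = a' := mk_inj.1 (congrArg (·.1) h)
  refine ⟨rfl, ?_⟩
  have h1 := congrArg (S.covB ⟨γ.1, a⟩) (TotalSpace.mk_injective _ h)
  rwa [covB_cov, covB_cov] at h1

/-- The section of `D^{*A} → C^*` with given components. -/
def mkSec (a : ∀ γ : C.dual.Tot, A.V γ.1) (β : ∀ γ : C.dual.Tot, B.dual.V γ.1)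
    (ha : ContMDiff C.dual.model A.model ∞ (fun γ => (⟨γ.1, a γ⟩ : A.Tot)))
    (hβ : ContMDiff C.dual.model B.dual.model ∞ (fun γ => (⟨γ.1, β γ⟩ : B.dual.Tot))) :
    D.DualSec where
  toFun γ := ⟨⟨γ.1, a γ⟩, S.cov ⟨γ.1, a γ⟩ (β γ) γ.2⟩
  smooth := S.contMDiff_cov (a := fun γ : C.dual.Tot => ⟨γ.1, a γ⟩) ha hβ contMDiff_id
  prCstar_toFun _ := S.prCstar_cov _ _ _

section MkSec

variable (a : ∀ γ : C.dual.Tot, A.V γ.1) (β : ∀ γ : C.dual.Tot, B.dual.V γ.1)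
    (ha : ContMDiff C.dual.model A.model ∞ (fun γ => (⟨γ.1, a γ⟩ : A.Tot)))
    (hβ : ContMDiff C.dual.model B.dual.model ∞ (fun γ => (⟨γ.1, β γ⟩ : B.dual.Tot)))

theorem secA_mkSec (γ : C.dual.Tot) : S.secA (S.mkSec a β ha hβ) γ = a γ :=
  (S.eq_and_eq_of_mk_cov_eq (S.toFun_eq_cov (S.mkSec a β ha hβ) γ)).1.symm

theorem secB_mkSec (γ : C.dual.Tot) : S.secB (S.mkSec a β ha hβ) γ = β γ :=
  (S.eq_and_eq_of_mk_cov_eq (S.toFun_eq_cov (S.mkSec a β ha hβ) γ)).2.symm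

end MkSec

theorem pairing_sec (t : D.flip.DualSec) (γ : C.dual.Tot) :
    D.pairing (s.toFun γ) (t.toFun γ) =
      S.secB s γ (S.flip.secA t γ) - S.flip.secB t γ (S.secA s γ) := by
  rw [S.toFun_eq_cov, S.flip.toFun_eq_cov]
  exact S.pairing_cov _ _ _ _ _

theorem ellCstar_cov : D.ellCstar s ⟨⟨m, b⟩, S.flip.cov ⟨m, b⟩ α γ⟩ =
    α (S.secA s ⟨m, γ⟩) - S.secB s ⟨m, γ⟩ b := by
  rw [DoubleVB.ellCstar, S.flip.prCstar_cov, S.toFun_eq_cov]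
  exact S.flip_pairing_cov _ _ _ _ _

end LinearSplitting

end DualGeometry

/-! ### Derivatives of linear functions along tangent vectors -/

namespace SmoothVB

variable {EN HN : Type*} [NormedAddCommGroup EN] [NormedSpace ℝ EN] [TopologicalSpace HN]
  {I : ModelWithCorners ℝ EN HN} {N : Type*} [TopologicalSpace N] [ChartedSpace HN N]
  [IsManifold I ∞ N] (E : SmoothVB I N)

/-- The derivative of a smooth function along a tangent vector of a vector bundle. -/
def deriv (F : C^∞⟮E.model, E.Tot; ℝ⟯) (u : TangentBundle E.model E.Tot) : ℝ :=
  diffAt E.model F u.1 u.2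

/-- On E ⊕ E the pullback of ℓ_θ by the addition is the sum of its pullbacks by the two projections;
differentiate along z. -/
theorem deriv_lin_of_isTangentAdd {u v w : TangentBundle E.model E.Tot}
    (h : E.IsTangentAdd v w u) (θ : E.dual.Sec) :
    E.deriv (E.lin θ) u = E.deriv (E.lin θ) v + E.deriv (E.lin θ) w := by
  obtain ⟨z, rfl, rfl, rfl⟩ := h
  have h₁ := contMDiff_prod_fst E E
  have h₂ := contMDiff_prod_snd E E
  have h₃ : ContMDiff (I.prod 𝓘(ℝ, E.F × E.F)) E.model ∞
      (fun p : TotalSpace (E.F × E.F) (E.V ×ᵇ E.V) => (⟨p.1, p.2.1 + p.2.2⟩ : E.Tot)) :=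
    fun x => E.contMDiffAt_add (h₁ x) (h₂ x)
  have hl := (E.lin θ).contMDiff
  have key : ∀ {g : TotalSpace (E.F × E.F) (E.V ×ᵇ E.V) → E.Tot},
      ContMDiff (I.prod 𝓘(ℝ, E.F × E.F)) E.model ∞ g →
      E.deriv (E.lin θ) (tangentMap (I.prod 𝓘(ℝ, E.F × E.F)) E.model g z) =
        diffAt (I.prod 𝓘(ℝ, E.F × E.F)) (fun p => E.lin θ (g p)) z.1 z.2 := fun {g} hg => by
    rw [diffAt_comp (hl (g z.1)) (hg z.1)]
    rfl
  rw [key h₁, key h₂, key h₃]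
  refine Eq.trans ?_ (DFunLike.congr_fun (diffAt_add ((hl.comp h₁) z.1) ((hl.comp h₂) z.1)) z.2)
  refine congrArg (fun f => diffAt (I.prod 𝓘(ℝ, E.F × E.F)) f z.1 z.2) (funext fun p => ?_)
  exact (show E.V p.1 →L[ℝ] ℝ from θ p.1).map_add _ _

theorem deriv_lin_tangentMap_smulT (r : ℝ) (u : TangentBundle E.model E.Tot) (θ : E.dual.Sec) :
    E.deriv (E.lin θ) (tangentMap E.model E.model (E.smulT r) u) = r * E.deriv (E.lin θ) u := by
  have hs : ContMDiff E.model E.model ∞ (E.smulT r) := E.contMDiff_smulT contMDiff_const contMDiff_id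
  have hl := (E.lin θ).contMDiff
  have h := diffAt_comp (hl (E.smulT r u.1)) (hs u.1)
  have h' : (fun v => E.lin θ (E.smulT r v)) = fun v => r * E.lin θ v := funext fun v =>
    (show E.V v.1 →L[ℝ] ℝ from θ v.1).map_smul _ _
  rw [h', diffAt_const_smul r (hl u.1)] at h
  exact (DFunLike.congr_fun h u.2).symm

theorem diffAt_vertLift {F : E.Tot → ℝ} {x : E.Tot} (hF : ContMDiffAt E.model 𝓘(ℝ, ℝ) ∞ F x)
    (v : E.V x.1) : diffAt E.model F x (E.vertLift x v) =
      _root_.deriv (fun t : ℝ => F ⟨x.1, x.2 + t • v⟩) 0 := by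
  have hg : ContMDiffAt 𝓘(ℝ, ℝ) E.model ∞ (fun t : ℝ => (⟨x.1, x.2 + t • v⟩ : E.Tot)) 0 :=
    E.contMDiffAt_add (p := fun _ : ℝ => x.1) contMDiffAt_const
      (E.contMDiffAt_smul (p := fun _ : ℝ => x.1) contMDiffAt_id contMDiffAt_const)
  have h0 : (⟨x.1, x.2 + (0 : ℝ) • v⟩ : E.Tot) = x := by rw [zero_smul, add_zero]
  have h := diffAt_comp (f := F) (g := fun t : ℝ => (⟨x.1, x.2 + t • v⟩ : E.Tot)) (x := 0)
    (by rwa [h0]) hg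
  have h1 := DFunLike.congr_fun h (1 : ℝ)
  have h2 : ∀ (y : E.Tot) (hy : y = x) (w : TangentSpace E.model y),
      diffAt E.model F y w = diffAt E.model F x w := by
    rintro _ rfl w
    rfl
  refine ((h2 _ h0 _).symm.trans h1.symm).trans ?_
  rw [diffAt, mfderiv_eq_fderiv]
  exact fderiv_apply_one_eq_deriv

theorem diffAt_lin_vertLift (θ : E.dual.Sec) (x : E.Tot) (v : E.V x.1) :
    diffAt E.model (E.lin θ) x (E.vertLift x v) = θ x.1 v := by
  rw [E.diffAt_vertLift ((E.lin θ).contMDiff x)]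
  have h : (fun t : ℝ => E.lin θ ⟨x.1, x.2 + t • v⟩) =
      fun t : ℝ => (θ x.1 x.2 : ℝ) + t * (θ x.1 v : ℝ) := funext fun t =>
    ((show E.V x.1 →L[ℝ] ℝ from θ x.1).map_add _ _).trans
      (congrArg _ ((show E.V x.1 →L[ℝ] ℝ from θ x.1).map_smul _ _))
  rw [h]
  simp

theorem diffAt_pull_vertLift (f : C^∞⟮I, N; ℝ⟯) (x : E.Tot) (v : E.V x.1) :
    diffAt E.model (E.pull f) x (E.vertLift x v) = 0 := by
  rw [E.diffAt_vertLift ((E.pull f).contMDiff x)]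
  exact _root_.deriv_const 0 (f x.1)

end SmoothVB

/-! ### Core sections and linear sections of a VB-algebroid -/

section VBAlgebroid

open SmoothVB

variable {EM HM : Type*} [NormedAddCommGroup EM] [NormedSpace ℝ EM] [FiniteDimensional ℝ EM]
  [TopologicalSpace HM] {I : ModelWithCorners ℝ EM HM} [I.Boundaryless] {M : Type*}
  [TopologicalSpace M] [ChartedSpace HM M] [IsManifold I ∞ M] [T2Space M]
  {A B C : SmoothVB I M} {DA : SmoothVB A.model A.Tot} {DB : SmoothVB B.model B.Tot}
  {D : DoubleVB A B C DA DB}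

namespace DoubleVB

variable (D)

/-- The core section `c^†` of `D → B`. -/
def coreSec (c : C.Sec) : DB.Sec where
  toFun b := D.flip.ker b (c b.1)
  contMDiff_toFun := D.flip.contMDiff_ker (a := fun b : B.Tot => b) contMDiff_id
    ((C.contMDiff_sec c).comp B.contMDiff_proj)

theorem coreSec_apply (c : C.Sec) (b : B.Tot) : D.coreSec c b = D.flip.ker b (c b.1) := rfl

theorem isCoreSec_coreSec (c : C.Sec) : D.IsCoreSec c (D.coreSec c) := fun b => by
  have h := D.flip.isAdd_ker b (c b.1)
  simpa [flip, coreSec_apply] using h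

variable {D}

theorem IsCoreSec.eq {c : C.Sec} {η : DB.Sec} (h : D.IsCoreSec c η) : η = D.coreSec c := by
  ext b
  exact mk_inj.1 (D.e.symm.injective ((h b).unique (D.isCoreSec_coreSec c b)))

theorem coreSec_injective : Function.Injective D.coreSec := fun c c' h => by
  ext m
  refine D.flip.ker_injective (B.zeroT m) ?_
  exact DFunLike.congr_fun h (B.zeroT m)

end DoubleVB

namespace LinearSplitting

variable (S : LinearSplitting D)

/-- The linear section `σ_A(a)` of `D → B`. -/
def linSec (a : A.Sec) : DB.Sec where
  toFun b := S.flip.lift b (a b.1)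
  contMDiff_toFun := S.flip.contMDiff_lift (a := fun b : B.Tot => b) contMDiff_id
    ((A.contMDiff_sec a).comp B.contMDiff_proj)

theorem linSec_apply (a : A.Sec) (b : B.Tot) : S.linSec a b = S.flip.lift b (a b.1) := rfl

theorem e_symm_linSec (a : A.Sec) (b : B.Tot) :
    D.e.symm ⟨b, S.linSec a b⟩ = S.toFun b.1 (a b.1) b.2 := by
  rw [linSec_apply, mk_lift]
  exact D.e.symm_apply_apply _

theorem isLinearSec_linSec (a : A.Sec) : D.IsLinearSec a (S.linSec a) where
  base b := by rw [e_symm_linSec, S.prA]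
  add b₁ b₂ b h := by
    obtain ⟨m, b₁, b₂, rfl, rfl, rfl⟩ := h
    simp only [e_symm_linSec]
    exact S.addA _ _ _ _
  smul r b := by
    rw [e_symm_linSec, e_symm_linSec]
    exact S.smulA _ _ _ _

theorem eq_linSec {a : A.Sec} {ξ : DB.Sec}
    (h : ∀ b : B.Tot, D.e.symm ⟨b, ξ b⟩ = S.toFun b.1 (a b.1) b.2) : ξ = S.linSec a := by
  ext b
  exact mk_inj.1 (D.e.symm.injective ((h b).trans (S.e_symm_linSec a b).symm))

end LinearSplitting

namespace IsVBAlgebroid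

variable {LA : LieAlgebroid A} {LDB : LieAlgebroid DB}

variable (D LDB) in
/-- The anchor of `D → B` on an element of `D`. -/
def anchorT (d : DA.Tot) : TangentBundle B.model B.Tot := ⟨(D.e d).1, LDB.anchor _ (D.e d).2⟩

theorem act_apply_eq (ξ : DB.Sec) (F : C^∞⟮B.model, B.Tot; ℝ⟯) (b : B.Tot) :
    LDB.act ξ F b = B.deriv F (anchorT D LDB (D.e.symm ⟨b, ξ b⟩)) := by
  rw [anchorT, Equiv.apply_symm_apply]
  rfl

theorem deriv_pull (h : IsVBAlgebroid D LA LDB) (f : C^∞⟮I, M; ℝ⟯) (d : DA.Tot) :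
    B.deriv (B.pull f) (anchorT D LDB d) = diffAt I f d.1.1 (LA.anchor _ d.1.2) := by
  have h1 := congrArg (fun u : TangentBundle I M => diffAt I f u.1 u.2) (h.anchor_over d)
  refine Eq.trans ?_ h1
  have h2 := diffAt_comp (f.contMDiff (D.e d).1.1) (B.contMDiff_proj (D.e d).1)
  exact DFunLike.congr_fun h2 _

theorem deriv_lin_add (h : IsVBAlgebroid D LA LDB) (β : B.dual.Sec) {d₁ d₂ d : DA.Tot} (hd : DA.IsAdd d₁ d₂ d) :
    B.deriv (B.lin β) (anchorT D LDB d) =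
      B.deriv (B.lin β) (anchorT D LDB d₁) + B.deriv (B.lin β) (anchorT D LDB d₂) :=
  B.deriv_lin_of_isTangentAdd (h.anchor_add _ _ _ hd) β

theorem deriv_lin_smul (h : IsVBAlgebroid D LA LDB) (β : B.dual.Sec) (r : ℝ) (d : DA.Tot) :
    B.deriv (B.lin β) (anchorT D LDB (DA.smulT r d)) = r * B.deriv (B.lin β) (anchorT D LDB d) := by
  rw [anchorT, h.anchor_smul, B.deriv_lin_tangentMap_smulT]
  rfl

theorem deriv_zeroT (F : C^∞⟮B.model, B.Tot; ℝ⟯) (b : B.Tot) :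
    B.deriv F (anchorT D LDB (D.e.symm (DB.zeroT b))) = 0 := by
  rw [anchorT, Equiv.apply_symm_apply]
  refine (congrArg (diffAt B.model F b) (LDB.anchor b).map_zero).trans ?_
  exact map_zero _

theorem act_linear_pull (h : IsVBAlgebroid D LA LDB) {a : A.Sec} {ξ : DB.Sec} (hξ : D.IsLinearSec a ξ) (f : C^∞⟮I, M; ℝ⟯)
    (b : B.Tot) : LDB.act ξ (B.pull f) b = LA.act a f b.1 := by
  rw [act_apply_eq (D := D), h.deriv_pull, hξ.base]
  rfl

theorem act_core_pull (h : IsVBAlgebroid D LA LDB) (c : C.Sec) (f : C^∞⟮I, M; ℝ⟯) (b : B.Tot) :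
    LDB.act (D.coreSec c) (B.pull f) b = 0 := by
  have h1 : (D.e.symm ⟨b, D.coreSec c b⟩).proj = A.zeroT b.1 := D.flip.e_kerFun_proj b (c b.1)
  rw [act_apply_eq (D := D), h.deriv_pull, h1]
  refine (congrArg (diffAt I f b.1) (LA.anchor b.1).map_zero).trans ?_
  exact map_zero _

/-- As c^† at b is 0_b +_A c and the anchor is additive over A, only the core vector contributes; in
particular the derivative is constant on the fibres of B. -/
theorem act_core_lin (h : IsVBAlgebroid D LA LDB) (c : C.Sec) (β : B.dual.Sec) (b : B.Tot) :
    LDB.act (D.coreSec c) (B.lin β) b =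
      B.deriv (B.lin β) (anchorT D LDB (D.core ⟨b.1, c b.1⟩)) := by
  rw [act_apply_eq (D := D), h.deriv_lin_add β (D.isCoreSec_coreSec c b), deriv_zeroT, zero_add]

/-- The derivative of ℓ_β along c^† is tensorial in β, because c^† kills functions from M; hence it
is the pairing with a section of B. -/
theorem exists_coreAnchor (h : IsVBAlgebroid D LA LDB) (c : C.Sec) : ∃ b : B.Sec, ∀ (β : B.dual.Sec) (x : B.Tot),
    LDB.act (D.coreSec c) (B.lin β) x = β x.1 (b x.1) := by
  have h0 : ∀ (β : B.dual.Sec) (x : B.Tot), LDB.act (D.coreSec c) (B.lin β) x =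
      LDB.act (D.coreSec c) (B.lin β) (B.zeroT x.1) := fun β x => by
    rw [h.act_core_lin, h.act_core_lin]
    rfl
  obtain ⟨b, hb, hb'⟩ := B.exists_lift (p := fun m : M => m) contMDiff_id
    (fun β m => LDB.act (D.coreSec c) (B.lin β) (B.zeroT m))
    (fun β => (LDB.act _ _).contMDiff.comp B.contMDiff_zeroT)
    (fun β β' m => by
      rw [show B.lin (β + β') = B.lin β + B.lin β' from rfl, LDB.act_add_right])
    (fun f β m => by
      rw [show B.lin (B.dual.fsmul f β) = B.pull f * B.lin β from rfl, LDB.act_mul,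
        h.act_core_pull, mul_zero, add_zero]
      rfl)
  exact ⟨⟨b, hb⟩, fun β x => (h0 β x).trans (hb' β x.1).symm⟩

/-- The choice defining `coreAnchor` can be met: the anchor of c^† and a vertical lift agree on
linear functions and on functions from M, and these separate tangent vectors. -/
theorem act_core_lin_eq (h : IsVBAlgebroid D LA LDB) (c : C.Sec) (β : B.dual.Sec) (x : B.Tot) :
    LDB.act (D.coreSec c) (B.lin β) x = β x.1 (D.coreAnchor LDB c x.1) := by
  have h1 : ∃ b : B.Sec, ∃ η : DB.Sec, D.IsCoreSec c η ∧
      ∀ x : B.Tot, LDB.anchor x (η x) = B.vertLift x (b x.1) := by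
    obtain ⟨b, hb⟩ := h.exists_coreAnchor c
    refine ⟨b, _, D.isCoreSec_coreSec c, fun x => B.tangent_ext (fun θ => ?_) fun f => ?_⟩
    · rw [B.diffAt_lin_vertLift]
      exact hb θ x
    · rw [B.diffAt_pull_vertLift]
      exact h.act_core_pull c f x
  obtain ⟨η, hη, hη'⟩ := Classical.epsilon_spec (p := fun b : B.Sec => ∃ η : DB.Sec,
    D.IsCoreSec c η ∧ ∀ x : B.Tot, LDB.anchor x (η x) = B.vertLift x (b x.1)) h1
  rw [LDB.act_apply, ← hη.eq, hη', B.diffAt_lin_vertLift]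
  rfl

theorem bracket_linSec_coreSec (h : IsVBAlgebroid D LA LDB) (S : LinearSplitting D) (a : A.Sec) (c : C.Sec) :
    LDB.bracket (S.linSec a) (D.coreSec c) = D.coreSec (D.coreConn LDB S.toFun a c) := by
  obtain ⟨c', hc'⟩ := h.linear_core a c _ _ (S.isLinearSec_linSec a) (D.isCoreSec_coreSec c)
  obtain ⟨ξ, η, hξ, hη, h1⟩ := Classical.epsilon_spec (p := fun c' : C.Sec => ∃ ξ η : DB.Sec,
    (∀ b : B.Tot, D.e.symm ⟨b, ξ b⟩ = S.toFun b.1 (a b.1) b.2) ∧ D.IsCoreSec c η ∧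
    D.IsCoreSec c' (LDB.bracket ξ η))
    ⟨c', _, _, S.e_symm_linSec a, D.isCoreSec_coreSec c, hc'⟩
  rw [← S.eq_linSec hξ, ← hη.eq]
  exact h1.eq

theorem bracket_coreSec_coreSec (h : IsVBAlgebroid D LA LDB) (c c' : C.Sec) :
    LDB.bracket (D.coreSec c) (D.coreSec c') = 0 :=
  h.core_core c c' _ _ (D.isCoreSec_coreSec c) (D.isCoreSec_coreSec c')

end IsVBAlgebroid

end VBAlgebroid

/-! ### Functions on D^{*B} that are linear over C^* or pulled back from C^* -/

section Special

open SmoothVB LieAlgebroid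

variable {EM HM : Type*} [NormedAddCommGroup EM] [NormedSpace ℝ EM] [FiniteDimensional ℝ EM]
  [TopologicalSpace HM] {I : ModelWithCorners ℝ EM HM} [I.Boundaryless] {M : Type*}
  [TopologicalSpace M] [ChartedSpace HM M] [IsManifold I ∞ M] [T2Space M]
  {A B C : SmoothVB I M} {DA : SmoothVB A.model A.Tot} {DB : SmoothVB B.model B.Tot}
  {D : DoubleVB A B C DA DB}

namespace DoubleVB

variable (D) in
/-- The functions on `D^{*B}` defined by linear sections of `D → B` and by sections of `B^*`. -/
inductive IsSpecial : C^∞⟮DB.dual.model, DB.dual.Tot; ℝ⟯ → Prop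
  | ell (a : A.Sec) (ξ : DB.Sec) (hξ : D.IsLinearSec a ξ) : IsSpecial (DB.ell ξ)
  | pull (β : B.dual.Sec) : IsSpecial (DB.dual.pull (B.lin β))

/-- Core sections are exactly what makes linear functions on C^* visible on D^{*B}: every bracket
with a function from C^* reduces to brackets with core sections and functions from M. -/
theorem ell_coreSec (c : C.Sec) (Ψ : DB.dual.Tot) :
    DB.ell (D.coreSec c) Ψ = C.ell c (D.flip.prCstar Ψ) := by
  rw [D.flip.prCstar_mk]
  rfl

theorem gen_prCstar (z : C.Sec × C^∞⟮I, M; ℝ⟯) (Ψ : DB.dual.Tot) :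
    gen DB (D.coreSec z.1, B.pull z.2) Ψ = gen C z (D.flip.prCstar Ψ) :=
  congrArg (· + z.2 Ψ.1.1) (D.ell_coreSec z.1 Ψ)

/-- The bracket sees only the differential of F at the image point, so F may be replaced there by a
generator ℓ_c + q^*f of C^*, whose pullback is a generator of D^{*B}. -/
theorem liePoisson_prCstar {LDB : LieAlgebroid DB} (K : DB.dual.Tot → ℝ)
    {F : C.dual.Tot → ℝ} (hF : ContMDiff C.dual.model 𝓘(ℝ, ℝ) ∞ F)
    {Ψ : DB.dual.Tot} {z : C.Sec × C^∞⟮I, M; ℝ⟯}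
    (hz : diffGen C (D.flip.prCstar Ψ) z = diffAt C.dual.model F (D.flip.prCstar Ψ)) :
    liePoisson LDB K (fun Ψ' => F (D.flip.prCstar Ψ')) Ψ =
      liePoisson LDB K (gen DB (D.coreSec z.1, B.pull z.2)) Ψ := by
  have hp := D.flip.contMDiff_prCstar Ψ
  have h1 : (gen DB (D.coreSec z.1, B.pull z.2) : DB.dual.Tot → ℝ) =
      fun Ψ' => gen C z (D.flip.prCstar Ψ') := funext (D.gen_prCstar z)
  have h2 : diffAt DB.dual.model (fun Ψ' => F (D.flip.prCstar Ψ')) Ψ =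
      diffAt DB.dual.model (gen DB (D.coreSec z.1, B.pull z.2)) Ψ := by
    rw [h1]
    refine (diffAt_comp (hF _) hp).trans ?_
    refine (congrArg (fun μ : TangentSpace C.dual.model (D.flip.prCstar Ψ) →L[ℝ] ℝ =>
      μ.comp (mfderiv DB.dual.model C.dual.model D.flip.prCstar Ψ)) hz.symm).trans ?_
    exact (diffAt_comp ((gen C z).contMDiff _) hp).symm
  rw [liePoisson_eq_bivector, liePoisson_eq_bivector, h2]

end DoubleVB

namespace LieAlgebroid

variable {EN HN : Type*} [NormedAddCommGroup EN] [NormedSpace ℝ EN] [FiniteDimensional ℝ EN]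
  [TopologicalSpace HN] {K : ModelWithCorners ℝ EN HN} [K.Boundaryless] {N : Type*}
  [TopologicalSpace N] [ChartedSpace HN N] [IsManifold K ∞ N] [T2Space N]
  {E : SmoothVB K N} {L : LieAlgebroid E}

theorem gen_zero_right (ξ : E.Sec) : gen E (ξ, 0) = E.ell ξ := by
  ext φ
  exact add_zero _

theorem gen_zero_left (f : C^∞⟮K, N; ℝ⟯) : gen E (0, f) = E.dual.pull f := by
  ext φ
  exact (congrArg (· + f φ.1) (E.ell_zero φ)).trans (zero_add _)

theorem act_zero_right (a : E.Sec) (x : N) : L.act a 0 x = 0 :=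
  map_zero (AddMonoidHom.mk' (fun f => L.act a f x) fun f g => L.act_add_right a f g x)

theorem act_zero_left (f : C^∞⟮K, N; ℝ⟯) (x : N) : L.act 0 f x = 0 :=
  map_zero (AddMonoidHom.mk' (fun a => L.act a f x) fun a b => L.act_add_left a b f x)

theorem liePoisson_ell_gen (ξ : E.Sec) (w : E.Sec × C^∞⟮K, N; ℝ⟯) (φ : E.dual.Tot) :
    liePoisson L (E.ell ξ) (gen E w) φ = E.ell (L.bracket ξ w.1) φ + L.act ξ w.2 φ.1 := by
  rw [← gen_zero_right, liePoisson_gen]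
  refine congrArg (E.ell (L.bracket ξ w.1) φ + ·) ?_
  exact (congrArg (L.act ξ w.2 φ.1 - ·) (act_zero_right _ _)).trans (sub_zero _)

theorem liePoisson_pull_gen (f : C^∞⟮K, N; ℝ⟯) (w : E.Sec × C^∞⟮K, N; ℝ⟯) (φ : E.dual.Tot) :
    liePoisson L (E.dual.pull f) (gen E w) φ = -L.act w.1 f φ.1 := by
  rw [← gen_zero_left, liePoisson_skew, liePoisson_gen]
  refine congrArg Neg.neg ?_
  have h1 : L.bracket w.1 0 = 0 := map_zero _
  refine (congrArg₂ (· + ·) (congrArg (fun s => E.ell s φ) h1)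
    (congrArg (L.act w.1 f φ.1 - ·) (act_zero_left w.2 φ.1))).trans ?_
  rw [sub_zero]
  exact (congrArg (· + _) (E.ell_zero φ)).trans (zero_add _)

theorem liePoisson_ell_ell (ξ η : E.Sec) (φ : E.dual.Tot) :
    liePoisson L (E.ell ξ) (E.ell η) φ = E.ell (L.bracket ξ η) φ := by
  rw [← gen_zero_right η, liePoisson_ell_gen, act_zero_right, add_zero]

theorem liePoisson_ell_pull (ξ : E.Sec) (f : C^∞⟮K, N; ℝ⟯) (φ : E.dual.Tot) :
    liePoisson L (E.ell ξ) (E.dual.pull f) φ = L.act ξ f φ.1 := by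
  rw [← gen_zero_left, liePoisson_ell_gen, map_zero, E.ell_zero, zero_add]

theorem liePoisson_pull_pull (f g : C^∞⟮K, N; ℝ⟯) (φ : E.dual.Tot) :
    liePoisson L (E.dual.pull f) (E.dual.pull g) φ = 0 := by
  rw [← gen_zero_left g, liePoisson_pull_gen, act_zero_left, neg_zero]

end LieAlgebroid

namespace LinearSplitting

variable (S : LinearSplitting D)

/-- The function `K` on `D^{*B}` is linear on the fibres over the points of `C^*` over `m`. -/
def IsFibLin (m : M) (K : DB.dual.Tot → ℝ) : Prop :=
  ∀ γ : C.dual.V m, ∃ l : (B.V m × A.dual.V m) →ₗ[ℝ] ℝ, ∀ b α,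
    K ⟨⟨m, b⟩, S.flip.cov ⟨m, b⟩ α γ⟩ = l (b, α)

variable {S} {m : M}

theorem IsFibLin.add {K K' : DB.dual.Tot → ℝ} (h : S.IsFibLin m K) (h' : S.IsFibLin m K') :
    S.IsFibLin m (fun Ψ => K Ψ + K' Ψ) := fun γ => by
  obtain ⟨l, hl⟩ := h γ
  obtain ⟨l', hl'⟩ := h' γ
  exact ⟨l + l', fun b α => congrArg₂ (· + ·) (hl b α) (hl' b α)⟩

theorem IsFibLin.neg {K : DB.dual.Tot → ℝ} (h : S.IsFibLin m K) :
    S.IsFibLin m (fun Ψ => -K Ψ) := fun γ => by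
  obtain ⟨l, hl⟩ := h γ
  exact ⟨-l, fun b α => congrArg Neg.neg (hl b α)⟩

theorem IsFibLin.sum {ι : Type*} (s : Finset ι) {K : ι → DB.dual.Tot → ℝ}
    (h : ∀ i, S.IsFibLin m (K i)) : S.IsFibLin m (fun Ψ => ∑ i ∈ s, K i Ψ) := fun γ => by
  choose l hl using fun i => h i γ
  exact ⟨∑ i ∈ s, l i, fun b α => by simp [hl]⟩

theorem IsFibLin.basic_mul {K G : DB.dual.Tot → ℝ} {F : C.dual.Tot → ℝ}
    (hG : ∀ Ψ, G Ψ = F (D.flip.prCstar Ψ)) (h : S.IsFibLin m K) :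
    S.IsFibLin m (fun Ψ => G Ψ * K Ψ) := fun γ => by
  obtain ⟨l, hl⟩ := h γ
  exact ⟨F ⟨m, γ⟩ • l, fun b α => congrArg₂ (· * ·)
    ((hG _).trans (congrArg F (S.flip.prCstar_cov _ _ _))) (hl b α)⟩

theorem IsFibLin.congr {K K' : DB.dual.Tot → ℝ} (h : S.IsFibLin m K)
    (hK : ∀ Ψ : DB.dual.Tot, Ψ.1.1 = m → K' Ψ = K Ψ) : S.IsFibLin m K' := fun γ => by
  obtain ⟨l, hl⟩ := h γ
  exact ⟨l, fun b α => by rw [hK _ rfl, hl]⟩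

/-- In components ξ(b) = (a, κ(b)) with a core part κ(b) linear in b, so the function is α(a) +
γ(κ(b)), linear in (b, α) for fixed γ. -/
theorem isFibLin_ell {a : A.Sec} {ξ : DB.Sec} (hξ : D.IsLinearSec a ξ) :
    S.IsFibLin m (DB.ell ξ) := fun γ => by
  have h1 : ∀ b : B.V m, ∃ x : DA.V ⟨m, a m⟩, D.e.symm ⟨⟨m, b⟩, ξ ⟨m, b⟩⟩ = ⟨⟨m, a m⟩, x⟩ :=
    fun b => exists_eq_mk (hξ.base ⟨m, b⟩)
  choose x hx using h1
  let κ : B.V m →ₗ[ℝ] DA.V ⟨m, a m⟩ :=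
    { toFun := x
      map_add' := fun b b' => by
        have h2 := hξ.add _ _ _ (isAdd_mk m b b')
        rw [hx, hx, hx] at h2
        exact isAdd_mk_iff.1 h2
      map_smul' := fun r b => by
        have h2 := hξ.smul r ⟨m, b⟩
        rw [hx] at h2
        exact mk_inj.1 ((hx (r • b)).symm.trans h2) }
  have h3 : ∀ b : B.V m, ξ ⟨m, b⟩ =
      S.flip.decomp ⟨m, b⟩ (a m, ((S.decomp ⟨m, a m⟩).symm (κ b)).2) := fun b => by
    have h4 : (⟨⟨m, b⟩, ξ ⟨m, b⟩⟩ : DB.Tot) = D.e ⟨⟨m, a m⟩, x b⟩ := by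
      rw [← hx, Equiv.apply_symm_apply]
    obtain ⟨⟨b', c⟩, hbc⟩ := (S.decomp ⟨m, a m⟩).surjective (x b)
    have h5 : ((S.decomp ⟨m, a m⟩).symm (κ b)).2 = c := by
      change ((S.decomp ⟨m, a m⟩).symm (x b)).2 = c
      rw [← hbc, LinearEquiv.symm_apply_apply]
    rw [← hbc, S.e_decomp] at h4
    obtain rfl : b = b' := mk_inj.1 (congrArg (·.1) h4)
    rw [h5]
    exact mk_inj.1 h4
  refine ⟨(((show C.V m →L[ℝ] ℝ from γ) : C.V m →ₗ[ℝ] ℝ).comp ((LinearMap.snd ℝ _ _).comp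
      ((S.decomp ⟨m, a m⟩).symm.toLinearMap.comp κ))).coprod
    { toFun := fun α : A.dual.V m => (α (a m) : ℝ)
      map_add' := fun _ _ => rfl
      map_smul' := fun _ _ => rfl }, fun b α => ?_⟩
  rw [ell_apply]
  refine (congrArg _ (h3 b)).trans ((S.flip.cov_decomp ⟨m, b⟩ α γ _ _).trans ?_)
  exact add_comm _ _

theorem isFibLin_pull {g : C^∞⟮B.model, B.Tot; ℝ⟯}
    (hadd : ∀ b b' : B.V m, g ⟨m, b + b'⟩ = g ⟨m, b⟩ + g ⟨m, b'⟩)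
    (hsmul : ∀ (r : ℝ) (b : B.V m), g ⟨m, r • b⟩ = r * g ⟨m, b⟩) :
    S.IsFibLin m (DB.dual.pull g) := fun _ =>
  ⟨{ toFun := fun z => g ⟨m, z.1⟩
     map_add' := fun z w => hadd z.1 w.1
     map_smul' := fun r z => hsmul r z.1 }, fun _ _ => rfl⟩

theorem _root_.DoubleVB.IsSpecial.isFibLin {K : C^∞⟮DB.dual.model, DB.dual.Tot; ℝ⟯}
    (hK : D.IsSpecial K) : S.IsFibLin m K := by
  obtain ⟨a, ξ, hξ⟩ | β := hK
  · exact isFibLin_ell hξ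
  · exact isFibLin_pull (fun _ _ => (show B.V m →L[ℝ] ℝ from β m).map_add _ _)
      fun _ _ => (show B.V m →L[ℝ] ℝ from β m).map_smul _ _

variable {LA : LieAlgebroid A} {LDB : LieAlgebroid DB}

theorem isFibLin_liePoisson_ell_pull (h : IsVBAlgebroid D LA LDB) {a : A.Sec} {ξ : DB.Sec}
    (hξ : D.IsLinearSec a ξ) (β : B.dual.Sec) :
    S.IsFibLin m (liePoisson LDB (DB.ell ξ) (DB.dual.pull (B.lin β))) := by
  have h1 : S.IsFibLin m (DB.dual.pull (LDB.act ξ (B.lin β))) := by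
    refine isFibLin_pull (fun b b' => ?_) fun r b => ?_
    · simp only [IsVBAlgebroid.act_apply_eq (D := D)]
      exact h.deriv_lin_add β (hξ.add _ _ _ (isAdd_mk m b b'))
    · have h2 := hξ.smul r ⟨m, b⟩
      simp only [IsVBAlgebroid.act_apply_eq (D := D)]
      refine Eq.trans ?_ (h.deriv_lin_smul β r _)
      rw [← h2]
      rfl
  exact h1.congr fun Ψ _ => liePoisson_ell_pull _ _ _

/-- Linear sections are closed under the bracket, their anchors preserve linear functions on B, and
functions from B commute. -/
theorem isFibLin_liePoisson_special (h : IsVBAlgebroid D LA LDB)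
    {K K' : C^∞⟮DB.dual.model, DB.dual.Tot; ℝ⟯} (hK : D.IsSpecial K) (hK' : D.IsSpecial K') :
    S.IsFibLin m (liePoisson LDB K K') := by
  obtain ⟨a, ξ, hξ⟩ | β := hK <;> obtain ⟨a', ξ', hξ'⟩ | β' := hK'
  · exact (isFibLin_ell (h.linear_linear _ _ _ _ hξ hξ')).congr
      fun Ψ _ => liePoisson_ell_ell _ _ _
  · exact isFibLin_liePoisson_ell_pull h hξ β'
  · exact (isFibLin_liePoisson_ell_pull h hξ' β).neg.congr fun Ψ _ => liePoisson_skew _ _ _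
  · intro γ
    exact ⟨0, fun b α => liePoisson_pull_pull _ _ _⟩

end LinearSplitting

namespace IsVBAlgebroid

variable {LA : LieAlgebroid A} {LDB : LieAlgebroid DB}

/-- Brackets of linear with core sections are core sections, linear sections differentiate functions
from M to functions from M, and core sections differentiate ℓ_β to a function from M. -/
theorem exists_liePoisson_special_prCstar (h : IsVBAlgebroid D LA LDB)
    {K : C^∞⟮DB.dual.model, DB.dual.Tot; ℝ⟯} (hK : D.IsSpecial K)
    {F : C.dual.Tot → ℝ} (hF : ContMDiff C.dual.model 𝓘(ℝ, ℝ) ∞ F) :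
    ∃ G : C.dual.Tot → ℝ, ∀ Ψ, liePoisson LDB K (fun Ψ' => F (D.flip.prCstar Ψ')) Ψ =
      G (D.flip.prCstar Ψ) := by
  choose z hz using fun γ : C.dual.Tot => diffGen_surjective C γ (diffAt C.dual.model F γ)
  obtain ⟨a, ξ, hξ⟩ | β := hK
  · choose c' hc' using fun c : C.Sec => h.linear_core a c ξ _ hξ (D.isCoreSec_coreSec c)
    refine ⟨fun γ => C.ell (c' (z γ).1) γ + LA.act a (z γ).2 γ.1, fun Ψ => ?_⟩
    rw [D.liePoisson_prCstar _ hF (hz _), liePoisson_ell_gen, h.act_linear_pull hξ, (hc' _).eq,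
      D.ell_coreSec]
    rfl
  · refine ⟨fun γ => -(β γ.1 (D.coreAnchor LDB (z γ).1 γ.1) : ℝ), fun Ψ => ?_⟩
    rw [D.liePoisson_prCstar _ hF (hz _), liePoisson_pull_gen, h.act_core_lin_eq]
    rfl

/-- Core sections commute and their anchors kill functions from M. This drops the derivatives of the
coefficients, themselves pulled back from C^*, in the later expansions against pulled-back
functions. -/
theorem liePoisson_prCstar_prCstar (h : IsVBAlgebroid D LA LDB)
    {F G : C.dual.Tot → ℝ} (hF : ContMDiff C.dual.model 𝓘(ℝ, ℝ) ∞ F)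
    (hG : ContMDiff C.dual.model 𝓘(ℝ, ℝ) ∞ G) (Ψ : DB.dual.Tot) :
    liePoisson LDB (fun Ψ' => F (D.flip.prCstar Ψ')) (fun Ψ' => G (D.flip.prCstar Ψ')) Ψ = 0 := by
  obtain ⟨z, hz⟩ := diffGen_surjective C _ (diffAt C.dual.model F (D.flip.prCstar Ψ))
  obtain ⟨w, hw⟩ := diffGen_surjective C _ (diffAt C.dual.model G (D.flip.prCstar Ψ))
  rw [D.liePoisson_prCstar _ hG hw, liePoisson_skew, D.liePoisson_prCstar _ hF hz, liePoisson_gen]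
  refine neg_eq_zero.2 ?_
  have h1 : LDB.genBr (D.coreSec w.1, B.pull w.2) (D.coreSec z.1, B.pull z.2) = (0, 0) := by
    refine Prod.ext (h.bracket_coreSec_coreSec _ _) ?_
    ext b
    exact (congrArg₂ (· - ·) (h.act_core_pull w.1 z.2 b) (h.act_core_pull z.1 w.2 b)).trans
      (sub_zero _)
  rw [h1, gen_zero_right, DB.ell_zero]

end IsVBAlgebroid

end Special

/-! ### The Lie algebroid D^{*A} → C^* -/

section DualAlgebroid

open SmoothVB LieAlgebroid

variable {EM HM : Type*} [NormedAddCommGroup EM] [NormedSpace ℝ EM] [FiniteDimensional ℝ EM]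
  [TopologicalSpace HM] {I : ModelWithCorners ℝ EM HM} [I.Boundaryless] {M : Type*}
  [TopologicalSpace M] [ChartedSpace HM M] [IsManifold I ∞ M] [T2Space M]
  {A B C : SmoothVB I M} {DA : SmoothVB A.model A.Tot} {DB : SmoothVB B.model B.Tot}
  {D : DoubleVB A B C DA DB}

namespace LinearSplitting

theorem exists_eq_cov (S : LinearSplitting D) (Ψ : DB.dual.Tot) : ∃ (m : M) (b : B.V m) (α : A.dual.V m) (γ : C.dual.V m),
    Ψ = ⟨⟨m, b⟩, S.flip.cov ⟨m, b⟩ α γ⟩ := by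
  obtain ⟨b, α, h⟩ := S.flip.exists_cov (Φ := Ψ) rfl
  exact ⟨_, b, α, _, h⟩

theorem contMDiff_ellCstar (S : LinearSplitting D) (s : D.DualSec) :
    ContMDiff DB.dual.model 𝓘(ℝ, ℝ) ∞ (D.ellCstar s) := by
  have h1 : ContMDiff DB.dual.model A.dual.model ∞
      (fun Ψ : DB.dual.Tot => (⟨Ψ.1.1, S.flip.covB Ψ.1 Ψ.2⟩ : A.dual.Tot)) :=
    S.flip.contMDiff_covB (a := fun Ψ : DB.dual.Tot => Ψ.1) DB.dual.contMDiff_proj contMDiff_id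
  have h2 := (S.contMDiff_secA s).comp D.flip.contMDiff_prCstar
  have h3 := (S.contMDiff_secB s).comp D.flip.contMDiff_prCstar
  have h4 : ContMDiff DB.dual.model B.model ∞ (fun Ψ : DB.dual.Tot => Ψ.1) :=
    DB.dual.contMDiff_proj
  refine ContMDiff.congr (f := fun Ψ : DB.dual.Tot =>
    (S.flip.covB Ψ.1 Ψ.2 (S.secA s (D.flip.prCstar Ψ)) : ℝ) -
      (S.secB s (D.flip.prCstar Ψ) Ψ.1.2 : ℝ)) (fun Ψ => ?_) fun Ψ => ?_
  · exact (A.contMDiffAt_eval (h1 Ψ) (h2 Ψ)).sub (B.contMDiffAt_eval (h3 Ψ) (h4 Ψ))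
  · obtain ⟨m, b, α, γ, rfl⟩ := S.exists_eq_cov Ψ
    have h5 : ((D.flip.prCstar ⟨⟨m, b⟩, S.flip.cov ⟨m, b⟩ α γ⟩).2 : C.dual.V m) = γ :=
      (mk_inj (E := C.dual) (x := m)).1 (S.flip.prCstar_cov ⟨m, b⟩ α γ)
    rw [S.ellCstar_cov, S.flip.covB_cov]
    exact congrArg (fun c : C.dual.V m => (α (S.secA s ⟨m, c⟩) : ℝ) - S.secB s ⟨m, c⟩ b) h5.symm

/-- A smooth function on `D^{*B}` that is linear over `C^*` is given by a section of `D^{*A}`. -/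
theorem exists_ellCstar_eq (S : LinearSplitting D) {K : DB.dual.Tot → ℝ} (hK : ContMDiff DB.dual.model 𝓘(ℝ, ℝ) ∞ K)
    (hl : ∀ m, S.IsFibLin m K) : ∃ u : D.DualSec, ∀ Ψ, D.ellCstar u Ψ = K Ψ := by
  have hp : ContMDiff C.dual.model I ∞ (fun γ : C.dual.Tot => γ.1) := C.dual.contMDiff_proj
  choose l hl using hl
  -- A section (a, β) is the function α(a) - β(b): its component a is read off at b = 0, and β, with
  -- a minus sign, at α = 0.
  obtain ⟨a, ha, ha'⟩ := A.exists_lift hp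
    (fun θ γ => K ⟨⟨γ.1, 0⟩, S.flip.cov ⟨γ.1, 0⟩ (θ γ.1) γ.2⟩)
    (fun θ => hK.comp (S.flip.contMDiff_cov (a := fun γ : C.dual.Tot => B.zeroT γ.1)
      (B.contMDiff_zeroT.comp hp) ((A.dual.contMDiff_sec θ).comp hp) contMDiff_id))
    (fun θ θ' γ => by
      rw [hl, hl, hl, ← map_add]
      exact congrArg (l γ.1 γ.2) (Prod.ext (add_zero 0).symm rfl))
    (fun f θ γ => by
      rw [hl, hl, ← smul_eq_mul, ← map_smul]
      exact congrArg (l γ.1 γ.2) (Prod.ext (smul_zero _).symm rfl))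
  obtain ⟨β, hβ, hβ'⟩ := B.exists_dual_lift hp
    (fun e γ => -K ⟨⟨γ.1, e γ.1⟩, S.flip.cov ⟨γ.1, e γ.1⟩ 0 γ.2⟩)
    (fun e => (hK.comp (S.flip.contMDiff_cov (a := fun γ : C.dual.Tot => ⟨γ.1, e γ.1⟩)
      ((B.contMDiff_sec e).comp hp) (A.dual.contMDiff_zeroT.comp hp) contMDiff_id)).neg)
    (fun e e' γ => by
      rw [hl, hl, hl, ← neg_add, ← map_add]
      exact congrArg (fun z => -l γ.1 γ.2 z) (Prod.ext rfl (add_zero 0).symm))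
    (fun f e γ => by
      rw [hl, hl, mul_neg, ← smul_eq_mul, ← map_smul]
      exact congrArg (fun z => -l γ.1 γ.2 z) (Prod.ext rfl (smul_zero _).symm))
  refine ⟨S.mkSec a β ha hβ, fun Ψ => ?_⟩
  obtain ⟨m, b, α, γ, rfl⟩ := S.exists_eq_cov Ψ
  obtain ⟨θ, rfl⟩ := A.dual.exists_sec_apply_eq m α
  obtain ⟨e, rfl⟩ := B.exists_sec_apply_eq m b
  rw [S.ellCstar_cov, S.secA_mkSec, S.secB_mkSec]
  refine (congrArg₂ (· - ·) (ha' θ ⟨m, γ⟩) (hβ' e ⟨m, γ⟩)).trans ?_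
  rw [sub_neg_eq_add, hl, hl, hl, ← map_add]
  exact congrArg (l m γ) (Prod.ext (zero_add _) (add_zero _))

/-- The functions on `D^{*B}` given by sections of `D^{*A}` are locally combinations of special
functions, with coefficients depending on the value of the section only. -/
theorem exists_expansion (S : LinearSplitting D) (m₀ : M) : ∃ (ι : Type) (_ : Fintype ι)
    (K : ι → C^∞⟮DB.dual.model, DB.dual.Tot; ℝ⟯) (H : ι → DA.dual.Tot → ℝ),
    (∀ k, D.IsSpecial (K k)) ∧ (∀ k, ContMDiff DA.dual.model 𝓘(ℝ, ℝ) ∞ (H k)) ∧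
    ∀ᶠ m in nhds m₀, ∀ (s : D.DualSec) (Ψ : DB.dual.Tot), Ψ.1.1 = m →
      D.ellCstar s Ψ = ∑ k, H k (s.toFun (D.flip.prCstar Ψ)) * K k Ψ := by
  obtain ⟨n, e, θ, χ, hχ, hA⟩ := A.exists_frame m₀
  obtain ⟨n', e', θ', χ', hχ', hB⟩ := B.exists_frame m₀
  have hpA : ContMDiff DA.dual.model A.model ∞ (fun Φ : DA.dual.Tot => Φ.1) :=
    DA.dual.contMDiff_proj
  -- In α(a) - β(b) expand a in a frame of A and b in a frame of B: α(a) = Σ θ_i(a) α(e_i) and β(b)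
  -- = Σ β(e'_j) θ'_j(b). The coefficients θ_i(a) and -β(e'_j) are functions of the covector (a, β,
  -- γ) alone.
  refine ⟨Fin n ⊕ Fin n', inferInstance,
    Sum.elim (fun i => DB.ell (S.linSec (e i))) (fun j => DB.dual.pull (B.lin (θ' j))),
    Sum.elim (fun i Φ => A.lin (θ i) Φ.1) (fun j Φ => -(Φ.2 (S.lift Φ.1 (e' j Φ.1.1)) : ℝ)),
    ?_, ?_, ?_⟩
  · rintro (i | j)
    · exact .ell _ _ (S.isLinearSec_linSec _)
    · exact .pull _
  · rintro (i | j)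
    · exact (A.lin (θ i)).contMDiff.comp hpA
    · exact fun Φ => (DA.contMDiffAt_eval (contMDiffAt_id (x := Φ))
        (S.contMDiff_lift hpA ((B.contMDiff_sec (e' j)).comp (A.contMDiff_proj.comp hpA)) Φ)).neg
  · filter_upwards [hχ, hχ'] with m h₁ h₂
    rintro s Ψ rfl
    obtain ⟨m, b, α, γ, rfl⟩ := S.exists_eq_cov Ψ
    have hA' := hA m (S.secA s ⟨m, γ⟩)
    have hB' := hB m b
    rw [h₁, one_smul] at hA'
    rw [h₂, one_smul] at hB'
    rw [Fintype.sum_sum_type, S.ellCstar_cov, S.flip.prCstar_cov, S.toFun_eq_cov, sub_eq_add_neg]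
    refine congrArg₂ (· + ·) ?_ ?_
    · have h3 := congrArg (show A.V m →L[ℝ] ℝ from α) hA'
      rw [map_sum] at h3
      refine h3.symm.trans (Finset.sum_congr rfl fun i _ => ?_)
      rw [map_smul]
      refine congrArg (A.lin (θ i) ⟨m, S.secA s ⟨m, γ⟩⟩ * ·) ?_
      exact (congrArg (fun f : A.dual.V m => (f (e i m) : ℝ))
        (S.flip.covB_cov ⟨m, b⟩ α γ)).symm
    · have h3 := congrArg (show B.V m →L[ℝ] ℝ from S.secB s ⟨m, γ⟩) hB'
      rw [map_sum] at h3
      refine (congrArg Neg.neg h3.symm).trans ?_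
      rw [← Finset.sum_neg_distrib]
      refine Finset.sum_congr rfl fun j _ => ?_
      rw [map_smul, smul_eq_mul, mul_comm, ← neg_mul]
      refine congrArg₂ (· * ·) (congrArg Neg.neg ?_) rfl
      exact (congrArg (fun f : B.dual.V m => (f (e' j m) : ℝ))
        (S.covB_cov ⟨m, S.secA s ⟨m, γ⟩⟩ (S.secB s ⟨m, γ⟩) γ)).symm

end LinearSplitting

end DualAlgebroid

theorem exists_forall_apply_eq {V : Type*} [NormedAddCommGroup V] [NormedSpace ℝ V]
    [FiniteDimensional ℝ V] (f : (V →L[ℝ] ℝ) →ₗ[ℝ] ℝ) : ∃ v : V, ∀ μ, μ v = f μ := by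
  obtain ⟨v, hv⟩ := (Module.evalEquiv ℝ V).surjective
    (f.comp (LinearMap.toContinuousLinearMap (𝕜 := ℝ) (E := V) (F' := ℝ)).toLinearMap)
  refine ⟨v, fun μ => ?_⟩
  have h := LinearMap.congr_fun hv (μ : V →ₗ[ℝ] ℝ)
  exact h.trans (congrArg f (ContinuousLinearMap.ext fun _ => rfl))

section DualAlgebroid

open SmoothVB LieAlgebroid

variable {EM HM : Type*} [NormedAddCommGroup EM] [NormedSpace ℝ EM] [FiniteDimensional ℝ EM]
  [TopologicalSpace HM] {I : ModelWithCorners ℝ EM HM} [I.Boundaryless] {M : Type*}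
  [TopologicalSpace M] [ChartedSpace HM M] [IsManifold I ∞ M] [T2Space M]
  {A B C : SmoothVB I M} {DA : SmoothVB A.model A.Tot} {DB : SmoothVB B.model B.Tot}
  {D : DoubleVB A B C DA DB} {LA : LieAlgebroid A} {LDB : LieAlgebroid DB}

namespace DoubleVB

theorem contMDiff_comp_prCstar {F : C.dual.Tot → ℝ} (hF : ContMDiff C.dual.model 𝓘(ℝ, ℝ) ∞ F) :
    ContMDiff DB.dual.model 𝓘(ℝ, ℝ) ∞ (fun Ψ => F (D.flip.prCstar Ψ)) :=
  hF.comp D.flip.contMDiff_prCstar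

theorem liePoisson_ellCstar_left {m : M} {ι : Type} [Fintype ι]
    {K : ι → C^∞⟮DB.dual.model, DB.dual.Tot; ℝ⟯} {H : ι → DA.dual.Tot → ℝ}
    (hH : ∀ k, ContMDiff DA.dual.model 𝓘(ℝ, ℝ) ∞ (H k))
    (hexp : ∀ᶠ m in nhds m, ∀ (s : D.DualSec) (Ψ : DB.dual.Tot), Ψ.1.1 = m →
      D.ellCstar s Ψ = ∑ k, H k (s.toFun (D.flip.prCstar Ψ)) * K k Ψ)
    (s : D.DualSec) (G : DB.dual.Tot → ℝ) {Ψ : DB.dual.Tot} (hΨ : Ψ.1.1 = m) :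
    liePoisson LDB (D.ellCstar s) G Ψ =
      ∑ k, (H k (s.toFun (D.flip.prCstar Ψ)) * liePoisson LDB (K k) G Ψ +
        K k Ψ * liePoisson LDB (fun Ψ' => H k (s.toFun (D.flip.prCstar Ψ'))) G Ψ) := by
  have hc : Filter.Tendsto (fun Ψ' : DB.dual.Tot => Ψ'.1.1) (nhds Ψ) (nhds m) := by
    rw [← hΨ]
    exact ((B.contMDiff_proj.comp DB.dual.contMDiff_proj).continuous).continuousAt
  have h1 : D.ellCstar s =ᶠ[nhds Ψ]
      fun Ψ' => ∑ k, H k (s.toFun (D.flip.prCstar Ψ')) * K k Ψ' := by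
    filter_upwards [hc.eventually hexp] with Ψ' h
    exact h s Ψ' rfl
  have hs : ∀ k, ContMDiff DB.dual.model 𝓘(ℝ, ℝ) ∞
      (fun Ψ' => H k (s.toFun (D.flip.prCstar Ψ'))) := fun k =>
    contMDiff_comp_prCstar ((hH k).comp s.smooth)
  rw [liePoisson_congr h1 (Filter.EventuallyEq.refl _ G)]
  refine (liePoisson_sum_left fun k _ => ((hs k).mul (K k).contMDiff).contMDiffAt).trans ?_
  exact Finset.sum_congr rfl fun k _ =>
    liePoisson_mul_left ((hs k) Ψ) ((K k).contMDiff Ψ)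

end DoubleVB

namespace IsVBAlgebroid

/-- By the Leibniz rule on the expansion in special functions, the derivatives of the coefficients
drop out and the remaining brackets are pulled back from C^*. The value thus depends on s(γ) only,
neither on the rest of s nor on the point over γ, which is what the definition of the anchor needs.
-/
theorem liePoisson_ellCstar_prCstar (h : IsVBAlgebroid D LA LDB) (S : LinearSplitting D)
    {F : C.dual.Tot → ℝ} (hF : ContMDiff C.dual.model 𝓘(ℝ, ℝ) ∞ F) {Ψ Ψ' : DB.dual.Tot}
    (hΨ : D.flip.prCstar Ψ = D.flip.prCstar Ψ') {s s' : D.DualSec}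
    (hs : s.toFun (D.flip.prCstar Ψ) = s'.toFun (D.flip.prCstar Ψ)) :
    liePoisson LDB (D.ellCstar s) (fun Ψ => F (D.flip.prCstar Ψ)) Ψ =
      liePoisson LDB (D.ellCstar s') (fun Ψ => F (D.flip.prCstar Ψ)) Ψ' := by
  obtain ⟨ι, hι, K, H, hK, hH, hexp⟩ := S.exists_expansion Ψ.1.1
  have hm : Ψ'.1.1 = Ψ.1.1 := congrArg (·.1) hΨ.symm
  rw [D.liePoisson_ellCstar_left hH hexp s _ rfl, D.liePoisson_ellCstar_left hH hexp s' _ hm]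
  refine Finset.sum_congr rfl fun k _ => ?_
  obtain ⟨G, hG⟩ := h.exists_liePoisson_special_prCstar (hK k) hF
  have h0 : ∀ (s : D.DualSec) (Ψ : DB.dual.Tot), liePoisson LDB
      (fun Ψ' => H k (s.toFun (D.flip.prCstar Ψ'))) (fun Ψ => F (D.flip.prCstar Ψ)) Ψ = 0 :=
    fun s => h.liePoisson_prCstar_prCstar ((hH k).comp s.smooth) hF
  rw [hG, hG, ← hΨ, hs, h0, h0, mul_zero, mul_zero]

theorem exists_liePoisson_ellCstar_prCstar (h : IsVBAlgebroid D LA LDB) (S : LinearSplitting D)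
    {F : C.dual.Tot → ℝ} (hF : ContMDiff C.dual.model 𝓘(ℝ, ℝ) ∞ F) (s : D.DualSec) :
    ∃ G : C.dual.Tot → ℝ, ∀ Ψ, liePoisson LDB (D.ellCstar s)
      (fun Ψ' => F (D.flip.prCstar Ψ')) Ψ = G (D.flip.prCstar Ψ) := by
  refine ⟨fun γ => liePoisson LDB (D.ellCstar s) (fun Ψ' => F (D.flip.prCstar Ψ'))
    ⟨B.zeroT γ.1, S.flip.cov (B.zeroT γ.1) 0 γ.2⟩, fun Ψ => ?_⟩
  exact h.liePoisson_ellCstar_prCstar S hF (S.flip.prCstar_cov (B.zeroT Ψ.1.1) 0 _).symm rfl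

theorem isFibLin_liePoisson_ellCstar_special (h : IsVBAlgebroid D LA LDB) (S : LinearSplitting D)
    (s : D.DualSec) {K : C^∞⟮DB.dual.model, DB.dual.Tot; ℝ⟯} (hK : D.IsSpecial K) (m : M) :
    S.IsFibLin m (liePoisson LDB (D.ellCstar s) K) := by
  obtain ⟨ι, hι, K', H, hK', hH, hexp⟩ := S.exists_expansion m
  choose G hG using fun k => h.exists_liePoisson_special_prCstar hK ((hH k).comp s.smooth)
  refine LinearSplitting.IsFibLin.congr ?_ fun Ψ hΨ =>
    D.liePoisson_ellCstar_left hH hexp s K hΨ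
  refine .sum _ fun k => .add
    (.basic_mul (F := fun γ => H k (s.toFun γ)) (fun _ => rfl)
      (S.isFibLin_liePoisson_special h (hK' k) hK)) ?_
  refine LinearSplitting.IsFibLin.congr
    (.basic_mul (G := fun Ψ => -G k (D.flip.prCstar Ψ)) (F := fun γ => -G k γ) (fun _ => rfl)
      (hK' k).isFibLin) fun Ψ _ => ?_
  rw [liePoisson_skew, mul_comm, ← hG k Ψ]
  rfl

/-- Expanding t leaves brackets of s with special functions, linear over C^* by the preceding lemma,
and brackets of s with coefficients, pulled back from C^* and multiplied by functions linear over
C^*. -/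
theorem isFibLin_liePoisson_ellCstar (h : IsVBAlgebroid D LA LDB) (S : LinearSplitting D)
    (s t : D.DualSec) (m : M) :
    S.IsFibLin m (liePoisson LDB (D.ellCstar t) (D.ellCstar s)) := by
  obtain ⟨ι, hι, K', H, hK', hH, hexp⟩ := S.exists_expansion m
  choose G hG using fun k => h.exists_liePoisson_ellCstar_prCstar S ((hH k).comp t.smooth) s
  refine LinearSplitting.IsFibLin.congr ?_ fun Ψ hΨ =>
    D.liePoisson_ellCstar_left hH hexp t _ hΨ
  refine .sum _ fun k => .add ?_ ?_
  · refine .basic_mul (F := fun γ => H k (t.toFun γ)) (fun _ => rfl) ?_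
    exact (h.isFibLin_liePoisson_ellCstar_special S s (hK' k) m).neg.congr
      fun Ψ _ => liePoisson_skew _ _ _
  · refine LinearSplitting.IsFibLin.congr
      (.basic_mul (G := fun Ψ => -G k (D.flip.prCstar Ψ)) (F := fun γ => -G k γ) (fun _ => rfl)
        (hK' k).isFibLin) fun Ψ _ => ?_
    rw [liePoisson_skew, mul_comm, ← hG k Ψ]
    rfl

/-- The bracket of two such functions is smooth and linear over C^*, so it comes from a section and
the choice in `dualBracket` is met. -/
theorem ellCstar_dualBracket (h : IsVBAlgebroid D LA LDB) (S : LinearSplitting D)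
    (s t : D.DualSec) (Ψ : DB.dual.Tot) : D.ellCstar (D.dualBracket LDB s t) Ψ =
      liePoisson LDB (D.ellCstar s) (D.ellCstar t) Ψ :=
  Classical.epsilon_spec (p := fun u : D.DualSec =>
    ∀ Ψ, D.ellCstar u Ψ = liePoisson LDB (D.ellCstar s) (D.ellCstar t) Ψ)
    (S.exists_ellCstar_eq (contMDiff_liePoisson (S.contMDiff_ellCstar s) (S.contMDiff_ellCstar t))
      (h.isFibLin_liePoisson_ellCstar S t s)) Ψ

theorem diffAt_dualAnchor (h : IsVBAlgebroid D LA LDB) (S : LinearSplitting D) {s : D.DualSec}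
    (F : C^∞⟮C.dual.model, C.dual.Tot; ℝ⟯) (Ψ : DB.dual.Tot) :
    diffAt C.dual.model F (D.flip.prCstar Ψ)
        (D.dualAnchor LDB (D.flip.prCstar Ψ) (s.toFun (D.flip.prCstar Ψ))) =
      liePoisson LDB (D.ellCstar s) (fun Ψ' => F (D.flip.prCstar Ψ')) Ψ := by
  set γ := D.flip.prCstar Ψ with hγ
  -- The anchor is the tangent vector representing the functional that pulls a covector at γ back to
  -- Ψ and contracts it with the bivector and the differential of the function of s; it exists by
  -- finite-dimensional reflexivity.
  obtain ⟨v, hv⟩ := exists_forall_apply_eq (V := EM × (C.F →L[ℝ] ℝ))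
    ((LDB.bivector Ψ (diffAt DB.dual.model (D.ellCstar s) Ψ)).comp
      (show (TangentSpace C.dual.model γ →L[ℝ] ℝ) →ₗ[ℝ] (TangentSpace DB.dual.model Ψ →L[ℝ] ℝ) from
      { toFun := fun μ => μ.comp (mfderiv DB.dual.model C.dual.model D.flip.prCstar Ψ)
        map_add' := fun _ _ => rfl
        map_smul' := fun _ _ => rfl }))
  have h1 : ∃ v : TangentSpace C.dual.model γ, ∀ s' : D.DualSec, s'.toFun γ = s.toFun γ →
      ∀ (F : C^∞⟮C.dual.model, C.dual.Tot; ℝ⟯) (Ψ : DB.dual.Tot), D.flip.prCstar Ψ = γ →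
      liePoisson LDB (D.ellCstar s') (fun Ψ' => F (D.flip.prCstar Ψ')) Ψ =
        diffAt C.dual.model F γ v := by
    refine ⟨v, fun s' hs' F Ψ' hΨ' => ?_⟩
    rw [← h.liePoisson_ellCstar_prCstar S F.contMDiff hΨ'.symm (s := s) (s' := s')
      (by rw [← hγ, hs'])]
    refine Eq.trans ?_ (hv (diffAt C.dual.model F γ)).symm
    rw [liePoisson_eq_bivector]
    exact congrArg (LDB.bivector Ψ (diffAt DB.dual.model (D.ellCstar s) Ψ))
      (diffAt_comp (F.contMDiff _) (D.flip.contMDiff_prCstar Ψ))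
  exact (Classical.epsilon_spec h1 s rfl F Ψ hγ.symm).symm

theorem dualAct_prCstar (h : IsVBAlgebroid D LA LDB) (S : LinearSplitting D) (s : D.DualSec)
    (F : C^∞⟮C.dual.model, C.dual.Tot; ℝ⟯) (Ψ : DB.dual.Tot) :
    D.dualAct LDB s F (D.flip.prCstar Ψ) =
      liePoisson LDB (D.ellCstar s) (fun Ψ' => F (D.flip.prCstar Ψ')) Ψ :=
  h.diffAt_dualAnchor S F Ψ

theorem contMDiff_dualAct (h : IsVBAlgebroid D LA LDB) (S : LinearSplitting D) (s : D.DualSec)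
    (F : C^∞⟮C.dual.model, C.dual.Tot; ℝ⟯) :
    ContMDiff C.dual.model 𝓘(ℝ, ℝ) ∞ (D.dualAct LDB s F) := by
  have hp : ContMDiff C.dual.model I ∞ (fun γ : C.dual.Tot => γ.1) := C.dual.contMDiff_proj
  have hz := S.flip.contMDiff_cov (a := fun γ : C.dual.Tot => B.zeroT γ.1)
    (β := fun _ => 0) (γ := fun γ => γ.2)
    (B.contMDiff_zeroT.comp hp) (A.dual.contMDiff_zeroT.comp hp) contMDiff_id
  refine ((contMDiff_liePoisson (L := LDB) (S.contMDiff_ellCstar s)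
    (D.contMDiff_comp_prCstar F.contMDiff)).comp hz).congr fun γ => ?_
  refine Eq.trans ?_ (h.dualAct_prCstar S s F _)
  exact congrArg (D.dualAct LDB s F) (S.flip.prCstar_cov (B.zeroT γ.1) 0 γ.2).symm

/-- The derivation of `C^∞(C^*)` defined by a section of `D^{*A} → C^*`. -/
def act (h : IsVBAlgebroid D LA LDB) (S : LinearSplitting D) (s : D.DualSec)
    (F : C^∞⟮C.dual.model, C.dual.Tot; ℝ⟯) : C^∞⟮C.dual.model, C.dual.Tot; ℝ⟯ :=
  ⟨D.dualAct LDB s F, h.contMDiff_dualAct S s F⟩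

variable (h : IsVBAlgebroid D LA LDB) (S : LinearSplitting D)

theorem act_prCstar (s : D.DualSec) (F : C^∞⟮C.dual.model, C.dual.Tot; ℝ⟯) (Ψ : DB.dual.Tot) :
    h.act S s F (D.flip.prCstar Ψ) =
      liePoisson LDB (D.ellCstar s) (fun Ψ' => F (D.flip.prCstar Ψ')) Ψ :=
  h.dualAct_prCstar S s F Ψ

theorem act_mul (s : D.DualSec) (F G : C^∞⟮C.dual.model, C.dual.Tot; ℝ⟯) :
    h.act S s (F * G) = F * h.act S s G + G * h.act S s F := by
  ext γ
  exact DFunLike.congr_fun (diffAt_mul (F.contMDiff γ) (G.contMDiff γ)) _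

theorem act_add (s : D.DualSec) (F G : C^∞⟮C.dual.model, C.dual.Tot; ℝ⟯) :
    h.act S s (F + G) = h.act S s F + h.act S s G := by
  ext γ
  exact DFunLike.congr_fun (diffAt_add (F.contMDiff γ) (G.contMDiff γ)) _

theorem exists_prCstar_eq (S : LinearSplitting D) (γ : C.dual.Tot) :
    ∃ Ψ : DB.dual.Tot, D.flip.prCstar Ψ = γ :=
  ⟨⟨B.zeroT γ.1, S.flip.cov (B.zeroT γ.1) 0 γ.2⟩, S.flip.prCstar_cov _ _ _⟩

variable {h S} {u s t : D.DualSec} {F G : C^∞⟮C.dual.model, C.dual.Tot; ℝ⟯}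

/-- `DualSec` carries no module structure, so the relation u = Fs + Gt is stated for the associated
functions. The Leibniz terms in F and G vanish since pullbacks from C^* commute. -/
theorem act_comb
    (hu : ∀ Ψ, D.ellCstar u Ψ = F (D.flip.prCstar Ψ) * D.ellCstar s Ψ +
      G (D.flip.prCstar Ψ) * D.ellCstar t Ψ) (K : C^∞⟮C.dual.model, C.dual.Tot; ℝ⟯) :
    h.act S u K = F * h.act S s K + G * h.act S t K := by
  ext γ
  obtain ⟨Ψ, rfl⟩ := exists_prCstar_eq S γ
  have hF := D.contMDiff_comp_prCstar F.contMDiff Ψ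
  have hG := D.contMDiff_comp_prCstar G.contMDiff Ψ
  have hs := S.contMDiff_ellCstar s Ψ
  have ht := S.contMDiff_ellCstar t Ψ
  refine (h.act_prCstar S u K Ψ).trans ?_
  rw [show D.ellCstar u = (fun Ψ => F (D.flip.prCstar Ψ)) * D.ellCstar s +
    (fun Ψ => G (D.flip.prCstar Ψ)) * D.ellCstar t from funext hu,
    liePoisson_add_left (hF.mul hs) (hG.mul ht), liePoisson_mul_left hF hs,
    liePoisson_mul_left hG ht, h.liePoisson_prCstar_prCstar F.contMDiff K.contMDiff,
    h.liePoisson_prCstar_prCstar G.contMDiff K.contMDiff, mul_zero, mul_zero, add_zero, add_zero,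
    ← h.act_prCstar S, ← h.act_prCstar S]
  rfl

theorem bracket_comb
    (hu : ∀ Ψ, D.ellCstar u Ψ = F (D.flip.prCstar Ψ) * D.ellCstar s Ψ +
      G (D.flip.prCstar Ψ) * D.ellCstar t Ψ) (a : D.DualSec) (Ψ : DB.dual.Tot) :
    D.ellCstar (D.dualBracket LDB a u) Ψ =
      F (D.flip.prCstar Ψ) * D.ellCstar (D.dualBracket LDB a s) Ψ +
      h.act S a F (D.flip.prCstar Ψ) * D.ellCstar s Ψ +
      (G (D.flip.prCstar Ψ) * D.ellCstar (D.dualBracket LDB a t) Ψ +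
      h.act S a G (D.flip.prCstar Ψ) * D.ellCstar t Ψ) := by
  have hF := D.contMDiff_comp_prCstar F.contMDiff Ψ
  have hG := D.contMDiff_comp_prCstar G.contMDiff Ψ
  have hs := S.contMDiff_ellCstar s Ψ
  have ht := S.contMDiff_ellCstar t Ψ
  rw [h.ellCstar_dualBracket S, h.ellCstar_dualBracket S, h.ellCstar_dualBracket S,
    show D.ellCstar u = (fun Ψ => F (D.flip.prCstar Ψ)) * D.ellCstar s +
    (fun Ψ => G (D.flip.prCstar Ψ)) * D.ellCstar t from funext hu,
    liePoisson_add_right (hF.mul hs) (hG.mul ht), liePoisson_mul_right hF hs,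
    liePoisson_mul_right hG ht, h.act_prCstar S, h.act_prCstar S]
  ring

theorem bracket_skew_ellCstar (h : IsVBAlgebroid D LA LDB) (S : LinearSplitting D)
    (s t : D.DualSec) (Ψ : DB.dual.Tot) :
    D.ellCstar (D.dualBracket LDB s t) Ψ = -D.ellCstar (D.dualBracket LDB t s) Ψ := by
  rw [h.ellCstar_dualBracket S, h.ellCstar_dualBracket S, liePoisson_skew]

/-- This is the Jacobi identity on D^{*B} for two functions linear over C^* and one pulled back from
C^*. -/
theorem act_dualBracket (s t : D.DualSec) (F : C^∞⟮C.dual.model, C.dual.Tot; ℝ⟯) :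
    h.act S (D.dualBracket LDB s t) F =
      h.act S s (h.act S t F) - h.act S t (h.act S s F) := by
  ext γ
  obtain ⟨Ψ, rfl⟩ := exists_prCstar_eq S γ
  have h1 : ∀ s, liePoisson LDB (D.ellCstar s) (fun Ψ' => F (D.flip.prCstar Ψ')) =
      fun Ψ => h.act S s F (D.flip.prCstar Ψ) := fun s =>
    funext fun Ψ => (h.act_prCstar S s F Ψ).symm
  refine (h.act_prCstar S _ F Ψ).trans ?_
  rw [show D.ellCstar (D.dualBracket LDB s t) = liePoisson LDB (D.ellCstar s) (D.ellCstar t) from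
    funext (h.ellCstar_dualBracket S s t), liePoisson_jacobi (S.contMDiff_ellCstar s)
    (S.contMDiff_ellCstar t) (D.contMDiff_comp_prCstar F.contMDiff), h1, h1, ← h.act_prCstar S,
    ← h.act_prCstar S]
  rfl

end IsVBAlgebroid

end DualAlgebroid

/-! ### The algebra of Lie bialgebroids -/

section Bialgebroid

variable {R S T : Type*} [CommRing R]

/-- The identities of a Lie algebroid with section space `S` over the functions `R`, tested against
the sections `T` of the dual. -/
structure IsDualAlgebroid (pair : S → T → R) (br : S → S → S) (act : S → R → R) : Prop where
  act_mul : ∀ s f g, act s (f * g) = f * act s g + g * act s f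
  act_add : ∀ s f g, act s (f + g) = act s f + act s g
  act_comb : ∀ u s t f g, (∀ τ, pair u τ = f * pair s τ + g * pair t τ) →
    ∀ k, act u k = f * act s k + g * act t k
  br_comb : ∀ u s t f g, (∀ τ, pair u τ = f * pair s τ + g * pair t τ) →
    ∀ a τ, pair (br a u) τ = f * pair (br a s) τ + act a f * pair s τ +
      (g * pair (br a t) τ + act a g * pair t τ)
  br_skew : ∀ s t τ, pair (br s t) τ = -pair (br t s) τ
  act_br : ∀ s t f, act (br s t) f = act s (act t f) - act t (act s f)

/-- The differential of a Lie algebroid with section space `T` on sections of the dual. -/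
def dualDiff (pair : S → T → R) (brT : T → T → T) (actT : T → R → R) (X : S) (α β : T) : R :=
  actT α (pair X β) - actT β (pair X α) - pair X (brT α β)

/-- A Lie bialgebroid, with the differential `d` of functions, with Lie derivatives, and with enough
sections. -/
structure IsBialgebroid (pair : S → T → R) (brS : S → S → S) (actS : S → R → R)
    (brT : T → T → T) (actT : T → R → R) (d : R → T) (lie : S → T → T) : Prop where
  left : IsDualAlgebroid pair brS actS
  right : IsDualAlgebroid (fun t s => pair s t) brT actT
  pair_d : ∀ X f, pair X (d f) = actS X f
  pair_lie : ∀ X Y α, pair Y (lie X α) = actS X (pair Y α) - pair (brS X Y) α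
  exists_smul : ∀ f X, ∃ Z, ∀ τ, pair Z τ = f * pair X τ
  -- Here the rank matters: for a line bundle the premise holds for every linear w.
  separating : ∀ w : T → R, (∀ Y α β, pair Y β * w α = pair Y α * w β) → ∀ α, w α = 0
  nondegenerate : ∀ r, (∀ X α, pair X α * r = 0) → r = 0
  compat : ∀ X Y α β, dualDiff pair brT actT (brS X Y) α β =
    -(actS Y (dualDiff pair brT actT X α β) - dualDiff pair brT actT X (lie Y α) β -
      dualDiff pair brT actT X α (lie Y β)) +
    (actS X (dualDiff pair brT actT Y α β) - dualDiff pair brT actT Y (lie X α) β -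
      dualDiff pair brT actT Y α (lie X β))

namespace IsDualAlgebroid

variable {pair : S → T → R} {br : S → S → S} {act : S → R → R}

theorem act_smul (h : IsDualAlgebroid pair br act) {u s : S} {f : R} (hu : ∀ τ, pair u τ = f * pair s τ) (k : R) :
    act u k = f * act s k := by
  have := h.act_comb u s s f 0 (fun τ => by rw [hu]; ring) k
  rw [this]; ring

theorem act_congr (h : IsDualAlgebroid pair br act) {u s : S} (hu : ∀ τ, pair u τ = pair s τ) (k : R) : act u k = act s k := by
  have := h.act_smul (f := 1) (u := u) (s := s) (fun τ => by rw [hu]; ring) k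
  rw [this]; ring

theorem act_zero (h : IsDualAlgebroid pair br act) (s : S) : act s 0 = 0 := by
  have := h.act_add s 0 0
  rw [add_zero] at this
  exact left_eq_add.1 this

theorem act_neg (h : IsDualAlgebroid pair br act) (s : S) (f : R) : act s (-f) = -act s f := by
  have := h.act_add s f (-f)
  rw [add_neg_cancel, h.act_zero] at this
  exact (neg_eq_of_add_eq_zero_right this.symm).symm

theorem act_sub (h : IsDualAlgebroid pair br act) (s : S) (f g : R) : act s (f - g) = act s f - act s g := by
  rw [sub_eq_add_neg, h.act_add, h.act_neg, ← sub_eq_add_neg]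

theorem br_smul (h : IsDualAlgebroid pair br act) {u s : S} {f : R} (hu : ∀ τ, pair u τ = f * pair s τ) (a : S) (τ : T) :
    pair (br a u) τ = f * pair (br a s) τ + act a f * pair s τ := by
  have := h.br_comb u s s f 0 (fun τ => by rw [hu]; ring) a τ
  rw [this, h.act_zero]; ring

theorem smul_br (h : IsDualAlgebroid pair br act) {u s : S} {f : R} (hu : ∀ τ, pair u τ = f * pair s τ) (a : S) (τ : T) :
    pair (br u a) τ = f * pair (br s a) τ - act a f * pair s τ := by
  rw [h.br_skew, h.br_smul hu, h.br_skew a s]; ring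

end IsDualAlgebroid

section Right

variable {pair : S → T → R} {brT : T → T → T} {actT : T → R → R}

theorem dualDiff_skew (h : IsDualAlgebroid (fun t s => pair s t) brT actT)
    (X : S) (α β : T) :
    dualDiff pair brT actT X α β = -dualDiff pair brT actT X β α := by
  have h1 : pair X (brT α β) = -pair X (brT β α) := h.br_skew α β X
  rw [dualDiff, dualDiff, h1]; ring

theorem dualDiff_comb (h : IsDualAlgebroid (fun t s => pair s t) brT actT)
    {u s t : T} {f g : R}
    (hu : ∀ X, pair X u = f * pair X s + g * pair X t) (X : S) (α : T) :
    dualDiff pair brT actT X α u =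
      f * dualDiff pair brT actT X α s + g * dualDiff pair brT actT X α t := by
  have h1 : pair X (brT α u) = _ := h.br_comb u s t f g hu α X
  rw [dualDiff, dualDiff, dualDiff, h1, hu, h.act_comb u s t f g hu, h.act_add, h.act_mul,
    h.act_mul]
  ring

theorem dualDiff_smul (h : IsDualAlgebroid (fun t s => pair s t) brT actT)
    {Z X : S} {f : R} (hZ : ∀ τ, pair Z τ = f * pair X τ) (α β : T) :
    dualDiff pair brT actT Z α β =
      f * dualDiff pair brT actT X α β + actT α f * pair X β - actT β f * pair X α := by
  rw [dualDiff, dualDiff, hZ, hZ, hZ, h.act_mul, h.act_mul]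
  ring

theorem dualDiff_comb_left (h : IsDualAlgebroid (fun t s => pair s t) brT actT)
    {Z X Y : S} {f g : R} (hZ : ∀ τ, pair Z τ = f * pair X τ + g * pair Y τ)
    (α β : T) : dualDiff pair brT actT Z α β =
      f * dualDiff pair brT actT X α β + actT α f * pair X β - actT β f * pair X α +
      (g * dualDiff pair brT actT Y α β + actT α g * pair Y β - actT β g * pair Y α) := by
  rw [dualDiff, dualDiff, dualDiff, hZ, hZ, hZ, h.act_add, h.act_add, h.act_mul, h.act_mul,
    h.act_mul, h.act_mul]
  ring

end Right

namespace IsBialgebroid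

variable {pair : S → T → R} {brS : S → S → S} {actS : S → R → R}
  {brT : T → T → T} {actT : T → R → R} {d : R → T} {lie : S → T → T}

/-- Put fY for Y in the compatibility condition and subtract f times the condition for Y. The
remainder is ⟨Y, β⟩ w(α) = ⟨Y, α⟩ w(β), where w(α) is the defect of the asserted identity up to
sign, and `separating` gives w = 0. -/
theorem act_lie (h : IsBialgebroid pair brS actS brT actT d lie)
    (X : S) (α : T) (f : R) :
    actS X (actT α f) - actT (lie X α) f = actT (d f) (pair X α) + pair X (brT α (d f)) := by
  have key : ∀ Y α β,
      pair Y β * (actT α (actS X f) - dualDiff pair brT actT X α (d f) - actS X (actT α f) +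
        actT (lie X α) f) =
      pair Y α * (actT β (actS X f) - dualDiff pair brT actT X β (d f) - actS X (actT β f) +
        actT (lie X β) f) := fun Y α β => by
    obtain ⟨Z, hZ⟩ := h.exists_smul f Y
    have hl : ∀ α V, pair V (lie Z α) = f * pair V (lie Y α) + pair Y α * pair V (d f) :=
      fun α V => by
      rw [h.pair_lie, h.pair_lie, h.left.act_smul hZ, h.left.smul_br hZ, h.pair_d]
      ring
    have hb : ∀ τ, pair (brS X Z) τ = f * pair (brS X Y) τ + actS X f * pair Y τ :=
      fun τ => h.left.br_smul hZ X τ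
    have h1 := h.compat X Z α β
    have h2 := h.compat X Y α β
    rw [dualDiff_comb_left h.right hb, h.left.act_smul hZ, dualDiff_smul h.right hZ,
      dualDiff_smul h.right hZ, dualDiff_smul h.right hZ, dualDiff_comb h.right (hl β),
      dualDiff_skew h.right X (lie Z α) β, dualDiff_comb h.right (hl α), h.left.act_sub,
      h.left.act_add, h.left.act_mul, h.left.act_mul, h.left.act_mul, h.pair_lie, h.pair_lie, h2,
      dualDiff_skew h.right X (lie Y α) β] at h1
    linear_combination h1
  have h3 := h.separating _ (key) α
  rw [dualDiff, h.pair_d] at h3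
  linear_combination -h3

/-- Put gX for X in `act_lie` and subtract g times the identity for X: what remains is ⟨X, α⟩ times
the sum of the two terms, and X, α are arbitrary. -/
theorem act_d_skew (h : IsBialgebroid pair brS actS brT actT d lie)
    (f g : R) : actT (d f) g = -actT (d g) f := by
  rw [← sub_eq_zero]
  refine h.nondegenerate _ fun X α => ?_
  obtain ⟨Z, hZ⟩ := h.exists_smul g X
  have hl : ∀ V, pair V (lie Z α) = g * pair V (lie X α) + pair X α * pair V (d g) := fun V => by
    rw [h.pair_lie, h.pair_lie, h.left.act_smul hZ, h.left.smul_br hZ, h.pair_d]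
    ring
  have h1 := h.act_lie X α f
  have h2 := h.act_lie Z α f
  rw [h.left.act_smul hZ, h.right.act_comb _ _ _ _ _ hl, hZ, hZ, h.right.act_mul] at h2
  linear_combination g * h1 - h2

/-- This says [dg, df]_* = d{g, f}. It is `act_lie` for α = dg, where L_X dg = d(Xg) because the
anchor preserves brackets, followed by skew-symmetry. -/
theorem pair_br_d (h : IsBialgebroid pair brS actS brT actT d lie)
    (X : S) (f g : R) : pair X (brT (d g) (d f)) = actS X (actT (d g) f) := by
  have hl : ∀ V, pair V (lie X (d g)) = pair V (d (actS X g)) := fun V => by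
    rw [h.pair_lie, h.pair_d, h.pair_d, h.pair_d, h.left.act_br]
    ring
  have h1 := h.act_lie X (d g) f
  rw [h.right.act_congr hl, h.pair_d] at h1
  linear_combination -h1 - h.act_d_skew (actS X g) f

/-- The function {f, g} has differential [df, dg]_*, and the anchor of T preserves brackets. -/
theorem jacobi (h : IsBialgebroid pair brS actS brT actT d lie)
    (f g k : R) : actT (d f) (actT (d g) k) =
    actT (d (actT (d f) g)) k + actT (d g) (actT (d f) k) := by
  have h1 : ∀ X, pair X (d (actT (d f) g)) = pair X (brT (d f) (d g)) := fun X => by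
    rw [h.pair_br_d, h.pair_d]
  rw [h.right.act_congr h1, h.right.act_br]
  ring

end IsBialgebroid

end Bialgebroid

/-! ### Tensorial maps on lifts of a map to the base -/

namespace SmoothVB

section LiftDuality

variable {EN HN : Type*} [NormedAddCommGroup EN] [NormedSpace ℝ EN] [FiniteDimensional ℝ EN]
  [TopologicalSpace HN] {I : ModelWithCorners ℝ EN HN} {N : Type*} [TopologicalSpace N]
  [ChartedSpace HN N] [IsManifold I ∞ N] [T2Space N]
  {EX HX : Type*} [NormedAddCommGroup EX] [NormedSpace ℝ EX] [TopologicalSpace HX]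
  {J : ModelWithCorners ℝ EX HX} {X : Type*} [TopologicalSpace X] [ChartedSpace HX X]

/-- The smooth lifts of `p : X → N` to a vector bundle over `N`. -/
abbrev Lift (J : ModelWithCorners ℝ EX HX) (E : SmoothVB I N) (p : X → N) :=
  {ε : ∀ x, E.V (p x) // ContMDiff J E.model ∞ (fun x => (⟨p x, ε x⟩ : E.Tot))}

/-- `Λ` is linear over the smooth functions on `X`. -/
def IsTensorial {E : SmoothVB I N} {p : X → N} (Λ : Lift J E p → C^∞⟮J, X; ℝ⟯) : Prop :=
  ∀ (u s t : Lift J E p) (f g : C^∞⟮J, X; ℝ⟯),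
    (∀ x, u.1 x = f x • s.1 x + g x • t.1 x) → Λ u = f * Λ s + g * Λ t

variable (E : SmoothVB I N) {p : X → N}

/-- The lift given by a section. -/
def liftSec (hp : ContMDiff J I ∞ p) (e : E.Sec) : Lift J E p :=
  ⟨fun x => e (p x), (E.contMDiff_sec e).comp hp⟩

variable {E}

theorem IsTensorial.sum {Λ : Lift J E p → C^∞⟮J, X; ℝ⟯} (hΛ : IsTensorial Λ)
    (hp : ContMDiff J I ∞ p) {ι : Type*} (T : Finset ι) (s : ι → Lift J E p)
    (f : ι → C^∞⟮J, X; ℝ⟯) (u : Lift J E p) (hu : ∀ x, u.1 x = ∑ i ∈ T, f i x • (s i).1 x) :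
    Λ u = ∑ i ∈ T, f i * Λ (s i) := by
  classical
  induction T using Finset.induction_on generalizing u with
  | empty =>
    have h := hΛ u u u 0 0 fun x => by
      rw [hu]
      simp
    rw [h]
    simp
  | insert i T hi ih =>
    have hw : ContMDiff J E.model ∞ (fun x => (⟨p x, ∑ i ∈ T, f i x • (s i).1 x⟩ : E.Tot)) :=
      fun x => E.contMDiffAt_sum_smul T (v := fun i => (s i).1) (hp x)
        (fun i _ => (f i).contMDiff x) fun i _ => (s i).2 x
    have h := hΛ u (s i) ⟨_, hw⟩ (f i) 1 fun x => by
      rw [hu, Finset.sum_insert hi]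
      exact congrArg _ (one_smul ℝ _).symm
    rw [h, ih ⟨_, hw⟩ fun _ => rfl, Finset.sum_insert hi, one_mul]

/-- A tensorial map from the lifts of `p` to a bundle to the functions on `X` is given by a lift of
`p` to the dual bundle. -/
theorem IsTensorial.exists_dual_lift {Λ : Lift J E p → C^∞⟮J, X; ℝ⟯} (hΛ : IsTensorial Λ)
    (hp : ContMDiff J I ∞ p) :
    ∃ φ : Lift J E.dual p, ∀ (ε : Lift J E p) x, (φ.1 x (ε.1 x) : ℝ) = Λ ε x := by
  obtain ⟨φ, hφ, h⟩ := E.exists_dual_lift hp (fun e x => Λ (E.liftSec hp e) x)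
    (fun e => (Λ _).contMDiff)
    (fun e e' x => by
      rw [hΛ _ (E.liftSec hp e) (E.liftSec hp e') 1 1 fun x => ?_]
      · exact congrArg₂ (fun a b : ℝ => a + b) (one_mul _) (one_mul _)
      · exact (congrArg₂ (fun a b : E.V (p x) => a + b) (one_smul ℝ (e (p x)))
          (one_smul ℝ (e' (p x)))).symm)
    (fun f e x => by
      rw [hΛ _ (E.liftSec hp e) (E.liftSec hp e) ⟨fun x => f (p x), f.contMDiff.comp hp⟩ 0
        fun x => ?_]
      · exact (congrArg _ (zero_mul (Λ _ x))).trans (add_zero _)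
      · exact ((congrArg _ (zero_smul ℝ _)).trans (add_zero _)).symm)
  refine ⟨⟨φ, hφ⟩, fun ε x => ?_⟩
  obtain ⟨n, e, θ, χ, hχ, hf⟩ := E.exists_frame (p x)
  have hc : ∀ i, ContMDiff J 𝓘(ℝ, ℝ) ∞ (fun x => (θ i (p x) (ε.1 x) : ℝ)) := fun i =>
    (E.lin (θ i)).contMDiff.comp ε.2
  have hχp : ContMDiff J 𝓘(ℝ, ℝ) ∞ (fun x => χ (p x)) := χ.contMDiff.comp hp
  have hu : ContMDiff J E.model ∞ (fun x => (⟨p x, χ (p x) • ε.1 x⟩ : E.Tot)) :=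
    fun x => E.contMDiffAt_smul (v := ε.1) (hχp x) (ε.2 x)
  -- The lift φ was built from sections of E only. The frame expresses χε through lifts of sections
  -- with coefficients on X, and χ = 1 at the point considered.
  have h1 := hΛ.sum hp Finset.univ (fun i => E.liftSec hp (e i)) (fun i => ⟨_, hc i⟩) ⟨_, hu⟩
    fun x => (hf (p x) (ε.1 x)).symm
  have h2 := hΛ ⟨_, hu⟩ ε ε ⟨_, hχp⟩ 0 fun x =>
    ((congrArg _ (zero_smul ℝ _)).trans (add_zero _)).symm
  have h3 : Λ ⟨_, hu⟩ x = Λ ε x := by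
    rw [h2]
    refine (congrArg _ (zero_mul (Λ _ x))).trans ((add_zero _).trans ?_)
    exact (congrArg (· * Λ ε x) hχ.self_of_nhds).trans (one_mul _)
  rw [← h3, h1]
  refine Eq.trans ?_ (map_sum (ContMDiffMap.evalRingHom x : C^∞⟮J, X; ℝ⟯ →+* ℝ) _ _).symm
  have h4 := hf (p x) (ε.1 x)
  rw [hχ.self_of_nhds, one_smul] at h4
  refine (congrArg (show E.V (p x) →L[ℝ] ℝ from φ x) h4.symm).trans ?_
  rw [map_sum]
  refine Finset.sum_congr rfl fun i _ => ?_
  rw [map_smul]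
  exact congrArg _ (h (e i) x)

/-- A tensorial map from the lifts of `p` to a dual bundle to the functions on `X` is given by a
lift of `p` to the bundle. -/
theorem IsTensorial.exists_lift {Λ : Lift J E.dual p → C^∞⟮J, X; ℝ⟯} (hΛ : IsTensorial Λ)
    (hp : ContMDiff J I ∞ p) :
    ∃ v : Lift J E p, ∀ (φ : Lift J E.dual p) x, (φ.1 x (v.1 x) : ℝ) = Λ φ x := by
  obtain ⟨φ, h⟩ := hΛ.exists_dual_lift hp
  obtain ⟨v, hv, h'⟩ := E.exists_lift hp (fun θ x => (φ.1 x (θ (p x)) : ℝ))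
    (fun θ x => E.dual.contMDiffAt_eval (φ := φ.1) (φ.2 x) ((E.dual.liftSec hp θ).2 x))
    (fun θ θ' x => (show E.dual.V (p x) →L[ℝ] ℝ from φ.1 x).map_add _ _)
    (fun f θ x => (show E.dual.V (p x) →L[ℝ] ℝ from φ.1 x).map_smul _ _)
  refine ⟨⟨v, hv⟩, fun ψ x => ?_⟩
  obtain ⟨θ, hθ⟩ := E.dual.exists_sec_apply_eq (p x) (ψ.1 x)
  rw [← h, ← hθ]
  exact h' θ x

end LiftDuality

end SmoothVB

/-! ### The duality between sections of D^{*A} and D^{*B} -/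

section Bialgebroid

open SmoothVB

variable {EM HM : Type*} [NormedAddCommGroup EM] [NormedSpace ℝ EM] [FiniteDimensional ℝ EM]
  [TopologicalSpace HM] {I : ModelWithCorners ℝ EM HM} [I.Boundaryless] {M : Type*}
  [TopologicalSpace M] [ChartedSpace HM M] [IsManifold I ∞ M] [T2Space M]
  {A B C : SmoothVB I M} {DA : SmoothVB A.model A.Tot} {DB : SmoothVB B.model B.Tot}
  {D : DoubleVB A B C DA DB}

namespace LinearSplitting

variable (S : LinearSplitting D)

theorem exists_dualSec_apply_eq (S : LinearSplitting D) (Φ : DA.dual.Tot) :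
    ∃ s : D.DualSec, s.toFun (D.prCstar Φ) = Φ := by
  obtain ⟨a, β, h⟩ := S.exists_cov (Φ := Φ) rfl
  obtain ⟨a', ha⟩ := A.exists_sec_apply_eq _ a
  obtain ⟨β', hβ⟩ := B.dual.exists_sec_apply_eq _ β
  have hp : ContMDiff C.dual.model I ∞ (fun γ : C.dual.Tot => γ.1) := C.dual.contMDiff_proj
  refine ⟨S.mkSec (fun γ => a' γ.1) (fun γ => β' γ.1) (A.liftSec hp a').2 (B.dual.liftSec hp β').2,
    Eq.trans ?_ h.symm⟩
  rw [← ha, ← hβ]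
  rfl

theorem ellCstar_eq_neg_pairing (S : LinearSplitting D) (u : D.DualSec) (Ψ : DB.dual.Tot) :
    D.ellCstar u Ψ = -D.pairing (u.toFun (D.flip.prCstar Ψ)) Ψ := by
  obtain ⟨m, b, α, γ, rfl⟩ := S.exists_eq_cov Ψ
  rw [S.ellCstar_cov, S.flip.prCstar_cov, S.toFun_eq_cov]
  refine Eq.trans ?_ (congrArg Neg.neg (S.pairing_cov _ _ _ _ _)).symm
  rw [neg_sub]

theorem _root_.DoubleVB.flip_ellCstar_eq_pairing (D : DoubleVB A B C DA DB) (t : D.flip.DualSec) (Φ : DA.dual.Tot) :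
    D.flip.ellCstar t Φ = D.pairing Φ (t.toFun (D.prCstar Φ)) := by
  rw [DoubleVB.ellCstar, D.flip_flip]

/-- The pairing of sections of `D^{*A}` and `D^{*B}`. -/
def pair (s : D.DualSec) (t : D.flip.DualSec) : C^∞⟮C.dual.model, C.dual.Tot; ℝ⟯ where
  val γ := D.pairing (s.toFun γ) (t.toFun γ)
  property := by
    have h1 : ContMDiff C.dual.model 𝓘(ℝ, ℝ) ∞
        (fun γ : C.dual.Tot => (S.secB s γ (S.flip.secA t γ) : ℝ)) := fun γ =>
      B.contMDiffAt_eval (φ := S.secB s) (S.contMDiff_secB s γ) (S.flip.contMDiff_secA t γ)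
    have h2 : ContMDiff C.dual.model 𝓘(ℝ, ℝ) ∞
        (fun γ : C.dual.Tot => (S.flip.secB t γ (S.secA s γ) : ℝ)) := fun γ =>
      A.contMDiffAt_eval (φ := S.flip.secB t) (S.flip.contMDiff_secB t γ) (S.contMDiff_secA s γ)
    exact (h1.sub h2).congr fun γ => S.pairing_sec s t γ

theorem pair_apply (s : D.DualSec) (t : D.flip.DualSec) (γ : C.dual.Tot) :
    S.pair s t γ = S.secB s γ (S.flip.secA t γ) - S.flip.secB t γ (S.secA s γ) :=
  S.pairing_sec s t γ

theorem pair_comb {u s t : D.DualSec} {f g : C^∞⟮C.dual.model, C.dual.Tot; ℝ⟯}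
    (hA : ∀ γ, S.secA u γ = f γ • S.secA s γ + g γ • S.secA t γ)
    (hB : ∀ γ, S.secB u γ = f γ • S.secB s γ + g γ • S.secB t γ) (τ : D.flip.DualSec) :
    S.pair u τ = f * S.pair s τ + g * S.pair t τ := by
  ext γ
  have h1 : (S.flip.secB τ γ (S.secA u γ) : ℝ) =
      f γ * (S.flip.secB τ γ (S.secA s γ) : ℝ) + g γ * (S.flip.secB τ γ (S.secA t γ) : ℝ) := by
    rw [hA]
    exact ((show A.V γ.1 →L[ℝ] ℝ from S.flip.secB τ γ).map_add _ _).trans (congrArg₂ (· + ·)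
      ((show A.V γ.1 →L[ℝ] ℝ from S.flip.secB τ γ).map_smul _ _)
      ((show A.V γ.1 →L[ℝ] ℝ from S.flip.secB τ γ).map_smul _ _))
  have h2 : (S.secB u γ (S.flip.secA τ γ) : ℝ) =
      f γ * (S.secB s γ (S.flip.secA τ γ) : ℝ) + g γ * (S.secB t γ (S.flip.secA τ γ) : ℝ) := by
    rw [hB]
    rfl
  refine (S.pair_apply u τ γ).trans ?_
  refine Eq.trans ?_ (congrArg₂ (fun x y => f γ * x + g γ * y) (S.pair_apply s τ γ)
    (S.pair_apply t τ γ)).symm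
  rw [h1, h2]
  ring

/-- The section of `D^{*A} → C^*` with a given component in `A` and vanishing component in `B^*`. -/
def leftSec (ε : Lift C.dual.model A (fun γ : C.dual.Tot => γ.1)) : D.DualSec :=
  S.mkSec ε.1 (fun _ => 0) ε.2 (B.dual.contMDiff_zeroT.comp C.dual.contMDiff_proj)

/-- The section of `D^{*A} → C^*` with a given component in `B^*` and vanishing component in `A`. -/
def rightSec (ε : Lift C.dual.model B.dual (fun γ : C.dual.Tot => γ.1)) : D.DualSec :=
  S.mkSec (fun _ => 0) ε.1 (A.contMDiff_zeroT.comp C.dual.contMDiff_proj) ε.2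

theorem secA_leftSec (ε : Lift C.dual.model A (fun γ : C.dual.Tot => γ.1)) (γ : C.dual.Tot) :
    S.secA (S.leftSec ε) γ = ε.1 γ := S.secA_mkSec _ _ _ _ _

theorem secB_leftSec (ε : Lift C.dual.model A (fun γ : C.dual.Tot => γ.1)) (γ : C.dual.Tot) :
    S.secB (S.leftSec ε) γ = 0 := S.secB_mkSec _ _ _ _ _

theorem secA_rightSec (ε : Lift C.dual.model B.dual (fun γ : C.dual.Tot => γ.1)) (γ : C.dual.Tot) :
    S.secA (S.rightSec ε) γ = 0 := S.secA_mkSec _ _ _ _ _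

theorem secB_rightSec (ε : Lift C.dual.model B.dual (fun γ : C.dual.Tot => γ.1)) (γ : C.dual.Tot) :
    S.secB (S.rightSec ε) γ = ε.1 γ := S.secB_mkSec _ _ _ _ _

/-- A map from sections of `D^{*A}` to functions that is linear over the functions is the pairing
with a section of `D^{*B}`. -/
theorem exists_pair_eq {lam : D.DualSec → C^∞⟮C.dual.model, C.dual.Tot; ℝ⟯}
    (hl : ∀ u s t f g, (∀ τ, S.pair u τ = f * S.pair s τ + g * S.pair t τ) →
      lam u = f * lam s + g * lam t) :
    ∃ τ : D.flip.DualSec, ∀ s, S.pair s τ = lam s := by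
  have hp : ContMDiff C.dual.model I ∞ (fun γ : C.dual.Tot => γ.1) := C.dual.contMDiff_proj
  -- The sign is that of α(a) in the pairing β(b) - α(a).
  have h1 : IsTensorial (E := A) (p := fun γ : C.dual.Tot => γ.1) (J := C.dual.model)
      (fun ε => -lam (S.leftSec ε)) := fun u s t f g hu => by
    have h := hl (S.leftSec u) (S.leftSec s) (S.leftSec t) f g (S.pair_comb (fun γ => by
      rw [secA_leftSec, secA_leftSec, secA_leftSec, hu]) fun γ => by
      rw [secB_leftSec, secB_leftSec, secB_leftSec, smul_zero, smul_zero, add_zero])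
    linear_combination -h
  have h2 : IsTensorial (E := B.dual) (p := fun γ : C.dual.Tot => γ.1) (J := C.dual.model)
      (fun ε => lam (S.rightSec ε)) := fun u s t f g hu =>
    hl _ _ _ _ _ (S.pair_comb (fun γ => by
      rw [secA_rightSec, secA_rightSec, secA_rightSec, smul_zero, smul_zero, add_zero]) fun γ => by
      rw [secB_rightSec, secB_rightSec, secB_rightSec, hu])
  obtain ⟨α, hα⟩ := h1.exists_dual_lift hp
  obtain ⟨b, hb⟩ := h2.exists_lift hp
  refine ⟨S.flip.mkSec b.1 α.1 b.2 α.2, fun s => ?_⟩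
  have h5 : ∀ γ, (1 : C^∞⟮C.dual.model, C.dual.Tot; ℝ⟯) γ = (1 : ℝ) := fun _ => rfl
  rw [hl s (S.leftSec ⟨_, S.contMDiff_secA s⟩) (S.rightSec ⟨_, S.contMDiff_secB s⟩) 1 1
    (S.pair_comb (fun γ => by
      rw [secA_leftSec, secA_rightSec, h5, smul_zero, add_zero, one_smul]) fun γ => by
      rw [secB_leftSec, secB_rightSec, h5, smul_zero, zero_add, one_smul])]
  ext γ
  rw [S.pair_apply, secA_mkSec, secB_mkSec, one_mul, one_mul]
  refine (congrArg₂ (· - ·) (hb ⟨_, S.contMDiff_secB s⟩ γ) (hα ⟨_, S.contMDiff_secA s⟩ γ)).trans ?_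
  exact (sub_neg_eq_add _ _).trans (add_comm _ _)

theorem exists_pair_smul (f : C^∞⟮C.dual.model, C.dual.Tot; ℝ⟯) (s : D.DualSec) :
    ∃ u : D.DualSec, ∀ τ, S.pair u τ = f * S.pair s τ := by
  refine ⟨S.mkSec (fun γ => f γ • S.secA s γ) (fun γ => f γ • S.secB s γ)
    (fun γ => A.contMDiffAt_smul (f.contMDiff γ) (S.contMDiff_secA s γ))
    (fun γ => B.dual.contMDiffAt_smul (f.contMDiff γ) (S.contMDiff_secB s γ)), fun τ => ?_⟩
  refine (S.pair_comb (s := s) (t := s) (f := f) (g := 0) (fun γ => ?_) (fun γ => ?_) τ).trans ?_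
  · refine (S.secA_mkSec _ _ _ _ γ).trans ?_
    exact ((congrArg _ (zero_smul ℝ _)).trans (add_zero _)).symm
  · refine (S.secB_mkSec _ _ _ _ γ).trans ?_
    exact ((congrArg _ (zero_smul ℝ _)).trans (add_zero _)).symm
  · rw [zero_mul, add_zero]

theorem exists_pair_apply_eq {γ : C.dual.Tot} (a : A.V γ.1) (β : B.dual.V γ.1) :
    ∃ s : D.DualSec, ∀ t : D.flip.DualSec, S.pair s t γ =
      β (S.flip.secA t γ) - (show A.V γ.1 →L[ℝ] ℝ from S.flip.secB t γ) a := by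
  obtain ⟨s, hs⟩ := S.exists_dualSec_apply_eq ⟨⟨γ.1, a⟩, S.cov ⟨γ.1, a⟩ β γ.2⟩
  rw [S.prCstar_cov] at hs
  have h := S.eq_and_eq_of_mk_cov_eq ((S.toFun_eq_cov s γ).symm.trans hs)
  refine ⟨s, fun t => ?_⟩
  rw [S.pair_apply, h.1, h.2]

theorem exists_flip_secA_secB_eq (S : LinearSplitting D) {γ : C.dual.Tot} (b : B.V γ.1) (α : A.dual.V γ.1) :
    ∃ t : D.flip.DualSec, S.flip.secA t γ = b ∧ S.flip.secB t γ = α := by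
  obtain ⟨t, ht⟩ := S.flip.exists_dualSec_apply_eq ⟨⟨γ.1, b⟩, S.flip.cov ⟨γ.1, b⟩ α γ.2⟩
  rw [S.flip.prCstar_cov] at ht
  exact ⟨t, S.flip.eq_and_eq_of_mk_cov_eq ((S.flip.toFun_eq_cov t γ).symm.trans ht)⟩

/-- Pairing with t is one linear functional on A ⊕ B^* at the base point of γ. In dimension at least
two it has a nonzero kernel vector, which some t' detects since the pairing is nondegenerate. -/
theorem exists_pair_eq_zero_and_ne_zero
    (hr : 1 < Module.finrank ℝ A.F + Module.finrank ℝ B.F) (t : D.flip.DualSec) (γ : C.dual.Tot) :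
    ∃ s : D.DualSec, S.pair s t γ = 0 ∧ ∃ t' : D.flip.DualSec, S.pair s t' γ ≠ 0 := by
  let f : (A.V γ.1 × (B.V γ.1 →L[ℝ] ℝ)) →ₗ[ℝ] ℝ :=
    { toFun := fun z => z.2 (S.flip.secA t γ) -
        (show A.V γ.1 →L[ℝ] ℝ from S.flip.secB t γ) z.1
      map_add' := fun z w => by
        rw [Prod.snd_add, Prod.fst_add, map_add, _root_.add_apply]
        ring
      map_smul' := fun c z => by
        rw [Prod.smul_snd, Prod.smul_fst, map_smul, _root_.smul_apply, RingHom.id_apply,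
          smul_eq_mul, smul_eq_mul, smul_eq_mul]
        ring }
  have hB : Module.finrank ℝ (B.V γ.1 →L[ℝ] ℝ) = Module.finrank ℝ B.F := by
    rw [← B.finrank_fiber γ.1,
      ← (LinearMap.toContinuousLinearMap (𝕜 := ℝ) (E := B.V γ.1) (F' := ℝ)).finrank_eq]
    exact Subspace.dual_finrank_eq
  have : FiniteDimensional ℝ (B.V γ.1 →L[ℝ] ℝ) := B.dual.finiteDimensional_fiber γ.1
  have hf : LinearMap.ker f ≠ ⊥ := LinearMap.ker_ne_bot_of_finrank_lt (by
    rw [Module.finrank_self, Module.finrank_prod, hB, A.finrank_fiber]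
    exact hr)
  obtain ⟨⟨a, β⟩, hz, hne⟩ := (Submodule.ne_bot_iff _).1 hf
  obtain ⟨s, hs⟩ := S.exists_pair_apply_eq (γ := γ) a β
  refine ⟨s, (hs t).trans hz, ?_⟩
  by_contra! h0
  have h1 : ∀ (b : B.V γ.1) (α : A.dual.V γ.1),
      β b - (show A.V γ.1 →L[ℝ] ℝ from α) a = 0 := fun b α => by
    obtain ⟨t', ht, ht'⟩ := S.exists_flip_secA_secB_eq b α
    rw [← h0 t', hs, ht, ht']
  refine hne (Prod.ext (A.eq_of_dual_sec fun θ => ?_) (ContinuousLinearMap.ext fun b => ?_))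
  · have h2 := h1 0 (θ γ.1)
    rw [map_zero, zero_sub, neg_eq_zero] at h2
    exact h2.trans (map_zero (show A.V γ.1 →L[ℝ] ℝ from θ γ.1)).symm
  · exact (sub_zero _).symm.trans (h1 b 0)

end LinearSplitting

end Bialgebroid

/-! ### Lie algebroid identities tested against dual sections -/

section InducedPoisson

open SmoothVB

variable {EM HM : Type*} [NormedAddCommGroup EM] [NormedSpace ℝ EM] [FiniteDimensional ℝ EM]
  [TopologicalSpace HM] {I : ModelWithCorners ℝ EM HM} [I.Boundaryless] {M : Type*}
  [TopologicalSpace M] [ChartedSpace HM M] [IsManifold I ∞ M] [T2Space M]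
  {A B C : SmoothVB I M} {DA : SmoothVB A.model A.Tot} {DB : SmoothVB B.model B.Tot}
  {D : DoubleVB A B C DA DB} {LA : LieAlgebroid A} {LB : LieAlgebroid B}
  {LDA : LieAlgebroid DA} {LDB : LieAlgebroid DB}

namespace IsVBAlgebroid

/-- One argument for both sides: the function of a section is minus the pairing for D^{*A} and plus
the pairing for D^{*B}, so c = -1 and c = 1 occur. The map `ev` evaluates a dual section at γ; its
values cover the dual bundle, so identities tested on T hold on all of it. -/
theorem isDualAlgebroid_of_ellCstar (h : IsVBAlgebroid D LA LDB) (S : LinearSplitting D) {T : Type*}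
    {pair : D.DualSec → T → C^∞⟮C.dual.model, C.dual.Tot; ℝ⟯} {c : ℝ} (hc : c ≠ 0)
    {ev : T → C.dual.Tot → DB.dual.Tot} (hev : ∀ τ γ, D.flip.prCstar (ev τ γ) = γ)
    (hpair : ∀ s τ γ, pair s τ γ = c * D.ellCstar s (ev τ γ))
    (hsurj : ∀ Ψ, ∃ τ, ev τ (D.flip.prCstar Ψ) = Ψ) :
    IsDualAlgebroid pair (D.dualBracket LDB) (h.act S) := by
  have hu : ∀ u s t (f g : C^∞⟮C.dual.model, C.dual.Tot; ℝ⟯),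
      (∀ τ, pair u τ = f * pair s τ + g * pair t τ) →
      ∀ Ψ, D.ellCstar u Ψ = f (D.flip.prCstar Ψ) * D.ellCstar s Ψ +
        g (D.flip.prCstar Ψ) * D.ellCstar t Ψ := fun u s t f g hu Ψ => by
    obtain ⟨τ, hτ⟩ := hsurj Ψ
    have h1 : pair u τ (D.flip.prCstar Ψ) = f (D.flip.prCstar Ψ) * pair s τ (D.flip.prCstar Ψ) +
      g (D.flip.prCstar Ψ) * pair t τ (D.flip.prCstar Ψ) := DFunLike.congr_fun (hu τ) _
    rw [hpair, hpair, hpair, hτ] at h1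
    refine mul_left_cancel₀ hc ?_
    linear_combination h1
  exact
    { act_mul := h.act_mul S
      act_add := h.act_add S
      act_comb := fun u s t f g h0 K => act_comb (hu u s t f g h0) K
      br_comb := fun u s t f g h0 a τ => by
        ext γ
        have h1 := bracket_comb (h := h) (S := S) (hu u s t f g h0) a (ev τ γ)
        rw [hev] at h1
        refine (hpair _ τ γ).trans ?_
        refine Eq.trans ?_ (congrArg₂ (· + ·)
          (congrArg₂ (fun x y => f γ * x + h.act S a f γ * y) (hpair _ τ γ) (hpair _ τ γ))
          (congrArg₂ (fun x y => g γ * x + h.act S a g γ * y) (hpair _ τ γ) (hpair _ τ γ))).symm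
        linear_combination c * h1
      br_skew := fun s t τ => by
        ext γ
        refine (hpair _ τ γ).trans ?_
        rw [h.bracket_skew_ellCstar S]
        refine Eq.trans ?_ (congrArg Neg.neg (hpair _ τ γ)).symm
        ring
      act_br := fun s t f => act_dualBracket s t f }

theorem isDualAlgebroid (h : IsVBAlgebroid D LA LDB) (S : LinearSplitting D) :
    IsDualAlgebroid S.pair (D.dualBracket LDB) (h.act S) :=
  h.isDualAlgebroid_of_ellCstar S (c := -1) (by norm_num) (ev := fun τ γ => τ.toFun γ)
    (fun τ γ => τ.prCstar_toFun γ)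
    (fun s τ γ => by
      rw [S.ellCstar_eq_neg_pairing, τ.prCstar_toFun]
      exact (neg_one_mul (-_ : ℝ)).trans (neg_neg _) |>.symm)
    fun Ψ => S.flip.exists_dualSec_apply_eq Ψ

theorem isDualAlgebroid_flip (h : IsVBAlgebroid D.flip LB LDA) (S : LinearSplitting D) :
    IsDualAlgebroid (fun t s => S.pair s t) (D.flip.dualBracket LDA) (h.act S.flip) := by
  refine h.isDualAlgebroid_of_ellCstar S.flip (c := 1) one_ne_zero
    (ev := fun (s : D.DualSec) γ => s.toFun γ) (fun s γ => ?_) (fun t s γ => ?_) fun Φ => ?_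
  · rw [D.flip_flip]
    exact s.prCstar_toFun γ
  · rw [D.flip_ellCstar_eq_pairing, s.prCstar_toFun, one_mul]
    rfl
  · rw [D.flip_flip]
    exact S.exists_dualSec_apply_eq Φ

end IsVBAlgebroid

end InducedPoisson

/-! ### The sections Θ_A^*(dF) and their components -/

section Differential

open SmoothVB LieAlgebroid

variable {EM HM : Type*} [NormedAddCommGroup EM] [NormedSpace ℝ EM] [FiniteDimensional ℝ EM]
  [TopologicalSpace HM] {I : ModelWithCorners ℝ EM HM} [I.Boundaryless] {M : Type*}
  [TopologicalSpace M] [ChartedSpace HM M] [IsManifold I ∞ M] [T2Space M]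
  {A B C : SmoothVB I M} {DA : SmoothVB A.model A.Tot} {DB : SmoothVB B.model B.Tot}
  {D : DoubleVB A B C DA DB} {LA : LieAlgebroid A} {LB : LieAlgebroid B}
  {LDA : LieAlgebroid DA} {LDB : LieAlgebroid DB}

/-- The zero section, of whichever bundle is at hand, carries the question to `tangent_ext`, and the
projection carries the answer back. -/
theorem SmoothVB.tangent_base_ext (E : SmoothVB I M) {x : M} {u w : TangentSpace I x}
    (h : ∀ f : C^∞⟮I, M; ℝ⟯, diffAt I f x u = diffAt I f x w) : u = w := by
  have hz := E.contMDiff_zeroT.mdifferentiableAt (x := x) (by simp)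
  have hp := (E.contMDiff_proj (E.zeroT x)).mdifferentiableAt (by simp)
  have h1 : mfderiv I E.model E.zeroT x u = mfderiv I E.model E.zeroT x w := by
    refine E.tangent_ext (fun θ => ?_) fun f => ?_
    · have h2 : (fun x => E.lin θ (E.zeroT x)) = fun _ => (0 : ℝ) := funext fun x =>
        (show E.V x →L[ℝ] ℝ from θ x).map_zero
      have h3 : ∀ u, diffAt E.model (E.lin θ) (E.zeroT x) (mfderiv I E.model E.zeroT x u) = 0 :=
        fun u => by
        refine (DFunLike.congr_fun (diffAt_comp ((E.lin θ).contMDiff (E.zeroT x))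
          (E.contMDiff_zeroT x)) u).symm.trans ?_
        rw [h2, diffAt_const]
        rfl
      exact (h3 u).trans (h3 w).symm
    · have h3 : ∀ u, diffAt E.model (E.pull f) (E.zeroT x) (mfderiv I E.model E.zeroT x u) =
          diffAt I f x u := fun u =>
        (DFunLike.congr_fun (diffAt_comp ((E.pull f).contMDiff (E.zeroT x))
          (E.contMDiff_zeroT x)) u).symm
      exact (h3 u).trans ((h f).trans (h3 w).symm)
  have h4 : ∀ u, mfderiv E.model I (fun v : E.Tot => v.1) (E.zeroT x)
      (mfderiv I E.model E.zeroT x u) = u := fun u => by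
    have h5 := mfderiv_comp x hp hz
    have h6 : mfderiv I I ((fun v : E.Tot => v.1) ∘ E.zeroT) x = ContinuousLinearMap.id ℝ _ :=
      mfderiv_id
    exact (DFunLike.congr_fun (h5.symm.trans h6) u)
  rw [← h4 u, h1, h4 w]

namespace LinearSplitting

/-- The section of `D^{*A} → C^*` defined by sections of `A` and `B^*`. -/
def sec (S : LinearSplitting D) (a : A.Sec) (β : B.dual.Sec) : D.DualSec :=
  S.mkSec (fun γ => a γ.1) (fun γ => β γ.1) (A.liftSec C.dual.contMDiff_proj a).2
    (B.dual.liftSec C.dual.contMDiff_proj β).2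

variable (S : LinearSplitting D)

theorem secA_sec (a : A.Sec) (β : B.dual.Sec) (γ : C.dual.Tot) : S.secA (S.sec a β) γ = a γ.1 :=
  S.secA_mkSec _ _ _ _ _

theorem secB_sec (a : A.Sec) (β : B.dual.Sec) (γ : C.dual.Tot) : S.secB (S.sec a β) γ = β γ.1 :=
  S.secB_mkSec _ _ _ _ _

theorem ell_linSec_cov (a : A.Sec) {m : M} (b : B.V m) (α : A.dual.V m) (γ : C.dual.V m) :
    DB.ell (S.linSec a) ⟨⟨m, b⟩, S.flip.cov ⟨m, b⟩ α γ⟩ = (α (a m) : ℝ) := by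
  have h := S.flip.cov_decomp ⟨m, b⟩ α γ (a m) 0
  rw [decomp_apply, map_zero, add_zero] at h
  exact h.trans ((congrArg ((α (a m) : ℝ) + ·) (show C.V m →L[ℝ] ℝ from γ).map_zero).trans
    (add_zero _))

theorem ellCstar_sec (a : A.Sec) (β : B.dual.Sec) : D.ellCstar (S.sec a β) =
    (DB.ell (S.linSec a) : DB.dual.Tot → ℝ) + (DB.dual.pull (B.lin (-β)) : DB.dual.Tot → ℝ) := by
  funext Ψ
  obtain ⟨m, b, α, γ, rfl⟩ := S.exists_eq_cov Ψ
  rw [S.ellCstar_cov, secA_sec, secB_sec]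
  exact (sub_eq_add_neg _ _).trans (congrArg (· + -(β m b : ℝ)) (S.ell_linSec_cov a b α γ).symm)

theorem pair_sec (a : A.Sec) (β : B.dual.Sec) (t : D.flip.DualSec) (γ : C.dual.Tot) :
    S.pair (S.sec a β) t γ =
      (β γ.1 (S.flip.secA t γ) : ℝ) - (S.flip.secB t γ (a γ.1) : ℝ) := by
  rw [S.pair_apply, secA_sec, secB_sec]

theorem linSec_zero : S.linSec 0 = 0 := by
  ext b
  exact map_zero (S.flip.lift b)

end LinearSplitting

namespace IsVBAlgebroid

theorem coreConn_zero (h : IsVBAlgebroid D LA LDB) (S : LinearSplitting D) (c : C.Sec) :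
    D.coreConn LDB S.toFun 0 c = 0 := by
  refine D.coreSec_injective ?_
  rw [← h.bracket_linSec_coreSec, S.linSec_zero, map_zero, LinearMap.zero_apply]
  ext b
  exact (map_zero (D.flip.ker b)).symm

theorem act_sec (h : IsVBAlgebroid D LA LDB) (S : LinearSplitting D) (a : A.Sec) (β : B.dual.Sec)
    (F : C^∞⟮C.dual.model, C.dual.Tot; ℝ⟯) (Ψ : DB.dual.Tot) :
    h.act S (S.sec a β) F (D.flip.prCstar Ψ) =
      liePoisson LDB (DB.ell (S.linSec a)) (fun Ψ' => F (D.flip.prCstar Ψ')) Ψ +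
      liePoisson LDB (DB.dual.pull (B.lin (-β))) (fun Ψ' => F (D.flip.prCstar Ψ')) Ψ := by
  rw [h.act_prCstar, S.ellCstar_sec]
  exact liePoisson_add_left ((DB.ell _).contMDiff Ψ) ((DB.dual.pull _).contMDiff Ψ)

/-- On D^{*B} this is the bracket of ℓ_{σ_A(a)} - q^*ℓ_β with ℓ_{c^†}: the first term gives the
connection, the second the core-anchor. -/
theorem act_sec_ell (h : IsVBAlgebroid D LA LDB) (S : LinearSplitting D) (a : A.Sec)
    (β : B.dual.Sec) (c : C.Sec) (γ : C.dual.Tot) :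
    h.act S (S.sec a β) (C.ell c) γ =
      C.ell (D.coreConn LDB S.toFun a c) γ + (β γ.1 (D.coreAnchor LDB c γ.1) : ℝ) := by
  obtain ⟨Ψ, rfl⟩ := exists_prCstar_eq S γ
  rw [h.act_sec, show (fun Ψ' => C.ell c (D.flip.prCstar Ψ')) = DB.ell (D.coreSec c) from
    funext fun Ψ' => (D.ell_coreSec c Ψ').symm, liePoisson_ell_ell, h.bracket_linSec_coreSec,
    D.ell_coreSec, liePoisson_skew, liePoisson_ell_pull, h.act_core_lin_eq]
  refine congrArg _ ?_
  exact neg_neg (β Ψ.1.1 (D.coreAnchor LDB c Ψ.1.1) : ℝ)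

theorem act_sec_pull (h : IsVBAlgebroid D LA LDB) (S : LinearSplitting D) (a : A.Sec)
    (β : B.dual.Sec) (f : C^∞⟮I, M; ℝ⟯) (γ : C.dual.Tot) :
    h.act S (S.sec a β) (C.dual.pull f) γ = LA.act a f γ.1 := by
  obtain ⟨Ψ, rfl⟩ := exists_prCstar_eq S γ
  rw [h.act_sec, show (fun Ψ' => C.dual.pull f (D.flip.prCstar Ψ')) =
    DB.dual.pull (B.pull f) from rfl, liePoisson_ell_pull, liePoisson_pull_pull,
    h.act_linear_pull (S.isLinearSec_linSec a), add_zero]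
  rfl

theorem exists_differential (h : IsVBAlgebroid D LA LDB) (S : LinearSplitting D)
    (F : C^∞⟮C.dual.model, C.dual.Tot; ℝ⟯) :
    ∃ τ : D.flip.DualSec, ∀ s, S.pair s τ = h.act S s F :=
  S.exists_pair_eq fun u s t f g hu => (h.isDualAlgebroid S).act_comb u s t f g hu F

/-- The section `Θ_A^*(dF)` of `D^{*B} → C^*`. -/
def differential (h : IsVBAlgebroid D LA LDB) (S : LinearSplitting D)
    (F : C^∞⟮C.dual.model, C.dual.Tot; ℝ⟯) : D.flip.DualSec :=
  Classical.choose (h.exists_differential S F)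

theorem pair_differential (h : IsVBAlgebroid D LA LDB) (S : LinearSplitting D)
    (F : C^∞⟮C.dual.model, C.dual.Tot; ℝ⟯) (s : D.DualSec) :
    S.pair s (h.differential S F) = h.act S s F :=
  Classical.choose_spec (h.exists_differential S F) s

theorem pair_sec_differential (h : IsVBAlgebroid D LA LDB) (S : LinearSplitting D)
    (F : C^∞⟮C.dual.model, C.dual.Tot; ℝ⟯) (a : A.Sec) (β : B.dual.Sec) (γ : C.dual.Tot) :
    (β γ.1 (S.flip.secA (h.differential S F) γ) : ℝ) -
      (S.flip.secB (h.differential S F) γ (a γ.1) : ℝ) = h.act S (S.sec a β) F γ := by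
  rw [← S.pair_sec, h.pair_differential]

/-- Pairing with the sections (0, β) isolates the component in B; in the next lemma the sections (a,
0) isolate the one in A^*. -/
theorem secA_differential_ell (h : IsVBAlgebroid D LA LDB) (S : LinearSplitting D) (c : C.Sec)
    (γ : C.dual.Tot) :
    S.flip.secA (h.differential S (C.ell c)) γ = D.coreAnchor LDB c γ.1 := by
  refine B.eq_of_dual_sec fun β => ?_
  have h1 := h.pair_sec_differential S (C.ell c) 0 β γ
  rw [h.act_sec_ell, h.coreConn_zero, C.ell_zero, zero_add] at h1
  refine Eq.trans ?_ h1
  exact (sub_zero _).symm.trans (congrArg _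
    (show A.V γ.1 →L[ℝ] ℝ from S.flip.secB (h.differential S (C.ell c)) γ).map_zero.symm)

theorem secB_differential_ell (h : IsVBAlgebroid D LA LDB) (S : LinearSplitting D) (c : C.Sec)
    (a : A.Sec) (γ : C.dual.Tot) :
    (S.flip.secB (h.differential S (C.ell c)) γ (a γ.1) : ℝ) =
      -C.ell (D.coreConn LDB S.toFun a c) γ := by
  have h1 := h.pair_sec_differential S (C.ell c) a 0 γ
  rw [h.act_sec_ell] at h1
  refine neg_eq_iff_eq_neg.1 ?_
  refine (zero_sub _).symm.trans (h1.trans ?_)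
  exact add_zero _

theorem secA_differential_pull (h : IsVBAlgebroid D LA LDB) (S : LinearSplitting D)
    (f : C^∞⟮I, M; ℝ⟯) (γ : C.dual.Tot) :
    S.flip.secA (h.differential S (C.dual.pull f)) γ = (0 : B.Sec) γ.1 := by
  refine B.eq_of_dual_sec fun β => ?_
  have h1 := h.pair_sec_differential S (C.dual.pull f) 0 β γ
  rw [h.act_sec_pull, act_zero_left] at h1
  refine Eq.trans ?_ (h1.trans (show B.V γ.1 →L[ℝ] ℝ from β γ.1).map_zero.symm)
  exact (sub_zero _).symm.trans (congrArg _
    (show A.V γ.1 →L[ℝ] ℝ from S.flip.secB (h.differential S (C.dual.pull f)) γ).map_zero.symm)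

theorem secB_differential_pull (h : IsVBAlgebroid D LA LDB) (S : LinearSplitting D)
    (f : C^∞⟮I, M; ℝ⟯) (a : A.Sec) (γ : C.dual.Tot) :
    (S.flip.secB (h.differential S (C.dual.pull f)) γ (a γ.1) : ℝ) =
      -C.dual.pull (LA.act a f) γ := by
  have h1 := h.pair_sec_differential S (C.dual.pull f) a 0 γ
  rw [h.act_sec_pull] at h1
  refine neg_eq_iff_eq_neg.1 ?_
  exact (zero_sub _).symm.trans h1

/-- The action of a section of `D^{*A} → C^*` whose component in `A` is a section `a` of `A`. -/
theorem act_eq_of_secA (h : IsVBAlgebroid D LA LDB) (S : LinearSplitting D) {t : D.DualSec}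
    {a : A.Sec} {Q : B.Sec → C^∞⟮C.dual.model, C.dual.Tot; ℝ⟯}
    (hA : ∀ γ, S.secA t γ = a γ.1) (hB : ∀ b γ, (S.secB t γ (b γ.1) : ℝ) = -Q b γ)
    (G : C^∞⟮C.dual.model, C.dual.Tot; ℝ⟯) (Ψ : DB.dual.Tot) :
    ∃ (n : ℕ) (e : Fin n → B.Sec) (θ : Fin n → B.dual.Sec),
      (∀ b : B.V Ψ.1.1, ∑ i, (θ i Ψ.1.1 b : ℝ) • e i Ψ.1.1 = b) ∧
      h.act S t G (D.flip.prCstar Ψ) =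
        liePoisson LDB (DB.ell (S.linSec a)) (fun Ψ' => G (D.flip.prCstar Ψ')) Ψ +
        ∑ i, Q (e i) (D.flip.prCstar Ψ) *
          liePoisson LDB (DB.dual.pull (B.lin (θ i))) (fun Ψ' => G (D.flip.prCstar Ψ')) Ψ := by
  obtain ⟨n, e, θ, χ, hχ, hf⟩ := B.exists_frame Ψ.1.1
  have hf' : ∀ᶠ m in nhds Ψ.1.1, ∀ b : B.V m, ∑ i, (θ i m b : ℝ) • e i m = b := by
    filter_upwards [hχ] with m hm b
    rw [hf, hm, one_smul]
  refine ⟨n, e, θ, hf'.self_of_nhds, ?_⟩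
  have hc : Filter.Tendsto (fun Ψ' : DB.dual.Tot => Ψ'.1.1) (nhds Ψ) (nhds Ψ.1.1) :=
    ((B.contMDiff_proj.comp DB.dual.contMDiff_proj).continuous).continuousAt
  -- The component of t in B^* varies with γ and is not given by a section of B^*. It is expanded in
  -- the dual frame with coefficients -Q(e_i) pulled back from C^*, which behave as constants when
  -- bracketed with G.
  have h1 : D.ellCstar t =ᶠ[nhds Ψ] (DB.ell (S.linSec a) : DB.dual.Tot → ℝ) + fun Ψ' =>
      ∑ i, ((fun Ψ' => Q (e i) (D.flip.prCstar Ψ')) *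
        (DB.dual.pull (B.lin (θ i)) : DB.dual.Tot → ℝ)) Ψ' := by
    filter_upwards [hc.eventually hf'] with Ψ' hΨ'
    obtain ⟨m, b, α, γ, rfl⟩ := S.exists_eq_cov Ψ'
    rw [S.ellCstar_cov, hA, Pi.add_apply, S.ell_linSec_cov, sub_eq_add_neg]
    refine congrArg _ ?_
    have h6 := congrArg (show B.V m →L[ℝ] ℝ from S.secB t ⟨m, γ⟩) (hΨ' b)
    rw [map_sum] at h6
    refine (congrArg Neg.neg h6.symm).trans ?_
    rw [← Finset.sum_neg_distrib]
    refine Finset.sum_congr rfl fun i _ => ?_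
    have h7 := hB (e i) ⟨m, γ⟩
    rw [map_smul, Pi.mul_apply, S.flip.prCstar_cov]
    refine (neg_mul_eq_mul_neg _ _).trans ?_
    refine (congrArg (fun r : ℝ => (θ i m b : ℝ) * -r) h7).trans ?_
    rw [neg_neg]
    exact mul_comm _ _
  rw [h.act_prCstar, liePoisson_congr h1 (Filter.EventuallyEq.refl _ _)]
  have h2 : ∀ i, ContMDiff DB.dual.model 𝓘(ℝ, ℝ) ∞ (fun Ψ' => Q (e i) (D.flip.prCstar Ψ')) :=
    fun i => D.contMDiff_comp_prCstar (Q (e i)).contMDiff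
  have h3 : ∀ i, ContMDiff DB.dual.model 𝓘(ℝ, ℝ) ∞ ((fun Ψ' => Q (e i) (D.flip.prCstar Ψ')) *
        (DB.dual.pull (B.lin (θ i)) : DB.dual.Tot → ℝ)) := fun i =>
    (h2 i).mul (DB.dual.pull (B.lin (θ i))).contMDiff
  refine (liePoisson_add_left ((DB.ell _).contMDiff Ψ) ?_).trans (congrArg _ ?_)
  · exact ContMDiffAt.sum fun i _ => h3 i Ψ
  · refine (liePoisson_sum_left fun i _ => h3 i Ψ).trans (Finset.sum_congr rfl fun i _ => ?_)
    rw [liePoisson_mul_left (h2 i Ψ) ((DB.dual.pull (B.lin (θ i))).contMDiff Ψ),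
      h.liePoisson_prCstar_prCstar (Q (e i)).contMDiff G.contMDiff, mul_zero, add_zero]

section Act

variable {t : D.DualSec} {a : A.Sec} {Q : B.Sec → C^∞⟮C.dual.model, C.dual.Tot; ℝ⟯}

theorem act_ell_of_secA (h : IsVBAlgebroid D LA LDB) (S : LinearSplitting D)
    (hA : ∀ γ, S.secA t γ = a γ.1) (hB : ∀ b γ, (S.secB t γ (b γ.1) : ℝ) = -Q b γ) (c : C.Sec)
    (γ : C.dual.Tot) : h.act S t (C.ell c) γ =
      C.ell (D.coreConn LDB S.toFun a c) γ - Q (D.coreAnchor LDB c) γ := by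
  obtain ⟨Ψ, rfl⟩ := exists_prCstar_eq S γ
  obtain ⟨n, e, θ, hf, h1⟩ := h.act_eq_of_secA S hA hB (C.ell c) Ψ
  rw [h1, show (fun Ψ' => C.ell c (D.flip.prCstar Ψ')) = DB.ell (D.coreSec c) from
    funext fun Ψ' => (D.ell_coreSec c Ψ').symm, liePoisson_ell_ell, h.bracket_linSec_coreSec,
    D.ell_coreSec, sub_eq_add_neg]
  refine congrArg _ ?_
  -- No linearity of Q is assumed; it comes from the component of t in B^*, and allows the
  -- core-anchor of c to be expanded in the frame.
  obtain ⟨l, hl⟩ : ∃ l : B.V Ψ.1.1 →L[ℝ] ℝ, ∀ b : B.Sec, l (b Ψ.1.1) = -Q b (D.flip.prCstar Ψ) :=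
    ⟨S.secB t (D.flip.prCstar Ψ), fun b => hB b (D.flip.prCstar Ψ)⟩
  rw [← hl, ← hf (D.coreAnchor LDB c Ψ.1.1), map_sum]
  refine Finset.sum_congr rfl fun i _ => ?_
  rw [map_smul, hl, liePoisson_skew, liePoisson_ell_pull, h.act_core_lin_eq]
  exact (mul_neg _ _).trans ((congrArg Neg.neg (mul_comm _ _)).trans (mul_neg _ _).symm)

theorem act_pull_of_secA (h : IsVBAlgebroid D LA LDB) (S : LinearSplitting D)
    (hA : ∀ γ, S.secA t γ = a γ.1) (hB : ∀ b γ, (S.secB t γ (b γ.1) : ℝ) = -Q b γ)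
    (f : C^∞⟮I, M; ℝ⟯) (γ : C.dual.Tot) :
    h.act S t (C.dual.pull f) γ = LA.act a f γ.1 := by
  obtain ⟨Ψ, rfl⟩ := exists_prCstar_eq S γ
  obtain ⟨n, e, θ, -, h1⟩ := h.act_eq_of_secA S hA hB (C.dual.pull f) Ψ
  rw [h1, show (fun Ψ' => C.dual.pull f (D.flip.prCstar Ψ')) =
    DB.dual.pull (B.pull f) from rfl, liePoisson_ell_pull,
    h.act_linear_pull (S.isLinearSec_linSec a), Finset.sum_eq_zero, add_zero]
  · rfl
  · intro i _
    rw [liePoisson_pull_pull, mul_zero]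

end Act

end IsVBAlgebroid

end Differential

/-! ### The induced Poisson bracket on C^* -/

section CstarPoisson

open SmoothVB LieAlgebroid

variable {EM HM : Type*} [NormedAddCommGroup EM] [NormedSpace ℝ EM] [FiniteDimensional ℝ EM]
  [TopologicalSpace HM] {I : ModelWithCorners ℝ EM HM} [I.Boundaryless] {M : Type*}
  [TopologicalSpace M] [ChartedSpace HM M] [IsManifold I ∞ M] [T2Space M]
  {A B C : SmoothVB I M} {DA : SmoothVB A.model A.Tot} {DB : SmoothVB B.model B.Tot}
  {D : DoubleVB A B C DA DB} {LA : LieAlgebroid A} {LB : LieAlgebroid B}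
  {LDA : LieAlgebroid DA} {LDB : LieAlgebroid DB}

theorem LinearSplitting.eq_of_pairing_eq (S : LinearSplitting D) {γ : C.dual.Tot}
    {Ψ Ψ' : DB.dual.Tot} (hΨ : D.flip.prCstar Ψ = γ) (hΨ' : D.flip.prCstar Ψ' = γ)
    (h : ∀ Φ : DA.dual.Tot, D.prCstar Φ = γ → D.pairing Φ Ψ = D.pairing Φ Ψ') : Ψ = Ψ' := by
  obtain ⟨b, α, rfl⟩ := S.flip.exists_cov hΨ
  obtain ⟨b', α', rfl⟩ := S.flip.exists_cov hΨ'
  have h1 : ∀ (a : A.V γ.1) (β : B.dual.V γ.1), (β b : ℝ) - α a = β b' - α' a := fun a β => by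
    have h2 := h ⟨⟨γ.1, a⟩, S.cov ⟨γ.1, a⟩ β γ.2⟩ (S.prCstar_cov _ _ _)
    rwa [S.pairing_cov, S.pairing_cov] at h2
  obtain rfl : b = b' := B.eq_of_dual_sec fun θ => by
    have h2 := h1 0 (θ γ.1)
    rwa [show (α 0 : ℝ) = 0 from (show A.V γ.1 →L[ℝ] ℝ from α).map_zero,
      show (α' 0 : ℝ) = 0 from (show A.V γ.1 →L[ℝ] ℝ from α').map_zero, sub_zero, sub_zero] at h2
  obtain rfl : α = α' := ContinuousLinearMap.ext fun a => neg_injective <|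
    (zero_sub _).symm.trans ((h1 a 0).trans (zero_sub _))
  rfl

namespace IsVBAlgebroid

/-- The section Θ_A^*(dF) meets the condition of the choice in `dualAnchorStar`, and nondegeneracy
of the pairing makes the solution unique. -/
theorem dualAnchorStar_diffAt (h : IsVBAlgebroid D LA LDB) (S : LinearSplitting D)
    (F : C^∞⟮C.dual.model, C.dual.Tot; ℝ⟯) (γ : C.dual.Tot) :
    D.dualAnchorStar LDB γ (diffAt C.dual.model F γ) = (h.differential S F).toFun γ := by
  have h1 : D.flip.prCstar ((h.differential S F).toFun γ) = γ ∧ ∀ Φ : DA.dual.Tot,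
      D.prCstar Φ = γ → D.pairing Φ ((h.differential S F).toFun γ) =
        diffAt C.dual.model F γ (D.dualAnchor LDB γ Φ) := by
    refine ⟨(h.differential S F).prCstar_toFun γ, fun Φ hΦ => ?_⟩
    obtain ⟨s, hs⟩ := S.exists_dualSec_apply_eq Φ
    rw [hΦ] at hs
    rw [← hs]
    exact DFunLike.congr_fun (h.pair_differential S F s) γ
  have h2 := Classical.epsilon_spec (p := fun Ψ : DB.dual.Tot => D.flip.prCstar Ψ = γ ∧
    ∀ Φ : DA.dual.Tot, D.prCstar Φ = γ →
      D.pairing Φ Ψ = diffAt C.dual.model F γ (D.dualAnchor LDB γ Φ)) ⟨_, h1⟩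
  exact S.eq_of_pairing_eq h2.1 h1.1 fun Φ hΦ => (h2.2 Φ hΦ).trans (h1.2 Φ hΦ).symm

theorem act_smul (h : IsVBAlgebroid D LA LDB) (S : LinearSplitting D) (s : D.DualSec) (c : ℝ)
    (F : C^∞⟮C.dual.model, C.dual.Tot; ℝ⟯) : h.act S s (c • F) = c • h.act S s F := by
  ext γ
  exact DFunLike.congr_fun (diffAt_const_smul c (F.contMDiff γ)) _

end IsVBAlgebroid

namespace IsDoubleLieAlgebroid

/-- The bracket of functions on `C^*` defined by `Θ_B ∘ Θ_A^*`. -/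
def cstarBr (hD : IsDoubleLieAlgebroid D LA LB LDA LDB) (S : LinearSplitting D)
    (F G : C^∞⟮C.dual.model, C.dual.Tot; ℝ⟯) : C^∞⟮C.dual.model, C.dual.Tot; ℝ⟯ :=
  hD.vbA.act S.flip (hD.vbB.differential S F) G

theorem cstarBr_apply (hD : IsDoubleLieAlgebroid D LA LB LDA LDB) (S : LinearSplitting D)
    (F G : C^∞⟮C.dual.model, C.dual.Tot; ℝ⟯) (γ : C.dual.Tot) :
    hD.cstarBr S F G γ = diffAt C.dual.model G γ
      (D.cstarSharp LDA LDB γ (diffAt C.dual.model F γ)) := by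
  rw [DoubleVB.cstarSharp, hD.vbB.dualAnchorStar_diffAt S F γ]
  rfl

theorem cstarBr_add_left (hD : IsDoubleLieAlgebroid D LA LB LDA LDB) (S : LinearSplitting D)
    (F F' G : C^∞⟮C.dual.model, C.dual.Tot; ℝ⟯) :
    hD.cstarBr S (F + F') G = hD.cstarBr S F G + hD.cstarBr S F' G := by
  refine ((hD.vbA.isDualAlgebroid_flip S).act_comb _ (hD.vbB.differential S F)
    (hD.vbB.differential S F') 1 1 (fun s => ?_) G).trans ?_
  · rw [hD.vbB.pair_differential, hD.vbB.pair_differential, hD.vbB.pair_differential,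
      hD.vbB.act_add, one_mul, one_mul]
  · rw [one_mul, one_mul]
    rfl

theorem cstarBr_smul_left (hD : IsDoubleLieAlgebroid D LA LB LDA LDB) (S : LinearSplitting D)
    (c : ℝ) (F G : C^∞⟮C.dual.model, C.dual.Tot; ℝ⟯) :
    hD.cstarBr S (c • F) G = c • hD.cstarBr S F G := by
  have h1 : ∀ K : C^∞⟮C.dual.model, C.dual.Tot; ℝ⟯, (ContMDiffMap.const c) * K = c • K :=
    fun K => rfl
  refine ((hD.vbA.isDualAlgebroid_flip S).act_comb _ (hD.vbB.differential S F)
    (hD.vbB.differential S F) (ContMDiffMap.const c) 0 (fun s => ?_) G).trans ?_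
  · rw [hD.vbB.pair_differential, hD.vbB.pair_differential, hD.vbB.act_smul, h1, zero_mul, add_zero]
  · rw [h1, zero_mul, add_zero]
    rfl

/-- The flipped VB-algebroid applied to Θ_A^*(dℓ_c), with components ∂_B c and a ↦ -ℓ_{∇_a c}. The
two connections appear in the arrangement opposite to `coreBracket`. -/
theorem cstarBr_ell_ell (hD : IsDoubleLieAlgebroid D LA LB LDA LDB) (S : LinearSplitting D)
    (c c' : C.Sec) (γ : C.dual.Tot) : hD.cstarBr S (C.ell c) (C.ell c') γ =
      C.ell (S.connBC LDA (D.coreAnchor LDB c) c') γ -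
        C.ell (S.connAC LDB (D.flip.coreAnchor LDA c') c) γ :=
  hD.vbA.act_ell_of_secA S.flip (t := hD.vbB.differential S (C.ell c))
    (a := D.coreAnchor LDB c) (Q := fun a => C.ell (D.coreConn LDB S.toFun a c))
    (hD.vbB.secA_differential_ell S c) (hD.vbB.secB_differential_ell S c) c' γ

theorem cstarBr_ell_pull (hD : IsDoubleLieAlgebroid D LA LB LDA LDB) (S : LinearSplitting D)
    (c : C.Sec) (f : C^∞⟮I, M; ℝ⟯) (γ : C.dual.Tot) :
    hD.cstarBr S (C.ell c) (C.dual.pull f) γ = LB.act (D.coreAnchor LDB c) f γ.1 :=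
  hD.vbA.act_pull_of_secA S.flip (t := hD.vbB.differential S (C.ell c))
    (a := D.coreAnchor LDB c) (Q := fun a => C.ell (D.coreConn LDB S.toFun a c))
    (hD.vbB.secA_differential_ell S c) (hD.vbB.secB_differential_ell S c) f γ

theorem cstarBr_pull_ell (hD : IsDoubleLieAlgebroid D LA LB LDA LDB) (S : LinearSplitting D)
    (f : C^∞⟮I, M; ℝ⟯) (c : C.Sec) (γ : C.dual.Tot) :
    hD.cstarBr S (C.dual.pull f) (C.ell c) γ = -LA.act (D.flip.coreAnchor LDA c) f γ.1 := by
  refine (hD.vbA.act_ell_of_secA S.flip (t := hD.vbB.differential S (C.dual.pull f))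
    (a := 0) (Q := fun a => C.dual.pull (LA.act a f))
    (hD.vbB.secA_differential_pull S f) (hD.vbB.secB_differential_pull S f) c γ).trans ?_
  rw [hD.vbA.coreConn_zero, C.ell_zero, zero_sub]
  rfl

theorem cstarBr_pull_pull (hD : IsDoubleLieAlgebroid D LA LB LDA LDB) (S : LinearSplitting D)
    (f g : C^∞⟮I, M; ℝ⟯) (γ : C.dual.Tot) :
    hD.cstarBr S (C.dual.pull f) (C.dual.pull g) γ = 0 := by
  refine (hD.vbA.act_pull_of_secA S.flip (t := hD.vbB.differential S (C.dual.pull f))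
    (a := 0) (Q := fun a => C.dual.pull (LA.act a f))
    (hD.vbB.secA_differential_pull S f) (hD.vbB.secB_differential_pull S f) g γ).trans ?_
  rw [act_zero_left]

/-- In rank zero the pairing vanishes identically, so the nondegeneracy required by `IsBialgebroid`
is not available, but tensoriality of the anchor forces the bracket to be zero. -/
theorem cstarBr_eq_zero (hD : IsDoubleLieAlgebroid D LA LB LDA LDB) (S : LinearSplitting D)
    (hr : Module.finrank ℝ A.F + Module.finrank ℝ B.F = 0)
    (F G : C^∞⟮C.dual.model, C.dual.Tot; ℝ⟯) : hD.cstarBr S F G = 0 := by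
  have h0 : ∀ (s : D.DualSec) (t : D.flip.DualSec), S.pair s t = 0 := fun s t => by
    ext γ
    have hA : Subsingleton (A.V γ.1) := Module.finrank_zero_iff.1 (by
      rw [A.finrank_fiber]
      exact (Nat.add_eq_zero_iff.1 hr).1)
    have hB : Subsingleton (B.V γ.1) := Module.finrank_zero_iff.1 (by
      rw [B.finrank_fiber]
      exact (Nat.add_eq_zero_iff.1 hr).2)
    rw [S.pair_apply, Subsingleton.elim (S.flip.secA t γ) 0, Subsingleton.elim (S.secA s γ) 0]
    exact (congrArg₂ (· - ·) (show B.V γ.1 →L[ℝ] ℝ from S.secB s γ).map_zero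
      (show A.V γ.1 →L[ℝ] ℝ from S.flip.secB t γ).map_zero).trans (sub_zero _)
  refine ((hD.vbA.isDualAlgebroid_flip S).act_comb _ (hD.vbB.differential S F)
    (hD.vbB.differential S F) 0 0 (fun s => ?_) G).trans ?_
  · simp only [h0, zero_mul, add_zero]
  · rw [zero_mul, add_zero]

theorem exists_isBialgebroid (hD : IsDoubleLieAlgebroid D LA LB LDA LDB) (S : LinearSplitting D)
    (hr : 1 < Module.finrank ℝ A.F + Module.finrank ℝ B.F) :
    ∃ lie : D.DualSec → D.flip.DualSec → D.flip.DualSec,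
      IsBialgebroid S.pair (D.dualBracket LDB) (hD.vbB.act S) (D.flip.dualBracket LDA)
        (hD.vbA.act S.flip) (hD.vbB.differential S) lie := by
  have hl := hD.vbB.isDualAlgebroid S
  -- Lie derivatives exist as sections because the defining expression is tensorial in Y: the terms
  -- in which X differentiates the coefficients cancel.
  have hL : ∀ (X : D.DualSec) (α : D.flip.DualSec), ∃ τ : D.flip.DualSec, ∀ Y,
      S.pair Y τ = hD.vbB.act S X (S.pair Y α) - S.pair (D.dualBracket LDB X Y) α :=
    fun X α => S.exists_pair_eq
      (lam := fun Y => hD.vbB.act S X (S.pair Y α) - S.pair (D.dualBracket LDB X Y) α)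
      fun u s t f g hu => by
      simp only []
      rw [hu, hl.act_add, hl.act_mul, hl.act_mul, hl.br_comb u s t f g hu]
      ring
  choose lie hL using hL
  refine ⟨lie, hl, hD.vbA.isDualAlgebroid_flip S, fun X f => hD.vbB.pair_differential S f X,
    fun X Y α => hL X α Y, S.exists_pair_smul, fun w hw α => ?_, fun r h0 => ?_, fun X Y α β => ?_⟩
  · ext γ
    -- A section that kills α at γ without vanishing there reduces the hypothesis on w to ⟨s, t'⟩
    -- w(α) = 0 at γ.
    obtain ⟨s, hs, t', ht'⟩ := S.exists_pair_eq_zero_and_ne_zero hr α γ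
    have h1 : S.pair s t' γ * w α γ = S.pair s α γ * w t' γ := DFunLike.congr_fun (hw s α t') γ
    rw [hs, zero_mul] at h1
    exact (mul_eq_zero.1 h1).resolve_left ht'
  · ext γ
    obtain ⟨t, -⟩ := S.flip.exists_dualSec_apply_eq ⟨B.zeroT γ.1, 0⟩
    obtain ⟨s, -, t', ht'⟩ := S.exists_pair_eq_zero_and_ne_zero hr t γ
    have h1 : S.pair s t' γ * r γ = 0 := DFunLike.congr_fun (h0 s t') γ
    exact (mul_eq_zero.1 h1).resolve_left ht'
  · have h1 : ∀ X α Y, (fun γ => D.pairing (Y.toFun γ) ((lie X α).toFun γ)) =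
        D.dualAct LDB X (fun γ => D.pairing (Y.toFun γ) (α.toFun γ)) -
          fun γ => D.pairing ((D.dualBracket LDB X Y).toFun γ) (α.toFun γ) := fun X α Y =>
      congrArg (fun F : C^∞⟮C.dual.model, C.dual.Tot; ℝ⟯ => (F : C.dual.Tot → ℝ)) (hL X α Y)
    exact DFunLike.coe_injective (hD.bialgebroid X Y α β (lie X α) (lie X β) (lie Y α) (lie Y β)
      (h1 X α) (h1 X β) (h1 Y α) (h1 Y β))

theorem cstarBr_skew_and_jacobi (hD : IsDoubleLieAlgebroid D LA LB LDA LDB)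
    (S : LinearSplitting D) (hr : Module.finrank ℝ A.F + Module.finrank ℝ B.F ≠ 1) :
    (∀ F G, hD.cstarBr S F G = -hD.cstarBr S G F) ∧
    ∀ F G K, hD.cstarBr S F (hD.cstarBr S G K) =
      hD.cstarBr S (hD.cstarBr S F G) K + hD.cstarBr S G (hD.cstarBr S F K) := by
  rcases Nat.lt_or_ge 1 (Module.finrank ℝ A.F + Module.finrank ℝ B.F) with h1 | h1
  · obtain ⟨lie, h⟩ := hD.exists_isBialgebroid S h1
    exact ⟨h.act_d_skew, h.jacobi⟩
  · have h0 := hD.cstarBr_eq_zero S (by omega)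
    simp only [h0, neg_zero, add_zero, implies_true, and_self]

/-- The Poisson structure on `C^*` induced by the Lie bialgebroid `(D^{*A}, D^{*B})`. -/
def cstarPoisson (hD : IsDoubleLieAlgebroid D LA LB LDA LDB) (S : LinearSplitting D)
    (hr : Module.finrank ℝ A.F + Module.finrank ℝ B.F ≠ 1) :
    PoissonStructure C.dual.model C.dual.Tot where
  br := LinearMap.mk₂ ℝ (hD.cstarBr S) (hD.cstarBr_add_left S) (hD.cstarBr_smul_left S)
    (fun F => hD.vbA.act_add S.flip _) fun c F => hD.vbA.act_smul S.flip _ c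
  br_self F := by
    ext γ
    exact self_eq_neg.1 (DFunLike.congr_fun ((hD.cstarBr_skew_and_jacobi S hr).1 F F) γ)
  jacobi := (hD.cstarBr_skew_and_jacobi S hr).2
  leibniz F G K := (hD.vbA.act_mul S.flip _ G K).trans (by
    rw [add_comm, mul_comm K]
    rfl)

end IsDoubleLieAlgebroid

end CstarPoisson

/-! ### The Lie algebroid structure on the core -/

section CoreAlgebroid

open SmoothVB LieAlgebroid

variable {EM HM : Type*} [NormedAddCommGroup EM] [NormedSpace ℝ EM] [FiniteDimensional ℝ EM]
  [TopologicalSpace HM] {I : ModelWithCorners ℝ EM HM} [I.Boundaryless] {M : Type*}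
  [TopologicalSpace M] [ChartedSpace HM M] [IsManifold I ∞ M] [T2Space M]
  {A B C : SmoothVB I M} {DA : SmoothVB A.model A.Tot} {DB : SmoothVB B.model B.Tot}
  {D : DoubleVB A B C DA DB} {LA : LieAlgebroid A} {LB : LieAlgebroid B}
  {LDA : LieAlgebroid DA} {LDB : LieAlgebroid DB}

theorem SmoothVB.ell_injective (E : SmoothVB I M) : Function.Injective E.ell := fun ξ η h => by
  ext x
  exact E.eq_of_dual_sec fun θ => DFunLike.congr_fun h ⟨x, θ x⟩

theorem SmoothVB.ell_add_eq (E : SmoothVB I M) (ξ η : E.Sec) : E.ell (ξ + η) = E.ell ξ + E.ell η := by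
  ext φ
  exact E.ell_add ξ η φ

theorem SmoothVB.ell_smul_eq (E : SmoothVB I M) (r : ℝ) (ξ : E.Sec) : E.ell (r • ξ) = r • E.ell ξ := by
  ext φ
  exact E.ell_smul r ξ φ

namespace IsVBAlgebroid

/-- `coreAnchor` is defined on sections, while a Lie algebroid needs a smooth fibrewise anchor.
Evaluating the anchor of D → B on core vectors over the zero section of B, and testing against
linear functions, gives it pointwise. -/
theorem exists_coreAnchorMap (h : IsVBAlgebroid D LA LDB) :
    ∃ l : ∀ m, C.V m →L[ℝ] B.V m,
      ContMDiff C.model B.model ∞ (fun v : C.Tot => (⟨v.1, l v.1 v.2⟩ : B.Tot)) ∧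
      ∀ (c : C.Sec) m, l m (c m) = D.coreAnchor LDB c m := by
  let u : ∀ v : C.Tot, TangentSpace B.model (B.zeroT v.1) := fun v =>
    LDB.anchor (B.zeroT v.1) (D.flip.ker (B.zeroT v.1) v.2)
  have hu : ∀ (c : C.Sec) (β : B.dual.Sec) m, diffAt B.model (B.lin β) (B.zeroT m) (u ⟨m, c m⟩) =
      β m (D.coreAnchor LDB c m) := fun c β m => h.act_core_lin_eq c β (B.zeroT m)
  have hk : ContMDiff C.model B.model.tangent ∞
      (fun v : C.Tot => (⟨B.zeroT v.1, u v⟩ : TangentBundle B.model B.Tot)) :=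
    LDB.anchor_smooth.comp (D.flip.contMDiff_ker (a := fun v : C.Tot => B.zeroT v.1)
      (c := fun v => v.2) (B.contMDiff_zeroT.comp C.contMDiff_proj) contMDiff_id)
  obtain ⟨l, hl, hl'⟩ := B.exists_lift (p := fun v : C.Tot => v.1) C.contMDiff_proj
    (fun β v => diffAt B.model (B.lin β) (B.zeroT v.1) (u v))
    (fun β => contMDiff_diffAt_apply (B.lin β) hk)
    (fun β β' v => by
      obtain ⟨m, v⟩ := v
      obtain ⟨c, rfl⟩ := C.exists_sec_apply_eq m v
      rw [hu, hu, hu]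
      rfl)
    (fun f β v => by
      obtain ⟨m, v⟩ := v
      obtain ⟨c, rfl⟩ := C.exists_sec_apply_eq m v
      rw [hu, hu]
      rfl)
  refine ⟨fun m => LinearMap.toContinuousLinearMap
    { toFun := fun v => l ⟨m, v⟩
      map_add' := fun v w => B.eq_of_dual_sec fun β => ?_
      map_smul' := fun r v => B.eq_of_dual_sec fun β => ?_ }, hl, fun c m =>
    B.eq_of_dual_sec fun β => (hl' β ⟨m, c m⟩).trans (hu c β m)⟩
  · have h1 : u ⟨m, v + w⟩ = u ⟨m, v⟩ + u ⟨m, w⟩ :=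
      (congrArg (LDB.anchor (B.zeroT m)) (map_add (D.flip.ker (B.zeroT m)) v w)).trans
        (map_add (LDB.anchor (B.zeroT m)) _ _)
    refine (hl' β ⟨m, v + w⟩).trans ?_
    rw [h1, map_add]
    refine Eq.trans ?_ ((show B.V m →L[ℝ] ℝ from β m).map_add _ _).symm
    exact (congrArg₂ (· + ·) (hl' β ⟨m, v⟩) (hl' β ⟨m, w⟩)).symm
  · have h1 : u ⟨m, r • v⟩ = r • u ⟨m, v⟩ :=
      (congrArg (LDB.anchor (B.zeroT m)) (map_smul (D.flip.ker (B.zeroT m)) r v)).trans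
        (map_smul (LDB.anchor (B.zeroT m)) _ _)
    refine (hl' β ⟨m, r • v⟩).trans ?_
    rw [h1, map_smul]
    refine Eq.trans ?_ ((show B.V m →L[ℝ] ℝ from β m).map_smul _ _).symm
    exact congrArg (r • ·) (hl' β ⟨m, v⟩).symm

/-- The core-anchor as a vector bundle morphism. -/
def coreAnchorMap (h : IsVBAlgebroid D LA LDB) (m : M) : C.V m →L[ℝ] B.V m :=
  Classical.choose h.exists_coreAnchorMap m

theorem contMDiff_coreAnchorMap (h : IsVBAlgebroid D LA LDB) :
    ContMDiff C.model B.model ∞ (fun v : C.Tot => (⟨v.1, h.coreAnchorMap v.1 v.2⟩ : B.Tot)) :=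
  (Classical.choose_spec h.exists_coreAnchorMap).1

theorem coreAnchorMap_apply (h : IsVBAlgebroid D LA LDB) (c : C.Sec) (m : M) :
    h.coreAnchorMap m (c m) = D.coreAnchor LDB c m :=
  (Classical.choose_spec h.exists_coreAnchorMap).2 c m

end IsVBAlgebroid

namespace IsDoubleLieAlgebroid

/-- Skew-symmetry is applied first: computing -{ℓ_{c₂}, ℓ_{c₁}} instead puts the two connections in
the stated arrangement. -/
theorem br_ell_ell (hD : IsDoubleLieAlgebroid D LA LB LDA LDB) (S : LinearSplitting D)
    (hr : Module.finrank ℝ A.F + Module.finrank ℝ B.F ≠ 1) (c₁ c₂ : C.Sec) :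
    (hD.cstarPoisson S hr).br (C.ell c₁) (C.ell c₂) = C.ell (S.coreBracket LDA LDB c₁ c₂) := by
  refine ((hD.cstarBr_skew_and_jacobi S hr).1 _ _).trans ?_
  ext γ
  refine (congrArg Neg.neg (hD.cstarBr_ell_ell S c₂ c₁ γ)).trans ?_
  rw [neg_sub, LinearSplitting.coreBracket, C.ell_sub]

/-- {ℓ_c, q^*f} is computed from ρ_B and ∂_B, and {q^*f, ℓ_c} from ρ_A and ∂_A; skew-symmetry
compares them. -/
theorem act_coreAnchor_eq (hD : IsDoubleLieAlgebroid D LA LB LDA LDB) (S : LinearSplitting D)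
    (hr : Module.finrank ℝ A.F + Module.finrank ℝ B.F ≠ 1) (c : C.Sec) (f : C^∞⟮I, M; ℝ⟯)
    (m : M) :
    LA.act (D.flip.coreAnchor LDA c) f m = LB.act (D.coreAnchor LDB c) f m := by
  have h1 := DFunLike.congr_fun ((hD.cstarBr_skew_and_jacobi S hr).1 (C.ell c) (C.dual.pull f))
    (C.dual.zeroT m)
  rw [cstarBr_ell_pull] at h1
  exact (h1.trans ((congrArg Neg.neg (hD.cstarBr_pull_ell S f c _)).trans (neg_neg _))).symm

/-- The Lie algebroid structure on the core. -/
def coreLieAlgebroid (hD : IsDoubleLieAlgebroid D LA LB LDA LDB) (S : LinearSplitting D)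
    (hr : Module.finrank ℝ A.F + Module.finrank ℝ B.F ≠ 1) : LieAlgebroid C where
  anchor m := (LB.anchor m).comp (hD.vbB.coreAnchorMap m)
  anchor_smooth := LB.anchor_smooth.comp hD.vbB.contMDiff_coreAnchorMap
  -- Bilinearity, the alternating property and the Jacobi identity are those of the Poisson bracket,
  -- read through the injective map c ↦ ℓ_c.
  bracket := LinearMap.mk₂ ℝ (S.coreBracket LDA LDB)
    (fun c c' d => C.ell_injective (by
      rw [C.ell_add_eq, ← hD.br_ell_ell S hr, ← hD.br_ell_ell S hr, ← hD.br_ell_ell S hr, C.ell_add_eq, map_add,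
        LinearMap.add_apply]))
    (fun r c d => C.ell_injective (by
      rw [C.ell_smul_eq, ← hD.br_ell_ell S hr, ← hD.br_ell_ell S hr, C.ell_smul_eq, map_smul,
        LinearMap.smul_apply]))
    (fun d c c' => C.ell_injective (by
      rw [C.ell_add_eq, ← hD.br_ell_ell S hr, ← hD.br_ell_ell S hr, ← hD.br_ell_ell S hr, C.ell_add_eq, map_add]))
    (fun r d c => C.ell_injective (by
      rw [C.ell_smul_eq, ← hD.br_ell_ell S hr, ← hD.br_ell_ell S hr, C.ell_smul_eq, map_smul]))
  bracket_self c := C.ell_injective (by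
    rw [LinearMap.mk₂_apply, ← hD.br_ell_ell S hr, PoissonStructure.br_self]
    ext φ
    exact (C.ell_zero φ).symm)
  jacobi c₁ c₂ c₃ := C.ell_injective (by
    simp only [LinearMap.mk₂_apply]
    rw [C.ell_add_eq]
    simp only [← hD.br_ell_ell S hr]
    exact PoissonStructure.jacobi _ _ _ _)
  -- Since ℓ_{fc} = q^*f ℓ_c, this is the Poisson Leibniz rule together with the value of {ℓ_c,
  -- q^*f}.
  leibniz c₁ c₂ f x := C.eq_of_dual_sec fun θ => by
    have h1 : C.ell (C.fsmul f c₂) = C.dual.pull f * C.ell c₂ := by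
      ext φ
      exact C.ell_fsmul f c₂ φ
    have h2 := DFunLike.congr_fun (hD.br_ell_ell S hr c₁ (C.fsmul f c₂)) ⟨x, θ x⟩
    rw [h1, PoissonStructure.leibniz, hD.br_ell_ell] at h2
    have h3 : (hD.cstarPoisson S hr).br (C.ell c₁) (C.dual.pull f) ⟨x, θ x⟩ =
        diffAt I f x (LB.anchor x (hD.vbB.coreAnchorMap x (c₁ x))) := by
      rw [hD.vbB.coreAnchorMap_apply]
      exact hD.cstarBr_ell_pull S c₁ f ⟨x, θ x⟩
    refine h2.symm.trans ?_
    refine Eq.trans ?_ (((show C.V x →L[ℝ] ℝ from θ x).map_add _ _).trans (congrArg₂ (· + ·)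
      ((show C.V x →L[ℝ] ℝ from θ x).map_smul _ _)
      ((show C.V x →L[ℝ] ℝ from θ x).map_smul _ _))).symm
    refine (add_comm _ _).trans ?_
    exact congrArg₂ (· + ·) rfl (congrArg (· * (θ x (c₂ x) : ℝ)) h3)

theorem coreLieAlgebroid_anchor (hD : IsDoubleLieAlgebroid D LA LB LDA LDB)
    (S : LinearSplitting D) (hr : Module.finrank ℝ A.F + Module.finrank ℝ B.F ≠ 1) (c : C.Sec)
    (m : M) : (hD.coreLieAlgebroid S hr).anchor m (c m) = LB.anchor m (D.coreAnchor LDB c m) :=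
  congrArg (LB.anchor m) (hD.vbB.coreAnchorMap_apply c m)

theorem anchor_coreAnchor_eq (hD : IsDoubleLieAlgebroid D LA LB LDA LDB)
    (S : LinearSplitting D) (hr : Module.finrank ℝ A.F + Module.finrank ℝ B.F ≠ 1) (c : C.Sec)
    (m : M) :
    LA.anchor m (D.flip.coreAnchor LDA c m) = LB.anchor m (D.coreAnchor LDB c m) :=
  C.tangent_base_ext fun f => hD.act_coreAnchor_eq S hr c f m

theorem isDualPoisson (hD : IsDoubleLieAlgebroid D LA LB LDA LDB) (S : LinearSplitting D)
    (hr : Module.finrank ℝ A.F + Module.finrank ℝ B.F ≠ 1) :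
    IsDualPoisson (hD.coreLieAlgebroid S hr) (hD.cstarPoisson S hr) where
  ell_ell := hD.br_ell_ell S hr
  ell_pull c f φ := by
    rw [coreLieAlgebroid_anchor]
    exact hD.cstarBr_ell_pull S c f φ
  pull_pull f g := by
    ext γ
    exact hD.cstarBr_pull_pull S f g γ

end IsDoubleLieAlgebroid

end CoreAlgebroid

theorem mainTheorem3 {EM : Type*} [NormedAddCommGroup EM] [NormedSpace ℝ EM]
    [FiniteDimensional ℝ EM] {M : Type*} [TopologicalSpace M] [T2Space M] [SigmaCompactSpace M]
    [ChartedSpace EM M] [IsManifold 𝓘(ℝ, EM) ∞ M]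
    (A B C : SmoothVB 𝓘(ℝ, EM) M) (DA : SmoothVB A.model A.Tot) (DB : SmoothVB B.model B.Tot)
    (D : DoubleVB A B C DA DB)
    (LA : LieAlgebroid A) (LB : LieAlgebroid B) (LDA : LieAlgebroid DA) (LDB : LieAlgebroid DB)
    (hD : IsDoubleLieAlgebroid D LA LB LDA LDB)
    (hrank : Module.finrank ℝ A.F + Module.finrank ℝ B.F ≠ 1)
    (S : LinearSplitting D) :
    ∃ (P : PoissonStructure C.dual.model C.dual.Tot) (LC : LieAlgebroid C),
      (∀ (F G : C^∞⟮C.dual.model, C.dual.Tot; ℝ⟯) (γ : C.dual.Tot),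
        P.br F G γ = diffAt C.dual.model G γ
          (D.cstarSharp LDA LDB γ (diffAt C.dual.model F γ))) ∧
      (∀ (c : C.Sec) (m : M),
        LC.anchor m (c m) = LA.anchor m (D.flip.coreAnchor LDA c m) ∧
        LC.anchor m (c m) = LB.anchor m (D.coreAnchor LDB c m)) ∧
      (∀ c₁ c₂ : C.Sec, LC.bracket c₁ c₂ = S.coreBracket LDA LDB c₁ c₂) ∧
      IsDualPoisson LC P :=
  ⟨hD.cstarPoisson S hrank, hD.coreLieAlgebroid S hrank, hD.cstarBr_apply S,
    fun c m => ⟨(hD.coreLieAlgebroid_anchor S hrank c m).trans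
      (hD.anchor_coreAnchor_eq S hrank c m).symm, hD.coreLieAlgebroid_anchor S hrank c m⟩,
    fun _ _ => rfl, hD.isDualPoisson S hrank⟩

end
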